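/- Let $\rho_0,\rho_1,\pi_0$ be probability measures on $\mathbb{R}^d$. **(i) Mini-batch couplings.** Let $B\ge 1$ and let $c:\mathbb{R}^d\times\mathbb{R}^d\to\mathbb{R}$. Let $\sigma$ assign, measurably, to every pair of batches $x,y\in(\mathbb{R}^d)^B$ a permutation $\sigma$ of $\{1,\dots,B\}$ minimizing $\sum_i c(x_i,y_{\sigma(i)})^2$. Draw independent batches of $B$ i.i.d. samples from $\rho_0$ and from $\rho_1$, and an independent uniform index $i$. Then the joint law $\gamma$ of $(x_i,y_{\sigma(i)})$ has marginals $\rho_0$ and $\rho_1$. **(ii) Marginal preservation.** Let $\gamma$ be any probability measure on $\mathbb{R}^d\times\mathbb{R}^d$ with marginals $\rho_0$ and $\rho_1$ (for instance a mini-batch coupling), with $\int\|x_1-x_0\|^2\,d\gamma<\infty$ and $\int\|v\|^2\,d\pi_0<\infty$. Let the acceleration field $a(x,t,u,\tau)$ minimize, over all measurable fields, $$\mathbb{E}_{(x_0,x_1)\sim\gamma,\;t\sim U[0,1],\;v_0\sim\pi_0,\;\tau\sim U[0,1]}\Big[\big\|(x_1-x_0-v_0)-a(x_t,t,v_\tau,\tau)\big\|^2\Big],$$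 where $x_t=(1-t)x_0+tx_1$ and $v_\tau=(1-\tau)v_0+\tau(x_1-x_0)$ and the four draws are independent. Assume that $a$ is continuous on $\mathbb{R}^d\times[0,1)\times\mathbb{R}^d\times[0,1)$ and Lipschitz in $u$ uniformly on compact subsets of this set. Solutions of the velocity ODE $$du_\tau(z,t)=a(z,t,u_\tau,\tau)\,d\tau$$ are understood to be continuous on $[0,1]$ and to satisfy the equation for $\tau\in[0,1)$. Let $X_t=(1-t)X_0+tX_1$ with $(X_0,X_1)\sim\gamma$. (a) *Coupled ODEs.* Assume that for all $z\in\mathbb{R}^d$ and $t\in[0,1)$ the velocity ODE at $(z,t)$ has a solution for $\pi_0$-almost every initial value, that its endpoint $u_1(z,t)$ is integrable when $u_0\sim\pi_0$, and that the mean velocity $b(z,t)=\mathbb{E}_{u_0\sim\pi_0}[u_1(z,t)]$ is continuous on $\mathbb{R}^d\times[0,1)$ and Lipschitz in $z$ uniformly on compact subsets of this set. Let $(Z_t)_{t\in[0,1]}$ be a process with continuous paths, differentiable on $[0,1)$, with $Z_0\sim\rho_0$ and $$dZ_t=u_1(Z_t,t)\,dt,$$ where, for every $t\in[0,1)$, $(u_\tau(Z_t,t))_{\tau\in[0,1]}$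 almost surely solves the velocity ODE at $(Z_t,t)$ from a source velocity $u_0\sim\pi_0$ independent of $Z_t$. Assume also $\int_0^1\mathbb{E}\|u_1(Z_t,t)\|\,dt<\infty$. Then $Z_t$ and $X_t$ have the same law for every $t\in[0,1]$. (b) *Euler sampling.* Without the assumption on $b$, let $0=s_0<\dots<s_N=1$ be any grid. Let $Z_0\sim\rho_0$ and, for each $k<N$, let $$Z_t=Z_{s_k}+(t-s_k)\,u_1(Z_{s_k},s_k)\qquad (s_k\le t\le s_{k+1}),$$ where $u_1(Z_{s_k},s_k)$ is obtained by solving the velocity ODE at $(Z_{s_k},s_k)$ from a source velocity $u_0\sim\pi_0$ independent of $Z_{s_k}$. Then $Z_t$ and $X_t$ have the same law for every $t\in[0,1]$. -/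

import Mathlib

open MeasureTheory ProbabilityTheory Set
open scoped ENNReal NNReal

noncomputable section

namespace HRF

/-- The sample space `ℝ^d` with its Euclidean norm. -/
abbrev Pt (d : ℕ) : Type := EuclideanSpace ℝ (Fin d)

/-- An acceleration field `a(x, t, u, τ)`. -/
abbrev AccField (d : ℕ) : Type := Pt d → ℝ → Pt d → ℝ → Pt d

variable {d : ℕ}

/-- `a` as a function on the product space. -/
def AccField.flat (a : AccField d) (q : Pt d × ℝ × Pt d × ℝ) : Pt d :=
  a q.1 q.2.1 q.2.2.1 q.2.2.2

/-- Linear interpolation `(1 - s) p + s q`. -/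
def lerp (s : ℝ) (p q : Pt d) : Pt d := (1 - s) • p + s • q

/-- The law of `X_t = (1 - t) X_0 + t X_1` for `(X_0, X_1) ∼ γ`. -/
def interpLaw (γ : Measure (Pt d × Pt d)) (t : ℝ) : Measure (Pt d) :=
  γ.map (fun p => lerp t p.1 p.2)

/-- `γ` is a joint distribution with marginals `ρ₀` and `ρ₁`. -/
structure IsCoupling (ρ₀ ρ₁ : Measure (Pt d)) (γ : Measure (Pt d × Pt d)) : Prop where
  fst_eq : γ.map Prod.fst = ρ₀
  snd_eq : γ.map Prod.snd = ρ₁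

/-! ### Mini-batch couplings -/

/-- `σ` selects, measurably in the two batches `x`, `y` of size `B`, a permutation that solves the
optimal transport problem with cost `c²` between the two empirical distributions. -/
structure IsBatchOT (B : ℕ) (c : Pt d → Pt d → ℝ)
    (σ : (Fin B → Pt d) → (Fin B → Pt d) → Equiv.Perm (Fin B)) : Prop where
  measurable : ∀ p : Equiv.Perm (Fin B),
    MeasurableSet {q : (Fin B → Pt d) × (Fin B → Pt d) | σ q.1 q.2 = p}
  optimal : ∀ (x y : Fin B → Pt d) (p : Equiv.Perm (Fin B)),
    ∑ i, c (x i) (y (σ x y i)) ^ 2 ≤ ∑ i, c (x i) (y (p i)) ^ 2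

/-- The joint distribution of a pair `(x_i, y_{σ(i)})` when `x`, `y` are independent batches of
`B` i.i.d. samples of `ρ₀` and `ρ₁`, and the index `i` is uniform and independent of them. -/
def miniBatchCoupling (ρ₀ ρ₁ : Measure (Pt d)) (B : ℕ)
    (σ : (Fin B → Pt d) → (Fin B → Pt d) → Equiv.Perm (Fin B)) : Measure (Pt d × Pt d) :=
  (B : ℝ≥0∞)⁻¹ • ∑ i : Fin B,
    ((Measure.pi fun _ : Fin B => ρ₀).prod (Measure.pi fun _ : Fin B => ρ₁)).map
      (fun q => (q.1 i, q.2 (σ q.1 q.2 i)))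

/-! ### Training -/

/-- The uniform distribution on `[0, 1]`. -/
def unif : Measure ℝ := volume.restrict (Icc 0 1)

/-- The training objective
`𝔼 ‖(x₁ - x₀ - v₀) - a(x_t, t, v_τ, τ)‖²` over `(x₀, x₁) ∼ γ`, `t ∼ U[0,1]`, `v₀ ∼ π₀`,
`τ ∼ U[0,1]`, with `x_t = (1-t) x₀ + t x₁` and `v_τ = (1-τ) v₀ + τ (x₁ - x₀)`. -/
def trainingLoss (γ : Measure (Pt d × Pt d)) (π₀ : Measure (Pt d)) (a : AccField d) : ℝ≥0∞ :=
  ∫⁻ q : (Pt d × Pt d) × ℝ × Pt d × ℝ,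
    (let x₀ := q.1.1
     let x₁ := q.1.2
     let t := q.2.1
     let v₀ := q.2.2.1
     let τ := q.2.2.2
     ‖(x₁ - x₀ - v₀) - a (lerp t x₀ x₁) t (lerp τ v₀ (x₁ - x₀)) τ‖ₑ ^ 2)
    ∂(γ.prod (unif.prod (π₀.prod unif)))

/-- `a` is trained: it minimizes the objective over all measurable fields. -/
structure IsTrained (γ : Measure (Pt d × Pt d)) (π₀ : Measure (Pt d)) (a : AccField d) :
    Prop where
  measurable : Measurable a.flat
  minimal : ∀ a' : AccField d, Measurable a'.flat → trainingLoss γ π₀ a ≤ trainingLoss γ π₀ a'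

/-! ### Regularity of the fields, on the time intervals `[0, 1)` -/

/-- `a` is continuous for `t, τ ∈ [0, 1)`, and Lipschitz in `u` on compact sets. -/
structure IsRegularAcc (a : AccField d) : Prop where
  continuousOn : ContinuousOn a.flat (univ ×ˢ Ico 0 1 ×ˢ univ ×ˢ Ico 0 1)
  lipschitz : ∀ R : ℝ, ∀ s ∈ Ico (0 : ℝ) 1, ∃ L : ℝ≥0, ∀ z ∈ Metric.closedBall (0 : Pt d) R,
    ∀ t ∈ Icc 0 s, ∀ τ ∈ Icc 0 s,
      LipschitzOnWith L (fun u => a z t u τ) (Metric.closedBall 0 R)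

/-- `b` is continuous for `t ∈ [0, 1)`, and Lipschitz in `z` on compact sets. -/
structure IsRegularVel (b : Pt d → ℝ → Pt d) : Prop where
  continuousOn : ContinuousOn (fun q : Pt d × ℝ => b q.1 q.2) (univ ×ˢ Ico 0 1)
  lipschitz : ∀ R : ℝ, ∀ s ∈ Ico (0 : ℝ) 1, ∃ L : ℝ≥0,
    ∀ t ∈ Icc 0 s, LipschitzOnWith L (fun z => b z t) (Metric.closedBall 0 R)

/-! ### Generation -/

/-- `u` solves the velocity ODE `du_τ = a(z, t, u_τ, τ) dτ` at the location `(z, t)`: it is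
continuous on `[0, 1]` and satisfies the equation on `[0, 1)` (the field may be singular at the
final time). -/
structure IsVelocityPath (a : AccField d) (z : Pt d) (t : ℝ) (u : ℝ → Pt d) : Prop where
  continuousOn : ContinuousOn u (Icc 0 1)
  ode : ∀ τ ∈ Ico (0 : ℝ) 1, HasDerivWithinAt u (a z t (u τ) τ) (Icc 0 1) τ

/-- `b(z, t)` is the mean of the velocity `u_1(z, t)` that the velocity ODE generates at `(z, t)`
from `u_0 ∼ π₀`. -/
def IsMeanVelocity (π₀ : Measure (Pt d)) (a : AccField d) (b : Pt d → ℝ → Pt d) : Prop :=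
  ∀ z : Pt d, ∀ t ∈ Ico (0 : ℝ) 1, ∃ u : Pt d → ℝ → Pt d,
    (∀ᵐ w ∂π₀, u w 0 = w ∧ IsVelocityPath a z t (u w)) ∧
    Integrable (fun w => u w 1) π₀ ∧ ∫ w, u w 1 ∂π₀ = b z t

variable {Ω : Type*} [MeasurableSpace Ω]

/-- The velocity `τ ↦ V τ` is generated at the random location `(Y, t)`: the source velocity
`V 0` has law `π₀` whatever the location is (it is independent of `Y`), and `V` almost surely
solves the velocity ODE at `(Y, t)`. -/
structure IsVelocitySample (P : Measure Ω) (π₀ : Measure (Pt d)) (a : AccField d)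
    (Y : Ω → Pt d) (t : ℝ) (V : ℝ → Ω → Pt d) : Prop where
  measurable : ∀ τ ∈ Icc (0 : ℝ) 1, Measurable (V τ)
  law_zero : P.map (V 0) = π₀
  indep : IndepFun Y (V 0) P
  path : ∀ᵐ ω ∂P, IsVelocityPath a (Y ω) t (fun τ => V τ ω)

/-- `Z` is a time-differentiable process generated by the coupled ODEs
`du_τ(z_t, t) = a(z_t, t, u_τ, τ) dτ`, `u_0 ∼ π₀`, and `dz_t = u_1(z_t, t) dt`, `z_0 ∼ ρ₀`;
here `U t τ = u_τ(Z_t, t)`. Nothing is said about the joint law of the source velocities `U t 0`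
at different times `t`. -/
structure IsGenerated (P : Measure Ω) (ρ₀ π₀ : Measure (Pt d)) (a : AccField d)
    (Z : ℝ → Ω → Pt d) (U : ℝ → ℝ → Ω → Pt d) : Prop where
  measurable : ∀ t ∈ Icc (0 : ℝ) 1, Measurable (Z t)
  law_zero : P.map (Z 0) = ρ₀
  velocity : ∀ t ∈ Ico (0 : ℝ) 1, IsVelocitySample P π₀ a (Z t) t (U t)
  continuousOn : ∀ᵐ ω ∂P, ContinuousOn (fun t => Z t ω) (Icc 0 1)
  position : ∀ᵐ ω ∂P, ∀ t ∈ Ico (0 : ℝ) 1,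
    HasDerivWithinAt (fun t => Z t ω) (U t 1 ω) (Icc 0 1) t
  integrable : ∫⁻ t in Icc (0 : ℝ) 1, ∫⁻ ω, ‖U t 1 ω‖ₑ ∂P < ∞

/-- `Z` is generated by the Euler scheme for the position ODE on the grid
`0 = s 0 < s 1 < ⋯ < s N = 1`, with a new source velocity in every step, and with linear
interpolation between grid points. -/
structure IsEulerGenerated (P : Measure Ω) (ρ₀ π₀ : Measure (Pt d)) (a : AccField d)
    (N : ℕ) (s : ℕ → ℝ) (Z : ℝ → Ω → Pt d) (U : ℕ → ℝ → Ω → Pt d) : Prop where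
  grid_zero : s 0 = 0
  grid_last : s N = 1
  grid_lt : ∀ k < N, s k < s (k + 1)
  measurable : ∀ t ∈ Icc (0 : ℝ) 1, Measurable (Z t)
  law_zero : P.map (Z 0) = ρ₀
  velocity : ∀ k < N, IsVelocitySample P π₀ a (Z (s k)) (s k) (U k)
  position : ∀ k < N, ∀ t ∈ Icc (s k) (s (k + 1)),
    ∀ᵐ ω ∂P, Z t ω = Z (s k) ω + (t - s k) • U k 1 ω

end HRF

end

/-! Part (i). For a fixed index `i` the law of `y_{σ(i)}` need not be `ρ₁`, since `σ` looks at the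
batches. Averaging over `i` repairs this: `σ` is a bijection, so the sum over `σ(i)` is pointwise
the sum over all `j`.

Part (ii) rests on one principle, used twice. Let a process `Y` have a velocity whose conditional
mean given `Y_r` is `v(Y_r, r)`. Then the laws of `Y` solve the continuity equation of `v` weakly,
and for locally Lipschitz `v` the initial law determines the later ones: pair the laws with a
solution of the backward transport equation. `IsMeanFlow` records such processes, with an extra
parameter `ξ` so that laws joint with `ξ` are covered. Solutions of the ODE of `v` need not exist
globally, so the backward solution is replaced by a test function composed with the Euler scheme of
a truncation of `v`, then mollified. The mollification radius is fixed first; the second-order terms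
that it makes large carry a factor of the step size. A spatial cutoff with gradient `O(1/R)` costs
`O(1/R)` times the expected path length, so a first moment of the velocity suffices. The outcome is
`IsMeanFlow.eventually_euler_near`; its pathwise counterpart `IsRegularField.eventually_euler_near`
says that the same scheme follows true solutions.

First use: a least-squares minimizer is the conditional mean of the acceleration given `(x_t, v_τ)`.
Continuity of `a` upgrades this from almost all to all times in `[0, 1)` (`IsTrained.integral_eq`).
So, for fixed `t`, the training velocities `τ ↦ v_τ` are a mean flow of `a` with parameter `x_t`,
and the velocity ODE started from `π₀` at a location distributed as `X_t` produces the joint law of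
`(X_t, X_1 - X_0)` (`IsTrained.map_velocitySample`). The final time `τ = 1`, where `a` may be
singular, is reached as a limit.

This gives (b) at once: since `X_s + (t - s)(X_1 - X_0) = X_t`, every Euler step is exact in law.

Second use, for (a): the mean `b(z, t)` is the conditional mean of `X_1 - X_0` given `X_t = z`, and
also that of the generated velocity given `Z_t = z`. Hence `X` and `Z` are mean flows of `b` with
the same initial law, and `IsMeanFlow.map_eq` identifies their laws before time `1`; continuity of
paths gives `t = 1`. -/

noncomputable section

set_option linter.unusedSectionVars false

namespace HRF

variable {d : ℕ}

/-! ### Marginals of mini-batch couplings -/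

section MiniBatch

variable {B : ℕ} {c : Pt d → Pt d → ℝ} {σ : (Fin B → Pt d) → (Fin B → Pt d) → Equiv.Perm (Fin B)}

lemma IsBatchOT.measurable_pair (h : IsBatchOT B c σ) (i : Fin B) :
    Measurable fun q : (Fin B → Pt d) × (Fin B → Pt d) => (q.1 i, q.2 (σ q.1 q.2 i)) := by
  let _ : MeasurableSpace (Equiv.Perm (Fin B)) := ⊤
  have hσ : Measurable fun q : (Fin B → Pt d) × (Fin B → Pt d) => σ q.1 q.2 :=
    measurable_to_countable' h.measurable
  have hG : Measurable fun r : ((Fin B → Pt d) × (Fin B → Pt d)) × Equiv.Perm (Fin B) =>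
      r.1.2 (r.2 i) :=
    measurable_from_prod_countable_left fun p => by dsimp only; fun_prop
  exact (by fun_prop : Measurable fun q : (Fin B → Pt d) × (Fin B → Pt d) => q.1 i).prodMk
    (hG.comp (measurable_id.prodMk hσ))

/-- Each `x_i` already has law `ρ₀`. For the other marginal only the average over `i` is right,
because a permutation merely reorders the batch `y`. -/
lemma IsBatchOT.isCoupling_miniBatchCoupling {ρ₀ ρ₁ : Measure (Pt d)} [IsProbabilityMeasure ρ₀]
    [IsProbabilityMeasure ρ₁] (hB : 0 < B) (h : IsBatchOT B c σ) :
    IsCoupling ρ₀ ρ₁ (miniBatchCoupling ρ₀ ρ₁ B σ) := by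
  have hB0 : (B : ℝ≥0∞) ≠ 0 := by exact_mod_cast hB.ne'
  have hBt : (B : ℝ≥0∞) ≠ ∞ := ENNReal.natCast_ne_top B
  set M := (Measure.pi fun _ : Fin B => ρ₀).prod (Measure.pi fun _ : Fin B => ρ₁) with hM
  constructor
  · ext A hA
    rw [miniBatchCoupling, ← hM, Measure.map_apply measurable_fst hA, Measure.smul_apply,
      Measure.finsetSum_apply]
    have : ∀ i : Fin B, (M.map (fun q => (q.1 i, q.2 (σ q.1 q.2 i)))) (Prod.fst ⁻¹' A) = ρ₀ A := by
      intro i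
      rw [← Measure.map_apply measurable_fst hA, Measure.map_map measurable_fst
        (h.measurable_pair i)]
      have : M.map (fun q => q.1 i) = ρ₀ := by
        have h1 : (fun q : (Fin B → Pt d) × (Fin B → Pt d) => q.1 i) =
          (Function.eval i) ∘ Prod.fst := rfl
        rw [h1, ← Measure.map_map (measurable_pi_apply i) measurable_fst, hM,
          Measure.map_fst_prod, measure_univ, one_smul]
        exact (measurePreserving_eval _ i).map_eq
      exact congrArg (fun m => m A) this
    simp only [this, Finset.sum_const, Finset.card_univ, Fintype.card_fin, nsmul_eq_mul,
      smul_eq_mul]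
    rw [← mul_assoc, ENNReal.inv_mul_cancel hB0 hBt, one_mul]
  · ext A hA
    rw [miniBatchCoupling, ← hM, Measure.map_apply measurable_snd hA, Measure.smul_apply,
      Measure.finsetSum_apply]
    have h2 : ∀ j : Fin B, M.map (fun q => q.2 j) = ρ₁ := by
      intro j
      have h1 : (fun q : (Fin B → Pt d) × (Fin B → Pt d) => q.2 j) =
        (Function.eval j) ∘ Prod.snd := rfl
      rw [h1, ← Measure.map_map (measurable_pi_apply j) measurable_snd, hM,
        Measure.map_snd_prod, measure_univ, one_smul]
      exact (measurePreserving_eval _ j).map_eq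
    have h3 : ∀ i : Fin B, (M.map (fun q => (q.1 i, q.2 (σ q.1 q.2 i)))) (Prod.snd ⁻¹' A)
        = ∫⁻ q, A.indicator 1 (q.2 (σ q.1 q.2 i)) ∂M := by
      intro i
      rw [← lintegral_indicator_one (measurable_snd hA), lintegral_map
        (measurable_one.indicator (measurable_snd hA)) (h.measurable_pair i)]
      rfl
    have h4 : ∀ j : Fin B, ∫⁻ q, A.indicator 1 (q.2 j) ∂M = ρ₁ A := by
      intro j
      rw [← h2 j, Measure.map_apply (by fun_prop) hA,
        ← lintegral_indicator_one ((by fun_prop : Measurable fun q : (Fin B → Pt d) ×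
          (Fin B → Pt d) => q.2 j) hA)]
      rfl
    simp only [h3]
    rw [← lintegral_finsetSum']
    -- The sum is reindexed by `σ` separately for each pair of batches, before integrating; this
    -- removes the dependence of `σ` on the batches.
    · have h5 : ∀ q : (Fin B → Pt d) × (Fin B → Pt d),
          ∑ i, A.indicator (1 : Pt d → ℝ≥0∞) (q.2 (σ q.1 q.2 i))
            = ∑ j, A.indicator (1 : Pt d → ℝ≥0∞) (q.2 j) := fun q =>
        Equiv.sum_comp (σ q.1 q.2) fun j => A.indicator (1 : Pt d → ℝ≥0∞) (q.2 j)
      simp only [h5]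
      rw [lintegral_finsetSum']
      · simp only [h4, Finset.sum_const, Finset.card_univ, Fintype.card_fin, nsmul_eq_mul,
          smul_eq_mul]
        rw [← mul_assoc, ENNReal.inv_mul_cancel hB0 hBt, one_mul]
      · intro j _
        exact ((measurable_one.indicator hA).comp (by fun_prop)).aemeasurable
    · intro i _
      exact ((measurable_one.indicator hA).comp
        (measurable_snd.comp (h.measurable_pair i))).aemeasurable

end MiniBatch

/-! ### Mollification of Lipschitz functions -/

section Mollifier

open Measure

variable {E : Type*} [NormedAddCommGroup E] [NormedSpace ℝ E] [FiniteDimensional ℝ E]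
  [MeasurableSpace E] [BorelSpace E]

/-- `η` is a smooth probability density supported in the ball of radius `ε`. -/
structure IsMollifier (η : E → ℝ) (ε : ℝ) : Prop where
  contDiff : ContDiff ℝ 2 η
  hasCompactSupport : HasCompactSupport η
  nonneg : ∀ y, 0 ≤ η y
  integral_eq_one : ∫ y, η y ∂(addHaar : Measure E) = 1
  eq_zero : ∀ y, ε < ‖y‖ → η y = 0

lemma exists_isMollifier {ε : ℝ} (hε : 0 < ε) : ∃ η : E → ℝ, IsMollifier η ε := by
  let f : ContDiffBump (0 : E) := ⟨ε / 2, ε, by positivity, by linarith⟩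
  refine ⟨f.normed addHaar, f.contDiff_normed, f.hasCompactSupport_normed, f.nonneg_normed,
    f.integral_normed, fun y hy => ?_⟩
  have : y ∉ Function.support (f.normed (addHaar : Measure E)) := by
    rw [f.support_normed_eq]
    simp only [Metric.mem_ball, dist_zero_right, not_lt]
    exact hy.le
  simpa using this

/-- Convolution of `φ` with the density `η`. -/
def mollify (η φ : E → ℝ) (x : E) : ℝ := ∫ y, η y * φ (x - y) ∂(addHaar : Measure E)

/-- The derivative of the convolution of `φ` with the density `η`. -/
def mollifyDeriv (η φ : E → ℝ) (x : E) : E →L[ℝ] ℝ :=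
  ∫ y, φ y • fderiv ℝ η (x - y) ∂(addHaar : Measure E)

namespace IsMollifier

variable {η : E → ℝ} {ε : ℝ} (hη : IsMollifier η ε) {φ φ' : E → ℝ}
include hη

lemma integrable : Integrable η (addHaar : Measure E) :=
  hη.contDiff.continuous.integrable_of_hasCompactSupport hη.hasCompactSupport

lemma integrable_mul (hφ : Continuous φ) (x : E) :
    Integrable (fun y => η y * φ (x - y)) (addHaar : Measure E) := by
  refine Continuous.integrable_of_hasCompactSupport ?_ ?_
  · exact hη.contDiff.continuous.mul (by fun_prop)
  · exact hη.hasCompactSupport.mul_right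

/-- A mollification is an average over the `ε`-ball, so a bound that holds on that ball passes to
it. The other estimates on `mollify` reduce to this one. -/
lemma abs_mollify_sub_const_le (hφ : Continuous φ) {x : E} {a c : ℝ}
    (h : ∀ y, ‖y‖ ≤ ε → |φ (x - y) - a| ≤ c) : |mollify η φ x - a| ≤ c := by
  have h1 : mollify η φ x - a = ∫ y, η y * (φ (x - y) - a) ∂(addHaar : Measure E) := by
    simp_rw [mul_sub]
    rw [integral_sub (hη.integrable_mul hφ x) (hη.integrable.mul_const a), integral_mul_const,
      hη.integral_eq_one, one_mul, mollify]
  rw [h1]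
  calc |∫ y, η y * (φ (x - y) - a) ∂(addHaar : Measure E)|
      ≤ ∫ y, η y * c ∂(addHaar : Measure E) := by
        rw [← Real.norm_eq_abs]
        refine norm_integral_le_of_norm_le (hη.integrable.mul_const c) (.of_forall fun y => ?_)
        rw [norm_mul, Real.norm_of_nonneg (hη.nonneg y), Real.norm_eq_abs]
        by_cases hy : ‖y‖ ≤ ε
        · exact mul_le_mul_of_nonneg_left (h y hy) (hη.nonneg y)
        · simp [hη.eq_zero y (not_le.1 hy)]
    _ = c := by rw [integral_mul_const, hη.integral_eq_one, one_mul]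

/-- The two averages are compared shift by shift, with the same `y`. It gives Lipschitz bounds when
`φ = φ'`, and later shows that mollification almost commutes with an Euler step. -/
lemma abs_mollify_sub_mollify_le (hφ : Continuous φ) (hφ' : Continuous φ') {x x' : E} {c : ℝ}
    (h : ∀ y, ‖y‖ ≤ ε → |φ (x - y) - φ' (x' - y)| ≤ c) :
    |mollify η φ x - mollify η φ' x'| ≤ c := by
  have h1 : mollify η φ x - mollify η φ' x'
      = mollify η (fun v => φ v - φ' (v + (x' - x))) x - 0 := by
    rw [mollify, mollify, mollify, ← integral_sub (hη.integrable_mul hφ x)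
      (hη.integrable_mul hφ' x'), sub_zero]
    congr 1; ext y
    rw [mul_sub]
    congr 3
    abel
  rw [h1]
  refine hη.abs_mollify_sub_const_le (by fun_prop) fun y hy => ?_
  have := h y hy
  rwa [sub_zero, show x - y + (x' - x) = x' - y by abel]

lemma abs_mollify_le (hφ : Continuous φ) {M : ℝ} (hM : ∀ x, |φ x| ≤ M) (x : E) :
    |mollify η φ x| ≤ M := by
  simpa using hη.abs_mollify_sub_const_le hφ (x := x) (a := 0) (c := M)
    fun y _ => by simpa using hM _

lemma hasFDerivAt_mollify (hφ : Continuous φ) (x : E) :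
    HasFDerivAt (mollify η φ) (mollifyDeriv η φ x) x := by
  have h := HasCompactSupport.hasFDerivAt_convolution_right (ContinuousLinearMap.mul ℝ ℝ)
    hη.hasCompactSupport (hφ.locallyIntegrable (μ := (addHaar : Measure E)))
    (hη.contDiff.of_le (by norm_num)) x
  have e1 : (mollify η φ) = (convolution φ η (ContinuousLinearMap.mul ℝ ℝ) addHaar) := by
    ext x
    rw [mollify, convolution_eq_swap]
    simp only [ContinuousLinearMap.mul_apply']
    congr 1; ext y; ring
  rw [e1]
  exact h

lemma norm_mollifyDeriv_le (hφ : Continuous φ) {G : ℝ≥0} (hG : LipschitzWith G φ) (x : E) :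
    ‖mollifyDeriv η φ x‖ ≤ G := by
  refine (hη.hasFDerivAt_mollify hφ x).le_of_lipschitz
    (LipschitzWith.of_dist_le_mul fun u v => ?_)
  rw [Real.dist_eq]
  refine hη.abs_mollify_sub_mollify_le hφ hφ fun y _ => ?_
  simpa [Real.dist_eq] using hG.dist_le_mul (u - y) (v - y)

/-- The derivative is moved onto `η`, so the constant depends only on `η` and on the sup bound of
`φ`. This uniformity allows the number of Euler steps to grow while `η` stays fixed. -/
lemma exists_lipschitzWith_mollifyDeriv (M : ℝ≥0) : ∃ K : ℝ≥0, ∀ φ : E → ℝ, Continuous φ →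
    (∀ x, |φ x| ≤ M) → LipschitzWith K (mollifyDeriv η φ) := by
  have hc : ContDiff ℝ 1 (fderiv ℝ η) := hη.contDiff.fderiv_right (by norm_num)
  obtain ⟨l, hl⟩ := hc.lipschitzWith_of_hasCompactSupport (hη.hasCompactSupport.fderiv ℝ)
    (by norm_num)
  have hz : ∀ y, ε < ‖y‖ → fderiv ℝ η y = 0 := by
    intro y hy
    have : η =ᶠ[nhds y] fun _ => 0 := by
      filter_upwards [(isOpen_lt continuous_const continuous_norm).mem_nhds hy] with v hv
      exact hη.eq_zero v hv
    rw [this.fderiv_eq, fderiv_const_apply]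
  set V : ℝ≥0 := ((addHaar : Measure E) (Metric.closedBall 0 ε)).toNNReal with hV
  have hVr : ∀ x : E, (addHaar : Measure E).real (Metric.closedBall x ε) = V := by
    intro x
    rw [Measure.real, Measure.addHaar_closedBall_center]; rfl
  refine ⟨M * l * (2 * V), fun φ hφ hM => LipschitzWith.of_dist_le_mul fun x x' => ?_⟩
  have hi : ∀ x, Integrable (fun y => φ y • fderiv ℝ η (x - y)) (addHaar : Measure E) := by
    intro x
    refine Continuous.integrable_of_hasCompactSupport ?_ ?_
    · exact hφ.smul (hc.continuous.comp (by fun_prop))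
    · have : HasCompactSupport fun y => fderiv ℝ η (x - y) :=
        (hη.hasCompactSupport.fderiv ℝ).comp_homeomorph (Homeomorph.subLeft x)
      exact this.smul_left (f := φ)
  rw [dist_eq_norm, mollifyDeriv, mollifyDeriv, ← integral_sub (hi x) (hi x')]
  -- Both integrands vanish off the `ε`-balls around `x` and `x'`, so the region of integration has
  -- volume at most twice that of one ball.
  set S : Set E := Metric.closedBall x ε ∪ Metric.closedBall x' ε
  have hS : MeasurableSet S := Metric.isClosed_closedBall.measurableSet.union
    Metric.isClosed_closedBall.measurableSet
  have hSf : (addHaar : Measure E) S ≠ ∞ :=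
    (measure_union_lt_top measure_closedBall_lt_top measure_closedBall_lt_top).ne
  calc ‖∫ y, (φ y • fderiv ℝ η (x - y) - φ y • fderiv ℝ η (x' - y)) ∂(addHaar : Measure E)‖
      ≤ ∫ y, S.indicator (fun _ => (M * l * dist x x' : ℝ)) y ∂(addHaar : Measure E) := by
        refine norm_integral_le_of_norm_le
          ((integrable_indicator_iff hS).2 (integrableOn_const hSf)) (.of_forall fun y => ?_)
        by_cases hy : y ∈ S
        · rw [indicator_of_mem hy, ← smul_sub, norm_smul, mul_assoc, Real.norm_eq_abs]
          refine mul_le_mul (hM y) ?_ (norm_nonneg _) M.2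
          rw [← dist_eq_norm]
          simpa using hl.dist_le_mul (x - y) (x' - y)
        · simp only [S, mem_union, Metric.mem_closedBall, not_or, not_le] at hy
          rw [hz (x - y) (by rw [← dist_eq_norm, dist_comm]; exact hy.1),
            hz (x' - y) (by rw [← dist_eq_norm, dist_comm]; exact hy.2)]
          simp only [smul_zero, sub_zero, norm_zero]
          exact indicator_nonneg (fun _ _ => by positivity) _
    _ = (addHaar : Measure E).real S * (M * l * dist x x') := by
        rw [integral_indicator_const _ hS, smul_eq_mul]
    _ ≤ (V + V) * (M * l * dist x x') := by
        gcongr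
        refine (measureReal_union_le _ _).trans (by rw [hVr, hVr])
    _ = ↑(M * l * (2 * V)) * dist x x' := by push_cast; ring

end IsMollifier

variable {Z : Type*} [MeasurableSpace Z]

lemma measurable_mollify {η : E → ℝ} (hη : Measurable η) {φ : Z × E → ℝ} (hφ : Measurable φ) :
    Measurable fun q : Z × E => mollify η (fun u => φ (q.1, u)) q.2 := by
  have : Measurable fun r : (Z × E) × E => η r.2 * φ (r.1.1, r.1.2 - r.2) := by fun_prop
  exact (this.stronglyMeasurable.integral_prod_right (ν := (addHaar : Measure E))).measurable

lemma measurable_mollifyDeriv {η : E → ℝ} (hη : ContDiff ℝ 2 η) {φ : Z × E → ℝ}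
    (hφ : Measurable φ) :
    Measurable fun q : Z × E => mollifyDeriv η (fun u => φ (q.1, u)) q.2 := by
  have h1 : Measurable (fderiv ℝ η) := (hη.continuous_fderiv (by norm_num)).measurable
  have : Measurable fun r : (Z × E) × E => φ (r.1.1, r.2) • fderiv ℝ η (r.1.2 - r.2) := by
    fun_prop
  exact (this.stronglyMeasurable.integral_prod_right (ν := (addHaar : Measure E))).measurable

end Mollifier

/-! ### Processes with prescribed conditional mean velocity -/

section MeanFlow

variable {E : Type*} [NormedAddCommGroup E] [NormedSpace ℝ E] [FiniteDimensional ℝ E]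
  [MeasurableSpace E] [BorelSpace E] {Z : Type*} [MeasurableSpace Z]
  {Ω : Type*} [MeasurableSpace Ω]

/-- The process `Y` with velocity `C` and parameter `ξ` has, on `[0, T]`, the conditional mean
velocity `v (ξ, Y_r, r)` given `(ξ, Y_r)`. -/
structure IsMeanFlow (P : Measure Ω) (T : ℝ) (ξ : Ω → Z) (Y C : ℝ → Ω → E)
    (v : Z → E → ℝ → E) : Prop where
  measurable_param : Measurable ξ
  measurable_pos : Measurable (Function.uncurry Y)
  measurable_vel : Measurable (Function.uncurry C)
  continuousOn : ∀ᵐ ω ∂P, ContinuousOn (fun r => Y r ω) (Icc 0 T)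
  hasDerivAt : ∀ᵐ ω ∂P, ∀ r ∈ Ioo 0 T, HasDerivAt (fun r => Y r ω) (C r ω) r
  integrable : Integrable (Function.uncurry C) ((volume.restrict (Ioc 0 T)).prod P)
  mean : ∀ᵐ r ∂volume.restrict (Ioc 0 T), ∀ l : Z × E → E →L[ℝ] ℝ, Measurable l →
    (∃ K, ∀ q, ‖l q‖ ≤ K) →
    ∫ ω, l (ξ ω, Y r ω) (C r ω) ∂P = ∫ ω, l (ξ ω, Y r ω) (v (ξ ω) (Y r ω) r) ∂P

lemma _root_.Measurable.clm_apply_vec {α : Type*} [MeasurableSpace α] {l : α → E →L[ℝ] ℝ}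
    {f : α → E} (hl : Measurable l) (hf : Measurable f) : Measurable fun a => l a (f a) := by
  have hb : IsBoundedBilinearMap ℝ fun p : (E →L[ℝ] ℝ) × E => p.1 p.2 :=
    isBoundedBilinearMap_apply
  exact hb.continuous.measurable.comp (hl.prodMk hf)

variable {P : Measure Ω} [IsProbabilityMeasure P] {T : ℝ} {ξ : Ω → Z} {Y C : ℝ → Ω → E}
  {v : Z → E → ℝ → E}

namespace IsMeanFlow

lemma measurable_pos_at (h : IsMeanFlow P T ξ Y C v) (r : ℝ) : Measurable (Y r) :=
  h.measurable_pos.of_uncurry_left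

lemma integrable_Ioc (h : IsMeanFlow P T ξ Y C v) {s t : ℝ} (hs : 0 ≤ s) (ht : t ≤ T) :
    Integrable (Function.uncurry C) ((volume.restrict (Ioc s t)).prod P) :=
  h.integrable.mono_measure
    (by
      rw [← Measure.restrict_univ (μ := P), Measure.prod_restrict, Measure.prod_restrict]
      exact Measure.restrict_mono (prod_mono (Ioc_subset_Ioc hs ht) le_rfl) le_rfl)

lemma intervalIntegrable (h : IsMeanFlow P T ξ Y C v) :
    ∀ᵐ ω ∂P, Integrable (fun r => C r ω) (volume.restrict (Ioc 0 T)) :=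
  h.integrable.prod_left_ae

lemma norm_sub_le (h : IsMeanFlow P T ξ Y C v) {s t : ℝ} (hs : 0 ≤ s) (ht : t ≤ T) :
    ∀ᵐ ω ∂P, ∀ r ∈ Ioc s t, ‖Y r ω - Y s ω‖ ≤ ∫ q in Ioc s t, ‖C q ω‖ := by
  filter_upwards [h.continuousOn, h.hasDerivAt, h.intervalIntegrable] with ω h1 h2 h3 r hr
  have hi : IntegrableOn (fun r => C r ω) (Ioc s t) := h3.mono_measure
    (Measure.restrict_mono (Ioc_subset_Ioc hs ht) le_rfl)
  have hi' : IntegrableOn (fun r => C r ω) (Ioc s r) := hi.mono_set (Ioc_subset_Ioc_right hr.2)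
  rw [← intervalIntegral.integral_eq_sub_of_hasDerivAt_of_le hr.1.le
    (h1.mono (Icc_subset_Icc hs (hr.2.trans ht)))
    (fun x hx => h2 x (Ioo_subset_Ioo hs (hr.2.trans ht) hx))
    ((intervalIntegrable_iff_integrableOn_Ioc_of_le hr.1.le).2 hi'),
    intervalIntegral.integral_of_le hr.1.le]
  refine (norm_integral_le_integral_norm _).trans ?_
  exact setIntegral_mono_set hi.norm (.of_forall fun _ => norm_nonneg _)
    (Ioc_subset_Ioc_right hr.2).eventuallyLE

lemma integral_norm_sub_le (h : IsMeanFlow P T ξ Y C v) {s t : ℝ} (hs : 0 ≤ s) (ht : t ≤ T)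
    {r : ℝ} (hr : r ∈ Ioc s t) :
    Integrable (fun ω => ‖Y r ω - Y s ω‖) P ∧
    ∫ ω, ‖Y r ω - Y s ω‖ ∂P ≤ ∫ q in Ioc s t, ∫ ω, ‖C q ω‖ ∂P := by
  have hI := (h.integrable_Ioc hs ht).norm
  have hb : Integrable (fun ω => ∫ q in Ioc s t, ‖C q ω‖) P := hI.integral_prod_right
  have hle := h.norm_sub_le hs ht
  have hint : Integrable (fun ω => ‖Y r ω - Y s ω‖) P := by
    refine hb.mono' ((h.measurable_pos_at r).sub (h.measurable_pos_at s)).norm.aestronglyMeasurable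
      ?_
    filter_upwards [hle] with ω hω
    rw [norm_norm]
    exact hω r hr
  refine ⟨hint, (integral_mono_ae hint hb (hle.mono fun ω hω => hω r hr)).trans ?_⟩
  rw [← integral_integral_swap (f := fun q ω => ‖C q ω‖) hI]

/-- Fundamental theorem of calculus in expectation. -/
lemma integral_sub_eq (h : IsMeanFlow P T ξ Y C v) {s t : ℝ} (hs : 0 ≤ s) (hst : s ≤ t)
    (ht : t ≤ T) {Q : Z × E → ℝ} {DQ : Z × E → E →L[ℝ] ℝ} (hQ : Measurable Q)
    (hDQ : Measurable DQ) {M K : ℝ} (hM : ∀ q, |Q q| ≤ M) (hK : ∀ q, ‖DQ q‖ ≤ K)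
    (hd : ∀ z u, HasFDerivAt (fun u => Q (z, u)) (DQ (z, u)) u) :
    Integrable (fun r => ∫ ω, DQ (ξ ω, Y r ω) (C r ω) ∂P) (volume.restrict (Ioc s t)) ∧
    ∫ ω, Q (ξ ω, Y t ω) ∂P - ∫ ω, Q (ξ ω, Y s ω) ∂P
      = ∫ r in Ioc s t, ∫ ω, DQ (ξ ω, Y r ω) (C r ω) ∂P := by
  have hI := h.integrable_Ioc hs ht
  have hprod : Integrable (Function.uncurry fun r ω => DQ (ξ ω, Y r ω) (C r ω))
      ((volume.restrict (Ioc s t)).prod P) := by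
    refine (hI.norm.const_mul K).mono' ?_ (.of_forall fun x => ?_)
    · have h1 : Measurable fun x : ℝ × Ω => DQ (ξ x.2, Y x.1 x.2) :=
        hDQ.comp ((h.measurable_param.comp measurable_snd).prodMk h.measurable_pos)
      exact (h1.clm_apply_vec h.measurable_vel).aestronglyMeasurable
    · exact ((DQ _).le_opNorm _).trans (mul_le_mul_of_nonneg_right (hK _) (norm_nonneg _))
  refine ⟨hprod.integral_prod_left, ?_⟩
  have hQi : ∀ r, Integrable (fun ω => Q (ξ ω, Y r ω)) P := fun r =>
    .of_bound (hQ.comp (h.measurable_param.prodMk (h.measurable_pos_at r))).aestronglyMeasurable M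
      (.of_forall fun ω => hM _)
  rw [integral_integral_swap hprod, ← integral_sub (hQi t) (hQi s)]
  refine integral_congr_ae ?_
  filter_upwards [h.continuousOn, h.hasDerivAt, hprod.prod_left_ae] with ω h1 h2 h3
  rw [← intervalIntegral.integral_of_le hst,
    intervalIntegral.integral_eq_sub_of_hasDerivAt_of_le
      (f := fun r => Q (ξ ω, Y r ω)) hst]
  · have hc : Continuous fun u => Q (ξ ω, u) :=
      continuous_iff_continuousAt.2 fun u => (hd (ξ ω) u).continuousAt
    exact hc.comp_continuousOn (h1.mono (Icc_subset_Icc hs ht))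
  · intro r hr
    exact (hd (ξ ω) (Y r ω)).comp_hasDerivAt r (h2 r (Ioo_subset_Ioo hs ht hr))
  · exact (intervalIntegrable_iff_integrableOn_Ioc_of_le hst).2 h3

/-- One step of the duality argument. -/
lemma abs_step_le (h : IsMeanFlow P T ξ Y C v) {s δ : ℝ} (hs : 0 ≤ s) (hδ : 0 ≤ δ)
    (ht : s + δ ≤ T) {S : Set Z} (hS : MeasurableSet S) {χ : E → ℝ} {c : ℝ≥0}
    (hχ : ContDiff ℝ 1 χ) (hχ0 : ∀ u, 0 ≤ χ u) (hχ1 : ∀ u, χ u ≤ 1) (hχc : LipschitzWith c χ)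
    {w : Z → E → ℝ → E} {L V : ℝ≥0} {ρ : ℝ} (hw : ∀ r, Measurable fun q : Z × E => w q.1 q.2 r)
    (hwv : ∀ z ∈ S, ∀ u, χ u ≠ 0 → ∀ r ∈ Icc 0 T, w z u r = v z u r)
    (hL : ∀ z, ∀ r ∈ Icc 0 T, LipschitzWith L fun u => w z u r) (hV : ∀ z u r, ‖w z u r‖ ≤ V)
    (hρ : ∀ z u, ∀ r ∈ Icc s (s + δ), ‖w z u r - w z u s‖ ≤ ρ)
    {ψ ψ' : Z × E → ℝ} {D : Z × E → E →L[ℝ] ℝ} (hψ : Measurable ψ) (hψ' : Measurable ψ')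
    (hD : Measurable D) (hd : ∀ z u, HasFDerivAt (fun u => ψ' (z, u)) (D (z, u)) u)
    {M G K : ℝ≥0} {κ : ℝ} (hψM : ∀ q, |ψ q| ≤ M) (hM : ∀ q, |ψ' q| ≤ M) (hG : ∀ q, ‖D q‖ ≤ G)
    (hK : ∀ z, LipschitzWith K fun u => D (z, u))
    (hκ : ∀ z u, |ψ (z, u) - ψ' (z, u) - δ * D (z, u) (w z u s)| ≤ κ * δ) :
    |∫ ω, S.indicator 1 (ξ ω) * χ (Y (s + δ) ω) * ψ' (ξ ω, Y (s + δ) ω) ∂P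
      - ∫ ω, S.indicator 1 (ξ ω) * χ (Y s ω) * ψ (ξ ω, Y s ω) ∂P|
    ≤ (M * c + δ * (c * G * V + K * V + G * L)) * (∫ q in Ioc s (s + δ), ∫ ω, ‖C q ω‖ ∂P)
      + δ * (κ + G * ρ) := by
  have hsT : s ∈ Icc 0 T := ⟨hs, by linarith⟩
  set A := ∫ q in Ioc s (s + δ), ∫ ω, ‖C q ω‖ ∂P with hA
  let g : Z → ℝ := S.indicator 1
  have hg : Measurable g := measurable_one.indicator hS
  have hg1 : ∀ z, |g z| ≤ 1 := fun z => by
    by_cases hz : z ∈ S <;> simp [g, hz]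
  have hχa : ∀ u, |χ u| ≤ 1 := fun u => abs_le.2 ⟨by linarith [hχ0 u], hχ1 u⟩
  have hDχ : ∀ u, ‖fderiv ℝ χ u‖ ≤ c := fun u => norm_fderiv_le_of_lipschitz ℝ hχc
  have hχm : Measurable χ := hχ.continuous.measurable
  have hDχm : Measurable (fderiv ℝ χ) := (hχ.continuous_fderiv (by norm_num)).measurable
  let Q : Z × E → ℝ := fun q => g q.1 * χ q.2 * ψ' q
  -- Product rule for `Q`: in `D1` the derivative falls on `ψ'`, in `D2` on the cutoff. The second
  -- part is pure error, at most `M * c` times the speed.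
  let D1 : Z × E → E →L[ℝ] ℝ := fun q => (g q.1 * χ q.2) • D q
  let D2 : Z × E → E →L[ℝ] ℝ := fun q => (g q.1 * ψ' q) • fderiv ℝ χ q.2
  have hD1m : Measurable D1 := by fun_prop
  have hD2m : Measurable D2 := by fun_prop
  have hgχ : ∀ z u, |g z * χ u| ≤ 1 := fun z u => by
    rw [abs_mul]; exact mul_le_one₀ (hg1 _) (abs_nonneg _) (hχa _)
  have hD1b : ∀ q, ‖D1 q‖ ≤ G := fun q => by
    rw [norm_smul, Real.norm_eq_abs]
    simpa using mul_le_mul (hgχ q.1 q.2) (hG q) (norm_nonneg _) zero_le_one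
  have hD2b : ∀ q, ‖D2 q‖ ≤ M * c := fun q => by
    rw [norm_smul, Real.norm_eq_abs, abs_mul]
    have := mul_le_mul (hg1 q.1) (hM q) (abs_nonneg _) zero_le_one
    rw [one_mul] at this
    exact mul_le_mul this (hDχ q.2) (norm_nonneg _) M.2
  obtain ⟨hint, heq⟩ := h.integral_sub_eq hs (by linarith : s ≤ s + δ) ht (Q := Q)
    (DQ := fun q => D1 q + D2 q) (by fun_prop) (by fun_prop) (M := M) (K := G + M * c)
    (fun q => by
      rw [abs_mul]
      simpa using mul_le_mul (hgχ q.1 q.2) (hM q) (abs_nonneg _) zero_le_one)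
    (fun q => (norm_add_le _ _).trans (add_le_add (hD1b q) (hD2b q)))
    (fun z u => by
      have h1 : HasFDerivAt χ (fderiv ℝ χ u) u :=
        (hχ.differentiable (by norm_num) u).hasFDerivAt
      have h2 := ((h1.mul (hd z u)).const_mul (g z))
      refine (h2.congr_of_eventuallyEq (.of_forall fun y => ?_)).congr_fderiv ?_
      · simp only [Q, mul_assoc]; rfl
      · simp only [D1, D2, smul_add, smul_smul])
  -- The drift frozen at the initial time and position of the step. It appears in the increment of
  -- `Q` in time and, through `hκ`, in the change from `ψ` to `ψ'`; the two occurrences cancel.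
  let c0 : ℝ := ∫ ω, D1 (ξ ω, Y s ω) (w (ξ ω) (Y s ω) s) ∂P
  have hξ := h.measurable_param
  have hYm := h.measurable_pos_at
  have hwm : ∀ r r', Measurable fun ω => D1 (ξ ω, Y r ω) (w (ξ ω) (Y r ω) r') := fun r r' =>
    (hD1m.comp (hξ.prodMk (hYm r))).clm_apply_vec ((hw r').comp (hξ.prodMk (hYm r)))
  have hwi : ∀ r r', Integrable (fun ω => D1 (ξ ω, Y r ω) (w (ξ ω) (Y r ω) r')) P := fun r r' =>
    .of_bound (hwm r r').aestronglyMeasurable (G * V) (.of_forall fun ω =>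
      ((D1 _).le_opNorm _).trans (mul_le_mul (hD1b _) (hV _ _ _) (norm_nonneg _) G.2))
  have hCi : ∀ᵐ r ∂volume.restrict (Ioc s (s + δ)), Integrable (fun ω => C r ω) P :=
    (h.integrable_Ioc hs ht).prod_right_ae
  have hmean := ae_mono (Measure.restrict_mono (Ioc_subset_Ioc hs ht) le_rfl) h.mean
  have hpt : ∀ᵐ r ∂volume.restrict (Ioc s (s + δ)),
      ‖∫ ω, (D1 (ξ ω, Y r ω) + D2 (ξ ω, Y r ω)) (C r ω) ∂P - c0‖
        ≤ M * c * ∫ ω, ‖C r ω‖ ∂P + ((c * G * V + K * V + G * L) * A + G * ρ) := by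
    filter_upwards [hCi, hmean, ae_restrict_mem measurableSet_Ioc] with r h1 h2 hr
    have hrT : r ∈ Icc 0 T := ⟨by linarith [hr.1], hr.2.trans ht⟩
    have hlC : ∀ (l : Z × E → E →L[ℝ] ℝ) (B : ℝ), Measurable l → (∀ q, ‖l q‖ ≤ B) →
        Integrable (fun ω => l (ξ ω, Y r ω) (C r ω)) P := fun l B hl hB => by
      refine (h1.norm.const_mul B).mono' ?_ (.of_forall fun ω =>
        ((l _).le_opNorm _).trans (mul_le_mul_of_nonneg_right (hB _) (norm_nonneg _)))
      exact ((hl.comp (hξ.prodMk (hYm r))).clm_apply_vec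
        h.measurable_vel.of_uncurry_left).aestronglyMeasurable
    -- Here the random velocity is replaced by its conditional mean. The weight in `D1` vanishes
    -- wherever `w` might differ from `v`.
    have e1 : ∫ ω, D1 (ξ ω, Y r ω) (C r ω) ∂P
        = ∫ ω, D1 (ξ ω, Y r ω) (w (ξ ω) (Y r ω) r) ∂P := by
      rw [h2 D1 hD1m ⟨G, hD1b⟩]
      congr 1; ext ω
      by_cases hz : ξ ω ∈ S ∧ χ (Y r ω) ≠ 0
      · rw [hwv _ hz.1 _ hz.2 r hrT]
      · have : g (ξ ω) * χ (Y r ω) = 0 := by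
          by_cases hz' : ξ ω ∈ S
          · simp [not_not.1 (not_and.1 hz hz')]
          · simp [g, hz']
        simp [D1, this]
    simp_rw [add_apply]
    rw [integral_add (hlC D1 G hD1m hD1b) (hlC D2 (M * c) hD2m hD2b), e1, add_comm, add_sub_assoc,
      ← integral_sub (hwi r r) (hwi s s)]
    refine (norm_add_le _ _).trans (add_le_add ?_ ?_)
    · rw [← integral_const_mul]
      exact norm_integral_le_of_norm_le (h1.norm.const_mul _) (.of_forall fun ω =>
        ((D2 _).le_opNorm _).trans (mul_le_mul_of_nonneg_right (hD2b _) (norm_nonneg _)))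
    · obtain ⟨hyi, hyle⟩ := h.integral_norm_sub_le hs ht hr
      calc _ ≤ ∫ ω, ((c * G * V + K * V + G * L) * ‖Y r ω - Y s ω‖ + G * ρ) ∂P := by
            refine norm_integral_le_of_norm_le ((hyi.const_mul _).add (integrable_const _))
              (.of_forall fun ω => ?_)
            set x := Y s ω
            set y := Y r ω
            set z := ξ ω
            -- One argument is changed at a time: the position in the cutoff, in `D` and in `w`, and
            -- finally the time in `w`. The bounds `b1` to `b4` treat these four differences.
            have e : D1 (z, y) (w z y r) - D1 (z, x) (w z x s)
                = g z * ((χ y - χ x) * D (z, y) (w z y r) + χ x * (D (z, y) - D (z, x)) (w z y r)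
                  + χ x * D (z, x) (w z y r - w z x r) + χ x * D (z, x) (w z x r - w z x s)) := by
              simp only [D1, smul_apply, smul_eq_mul,
                sub_apply, map_sub]
              ring
            have b1 : |(χ y - χ x) * D (z, y) (w z y r)| ≤ c * G * V * ‖y - x‖ := by
              rw [abs_mul]
              have h3 : |χ y - χ x| ≤ c * ‖y - x‖ := by
                simpa [Real.dist_eq, dist_eq_norm] using hχc.dist_le_mul y x
              have h4 : |D (z, y) (w z y r)| ≤ G * V :=
                ((D _).le_opNorm _).trans (mul_le_mul (hG _) (hV _ _ _) (norm_nonneg _) G.2)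
              calc _ ≤ (c * ‖y - x‖) * (G * V) := mul_le_mul h3 h4 (abs_nonneg _) (by positivity)
                _ = _ := by ring
            have b2 : |χ x * (D (z, y) - D (z, x)) (w z y r)| ≤ K * V * ‖y - x‖ := by
              rw [abs_mul]
              have h3 : ‖D (z, y) - D (z, x)‖ ≤ K * ‖y - x‖ := by
                simpa [dist_eq_norm] using (hK z).dist_le_mul y x
              have h4 : |(D (z, y) - D (z, x)) (w z y r)| ≤ (K * ‖y - x‖) * V :=
                (ContinuousLinearMap.le_opNorm _ _).trans
                  (mul_le_mul h3 (hV _ _ _) (norm_nonneg _) (by positivity))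
              calc _ ≤ 1 * ((K * ‖y - x‖) * V) := mul_le_mul (hχa _) h4 (abs_nonneg _) zero_le_one
                _ = _ := by ring
            have b3 : |χ x * D (z, x) (w z y r - w z x r)| ≤ G * L * ‖y - x‖ := by
              rw [abs_mul]
              have h3 : ‖w z y r - w z x r‖ ≤ L * ‖y - x‖ := by
                simpa [dist_eq_norm] using (hL z r hrT).dist_le_mul y x
              have h4 : |D (z, x) (w z y r - w z x r)| ≤ G * (L * ‖y - x‖) :=
                (ContinuousLinearMap.le_opNorm _ _).trans
                  (mul_le_mul (hG _) h3 (norm_nonneg _) G.2)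
              calc _ ≤ 1 * (G * (L * ‖y - x‖)) := mul_le_mul (hχa _) h4 (abs_nonneg _) zero_le_one
                _ = _ := by ring
            have b4 : |χ x * D (z, x) (w z x r - w z x s)| ≤ G * ρ := by
              rw [abs_mul]
              have h4 : |D (z, x) (w z x r - w z x s)| ≤ G * ρ :=
                (ContinuousLinearMap.le_opNorm _ _).trans
                  (mul_le_mul (hG _) (hρ _ _ r ⟨hr.1.le, hr.2⟩) (norm_nonneg _) G.2)
              calc _ ≤ 1 * ((G : ℝ) * ρ) := mul_le_mul (hχa _) h4 (abs_nonneg _) zero_le_one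
                _ = _ := one_mul _
            rw [e, Real.norm_eq_abs, abs_mul]
            calc _ ≤ 1 * (c * G * V * ‖y - x‖ + K * V * ‖y - x‖ + G * L * ‖y - x‖ + G * ρ) := by
                  refine mul_le_mul (hg1 _) ?_ (abs_nonneg _) zero_le_one
                  refine (abs_add_le _ _).trans (add_le_add ?_ b4)
                  refine (abs_add_le _ _).trans (add_le_add ?_ b3)
                  exact (abs_add_le _ _).trans (add_le_add b1 b2)
              _ = _ := by ring
        _ = (c * G * V + K * V + G * L) * ∫ ω, ‖Y r ω - Y s ω‖ ∂P + G * ρ := by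
            rw [integral_add (hyi.const_mul _) (integrable_const _), integral_const_mul]
            simp
        _ ≤ _ := by gcongr
  have hvol : (volume.restrict (Ioc s (s + δ))).real univ = δ := by
    rw [measureReal_restrict_apply_univ, Real.volume_real_Ioc_of_le (by linarith)]; ring
  have hstep : |∫ ω, Q (ξ ω, Y (s + δ) ω) ∂P - ∫ ω, Q (ξ ω, Y s ω) ∂P - δ * c0|
      ≤ M * c * A + δ * ((c * G * V + K * V + G * L) * A + G * ρ) := by
    have e : δ * c0 = ∫ _r in Ioc s (s + δ), c0 := by rw [integral_const, hvol, smul_eq_mul]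
    rw [heq, e, ← integral_sub hint (integrable_const _)]
    have hCi2 : Integrable (fun r => ∫ ω, ‖C r ω‖ ∂P) (volume.restrict (Ioc s (s + δ))) :=
      (h.integrable_Ioc hs ht).norm.integral_prod_left
    refine (norm_integral_le_of_norm_le ((hCi2.const_mul _).add (integrable_const _)) hpt).trans ?_
    simp only [Pi.add_apply]
    rw [integral_add (hCi2.const_mul _) (integrable_const _), integral_const_mul, integral_const,
      hvol, smul_eq_mul]
  -- The discrete backward transport equation `hκ`, integrated against the weight at time `s`.
  have hlast : |∫ ω, g (ξ ω) * χ (Y s ω) * ψ (ξ ω, Y s ω) ∂P - ∫ ω, Q (ξ ω, Y s ω) ∂P - δ * c0|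
      ≤ κ * δ := by
    have hi : ∀ f : Z × E → ℝ, Measurable f → (∀ q, |f q| ≤ M) →
        Integrable (fun ω => g (ξ ω) * χ (Y s ω) * f (ξ ω, Y s ω)) P := fun f hf hfM => by
      refine .of_bound ?_ M (.of_forall fun ω => ?_)
      · exact (((hg.comp hξ).mul (hχm.comp (hYm s))).mul
          (hf.comp (hξ.prodMk (hYm s)))).aestronglyMeasurable
      · rw [norm_mul]
        simpa using mul_le_mul (hgχ (ξ ω) (Y s ω)) (hfM _) (abs_nonneg _) zero_le_one
    have hsub : Integrable (fun ω => g (ξ ω) * χ (Y s ω) * ψ (ξ ω, Y s ω)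
        - g (ξ ω) * χ (Y s ω) * ψ' (ξ ω, Y s ω)) P := (hi ψ hψ hψM).sub (hi ψ' hψ' hM)
    rw [← integral_const_mul, ← integral_sub (hi ψ hψ hψM) (hi ψ' hψ' hM),
      ← integral_sub hsub ((hwi s s).const_mul δ)]
    have := norm_integral_le_of_norm_le_const (μ := P)
      (f := fun ω => g (ξ ω) * χ (Y s ω) * ψ (ξ ω, Y s ω) - g (ξ ω) * χ (Y s ω) * ψ' (ξ ω, Y s ω)
        - δ * D1 (ξ ω, Y s ω) (w (ξ ω) (Y s ω) s)) (C := κ * δ) (.of_forall fun ω => by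
        have e : g (ξ ω) * χ (Y s ω) * ψ (ξ ω, Y s ω) - g (ξ ω) * χ (Y s ω) * ψ' (ξ ω, Y s ω)
            - δ * D1 (ξ ω, Y s ω) (w (ξ ω) (Y s ω) s)
          = (g (ξ ω) * χ (Y s ω)) * (ψ (ξ ω, Y s ω) - ψ' (ξ ω, Y s ω)
            - δ * D (ξ ω, Y s ω) (w (ξ ω) (Y s ω) s)) := by
          simp only [D1, smul_apply, smul_eq_mul]; ring
        rw [e, norm_mul]
        simpa using mul_le_mul (hgχ (ξ ω) (Y s ω)) (hκ (ξ ω) (Y s ω)) (abs_nonneg _) zero_le_one)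
    simpa using this
  have e : ∫ ω, g (ξ ω) * χ (Y (s + δ) ω) * ψ' (ξ ω, Y (s + δ) ω) ∂P
      - ∫ ω, g (ξ ω) * χ (Y s ω) * ψ (ξ ω, Y s ω) ∂P
      = (∫ ω, Q (ξ ω, Y (s + δ) ω) ∂P - ∫ ω, Q (ξ ω, Y s ω) ∂P - δ * c0)
        - (∫ ω, g (ξ ω) * χ (Y s ω) * ψ (ξ ω, Y s ω) ∂P - ∫ ω, Q (ξ ω, Y s ω) ∂P - δ * c0) := by
    simp only [Q]; ring
  change |∫ ω, g (ξ ω) * χ (Y (s + δ) ω) * ψ' (ξ ω, Y (s + δ) ω) ∂P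
      - ∫ ω, g (ξ ω) * χ (Y s ω) * ψ (ξ ω, Y s ω) ∂P| ≤ _
  rw [e]
  refine (abs_sub _ _).trans ((add_le_add hstep hlast).trans (le_of_eq ?_))
  ring

end IsMeanFlow

end MeanFlow

section Euler

variable {E : Type*} [NormedAddCommGroup E] [NormedSpace ℝ E] {Z : Type*}

/-- The Euler scheme with step `δ` for the field `w`, from time `k δ` to time `(k + j) δ`. -/
def euler (w : Z → E → ℝ → E) (δ : ℝ) : ℕ → ℕ → Z → E → E
  | _, 0, _, u => u
  | k, j + 1, z, u => euler w δ (k + 1) j z (u + δ • w z u (k * δ))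

variable {w : Z → E → ℝ → E} {δ T : ℝ} {L : ℝ≥0}

lemma measurable_euler [MeasurableSpace Z] [MeasurableSpace E] [BorelSpace E]
    [SecondCountableTopology E] (hw : ∀ r, Measurable fun q : Z × E => w q.1 q.2 r) (k j : ℕ) :
    Measurable fun q : Z × E => euler w δ k j q.1 q.2 := by
  induction j generalizing k with
  | zero => exact measurable_snd
  | succ j ih =>
    have h : Measurable fun q : Z × E => (q.1, q.2 + δ • w q.1 q.2 (k * δ)) :=
      measurable_fst.prodMk (measurable_snd.add ((hw _).const_smul δ))
    exact (ih (k + 1)).comp h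

lemma euler_grid_mem {k j N : ℕ} (hδ : 0 ≤ δ) (hN : N * δ = T) (h : k + (j + 1) ≤ N) :
    (k : ℝ) * δ ∈ Icc 0 T ∧ ((k + 1 : ℕ) : ℝ) * δ ∈ Icc 0 T := by
  have h1 : ((k + 1 : ℕ) : ℝ) ≤ N := by exact_mod_cast (by omega : k + 1 ≤ N)
  have h2 : ((k + 1 : ℕ) : ℝ) * δ ≤ T := hN ▸ mul_le_mul_of_nonneg_right h1 hδ
  refine ⟨⟨by positivity, le_trans ?_ h2⟩, by positivity, h2⟩
  push_cast; nlinarith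

/-- Discrete Grönwall inequality: each step commits a local error `δ * ρ`, and each later step
magnifies errors by at most `1 + δ * L`. -/
lemma norm_euler_sub_le {N : ℕ} (hδ : 0 ≤ δ) (hN : N * δ = T) {z : Z}
    (hL : ∀ r ∈ Icc 0 T, LipschitzWith L fun u => w z u r) {u : ℝ → E} {ρ : ℝ} (hρ : 0 ≤ ρ)
    (hu : ∀ k < N, ‖u ((k + 1 : ℕ) * δ) - u (k * δ) - δ • w z (u (k * δ)) (k * δ)‖ ≤ δ * ρ)
    (j : ℕ) : ∀ k, k + j ≤ N → ∀ x,
      ‖euler w δ k j z x - u ((k + j : ℕ) * δ)‖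
        ≤ (1 + δ * L) ^ j * (‖x - u (k * δ)‖ + j * (δ * ρ)) := by
  induction j with
  | zero => intro k _ x; simp [euler]
  | succ j ih =>
    intro k hk x
    have h1 := ih (k + 1) (by omega) (x + δ • w z x (k * δ))
    rw [euler, show k + (j + 1) = k + 1 + j by ring]
    have h2 : ‖x + δ • w z x (k * δ) - u ((k + 1 : ℕ) * δ)‖
        ≤ (1 + δ * L) * ‖x - u (k * δ)‖ + δ * ρ := by
      have e : x + δ • w z x (k * δ) - u ((k + 1 : ℕ) * δ)
          = (x - u (k * δ)) + δ • (w z x (k * δ) - w z (u (k * δ)) (k * δ))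
            - (u ((k + 1 : ℕ) * δ) - u (k * δ) - δ • w z (u (k * δ)) (k * δ)) := by
        rw [smul_sub]; abel
      rw [e]
      refine (norm_sub_le _ _).trans (add_le_add ((norm_add_le _ _).trans ?_) (hu k (by omega)))
      rw [norm_smul, Real.norm_of_nonneg hδ, add_mul, one_mul, mul_assoc]
      gcongr
      simpa [dist_eq_norm] using
        (hL _ (euler_grid_mem hδ hN hk).1).dist_le_mul x (u (k * δ))
    refine h1.trans ?_
    have h3 : (1 : ℝ) ≤ 1 + δ * L := by
      have : 0 ≤ δ * L := by positivity
      linarith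
    rw [pow_succ, mul_assoc]
    refine mul_le_mul_of_nonneg_left ?_ (by positivity)
    have h4 : 0 ≤ (j + 1 : ℝ) * (δ * ρ) := by positivity
    push_cast at h2 ⊢
    nlinarith [h2, h3, h4, norm_nonneg (x - u (k * δ))]

lemma lipschitzWith_euler {N : ℕ} (hδ : 0 ≤ δ) (hN : N * δ = T) {z : Z}
    (hL : ∀ r ∈ Icc 0 T, LipschitzWith L fun u => w z u r) (j : ℕ) : ∀ k, k + j ≤ N → ∀ x y,
      ‖euler w δ k j z x - euler w δ k j z y‖ ≤ (1 + δ * L) ^ j * ‖x - y‖ := by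
  induction j with
  | zero => intro k _ x y; simp [euler]
  | succ j ih =>
    intro k hk x y
    rw [euler, euler]
    refine (ih (k + 1) (by omega) _ _).trans ?_
    rw [pow_succ, mul_assoc]
    refine mul_le_mul_of_nonneg_left ?_ (by positivity)
    have e : x + δ • w z x (k * δ) - (y + δ • w z y (k * δ))
        = (x - y) + δ • (w z x (k * δ) - w z y (k * δ)) := by rw [smul_sub]; abel
    rw [e]
    refine (norm_add_le _ _).trans ?_
    rw [norm_smul, Real.norm_of_nonneg hδ, add_mul, one_mul, mul_assoc]
    gcongr
    simpa [dist_eq_norm] using (hL _ (euler_grid_mem hδ hN hk).1).dist_le_mul x y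

lemma pow_le_exp_of_mul_eq {N j : ℕ} (hδ : 0 ≤ δ) (hN : N * δ = T) (hj : j ≤ N) :
    (1 + δ * L) ^ j ≤ Real.exp (T * L) := by
  have h1 : (1 : ℝ) ≤ 1 + δ * L := by
    have : 0 ≤ δ * L := by positivity
    linarith
  calc (1 + δ * L) ^ j ≤ (1 + δ * L) ^ N := pow_le_pow_right₀ h1 hj
    _ ≤ (Real.exp (δ * L)) ^ N := by
        gcongr
        linarith [Real.add_one_le_exp (δ * L)]
    _ = Real.exp (T * L) := by rw [← Real.exp_nat_mul, ← hN]; ring_nf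

end Euler

/-! ### Duality with the mollified backward Euler scheme -/

section Duality

variable {E : Type*} [NormedAddCommGroup E] [NormedSpace ℝ E] [FiniteDimensional ℝ E]
  [MeasurableSpace E] [BorelSpace E] {Z : Type*} [MeasurableSpace Z]
  {Ω : Type*} [MeasurableSpace Ω]
  {P : Measure Ω} [IsProbabilityMeasure P] {T : ℝ} {ξ : Ω → Z} {Y C : ℝ → Ω → E}
  {v : Z → E → ℝ → E}

/-- First-order Taylor remainder, by the mean value inequality on the segment, along which `D` moves
by at most `K * ‖y‖` from `D x`. -/
lemma abs_sub_sub_le_of_lipschitz_deriv {f : E → ℝ} {D : E → E →L[ℝ] ℝ} {K : ℝ≥0}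
    (hd : ∀ u, HasFDerivAt f (D u) u) (hK : LipschitzWith K D) (x y : E) :
    |f (x + y) - f x - D x y| ≤ K * ‖y‖ ^ 2 := by
  have h := (convex_segment (𝕜 := ℝ) x (x + y)).norm_image_sub_le_of_norm_hasFDerivWithin_le'
    (f := f) (f' := D) (φ := D x) (C := K * ‖y‖) (fun u _ => (hd u).hasFDerivWithinAt)
    (fun u hu => by
      rw [← dist_eq_norm]
      refine (hK.dist_le_mul u x).trans ?_
      gcongr
      rw [dist_eq_norm]
      simpa using norm_sub_le_of_mem_segment hu)
    (left_mem_segment ℝ _ _) (right_mem_segment ℝ _ _)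
  rw [add_sub_cancel_left, Real.norm_eq_abs] at h
  exact h.trans (le_of_eq (by ring))

/-- Mollified backward Euler iterates of a test function solve the transport equation of `w` up to
a small error. -/
lemma exists_smooth_euler_family {w : Z → E → ℝ → E} {L V M G G' K : ℝ≥0} {N : ℕ} {δ ε : ℝ}
    {η : E → ℝ} (hη : IsMollifier η ε)
    (hK : ∀ φ : E → ℝ, Continuous φ → (∀ x, |φ x| ≤ M) → LipschitzWith K (mollifyDeriv η φ))
    (hδ : 0 ≤ δ) (hNδ : N * δ = T) (hw : ∀ r, Measurable fun q : Z × E => w q.1 q.2 r)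
    (hL : ∀ z, ∀ r ∈ Icc 0 T, LipschitzWith L fun u => w z u r) (hV : ∀ z u r, ‖w z u r‖ ≤ V)
    (hG' : (G' : ℝ) = G * Real.exp (T * L)) {Φ : Z × E → ℝ} (hΦ : Measurable Φ)
    (hΦM : ∀ q, |Φ q| ≤ M) (hΦG : ∀ z, LipschitzWith G fun u => Φ (z, u)) :
    ∃ (ψ : ℕ → Z × E → ℝ) (D : ℕ → Z × E → E →L[ℝ] ℝ),
      (∀ k, Measurable (ψ k)) ∧ (∀ k, Measurable (D k)) ∧ (∀ k ≤ N, ∀ q, |ψ k q| ≤ M) ∧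
      (∀ k ≤ N, ∀ z u, HasFDerivAt (fun u => ψ k (z, u)) (D k (z, u)) u) ∧
      (∀ k ≤ N, ∀ q, ‖D k q‖ ≤ G') ∧ (∀ k ≤ N, ∀ z, LipschitzWith K fun u => D k (z, u)) ∧
      (∀ k < N, ∀ z x, |ψ k (z, x) - ψ (k + 1) (z, x) - δ * D (k + 1) (z, x) (w z x (k * δ))|
        ≤ (G' * L * ε + K * δ * V ^ 2) * δ) ∧
      ∀ k ≤ N, ∀ q, |ψ k q - Φ (q.1, euler w δ k (N - k) q.1 q.2)| ≤ G' * ε := by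
  -- The test function is pulled back from the final grid time to the `k`-th. As `euler` performs
  -- its earliest step first, `φ k` is exactly `φ (k + 1)` composed with one step (`hφstep`); only
  -- the mollification makes the transport equation approximate.
  let φ : ℕ → Z × E → ℝ := fun k q => Φ (q.1, euler w δ k (N - k) q.1 q.2)
  have hφm : ∀ k, Measurable (φ k) := fun k =>
    hΦ.comp (measurable_fst.prodMk (measurable_euler hw k (N - k)))
  have hφM : ∀ k q, |φ k q| ≤ M := fun k q => hΦM _
  have hφG : ∀ k ≤ N, ∀ z, LipschitzWith G' fun u => φ k (z, u) := by
    intro k hk z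
    refine LipschitzWith.of_dist_le_mul fun x y => ((hΦG z).dist_le_mul _ _).trans ?_
    rw [hG', mul_assoc]
    refine mul_le_mul_of_nonneg_left ?_ G.2
    rw [dist_eq_norm, dist_eq_norm]
    refine (lipschitzWith_euler hδ hNδ (hL z) _ k (by omega) x y).trans ?_
    exact mul_le_mul_of_nonneg_right (pow_le_exp_of_mul_eq hδ hNδ (by omega)) (norm_nonneg _)
  have hφstep : ∀ k < N, ∀ z u, φ k (z, u) = φ (k + 1) (z, u + δ • w z u (k * δ)) := by
    intro k hk z u
    simp only [φ]
    rw [show N - k = N - (k + 1) + 1 by omega, euler]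
  let ψ : ℕ → Z × E → ℝ := fun k q => mollify η (fun u => φ k (q.1, u)) q.2
  let D : ℕ → Z × E → E →L[ℝ] ℝ := fun k q => mollifyDeriv η (fun u => φ k (q.1, u)) q.2
  have hψd : ∀ k ≤ N, ∀ z u, HasFDerivAt (fun u => ψ k (z, u)) (D k (z, u)) u := fun k hk z u =>
    hη.hasFDerivAt_mollify (φ := fun u => φ k (z, u)) (hφG k hk z).continuous u
  have hDK : ∀ k ≤ N, ∀ z, LipschitzWith K fun u => D k (z, u) := fun k hk z =>
    hK (fun u => φ k (z, u)) (hφG k hk z).continuous (fun u => hφM _ _)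
  have hψm : ∀ k, Measurable (ψ k) := fun k =>
    measurable_mollify (φ := φ k) hη.contDiff.continuous.measurable (hφm k)
  have hDm : ∀ k, Measurable (D k) := fun k =>
    measurable_mollifyDeriv (φ := φ k) hη.contDiff (hφm k)
  have hψM : ∀ k ≤ N, ∀ q, |ψ k q| ≤ M := fun k hk q =>
    hη.abs_mollify_le (φ := fun u => φ k (q.1, u)) (hφG k hk q.1).continuous (fun u => hφM k _) q.2
  have hDG : ∀ k ≤ N, ∀ q, ‖D k q‖ ≤ G' := fun k hk q =>
    hη.norm_mollifyDeriv_le (φ := fun u => φ k (q.1, u)) (hφG k hk q.1).continuous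
      (hφG k hk q.1) q.2
  refine ⟨ψ, D, hψm, hDm, hψM, hψd, hDG, hDK, ?_, ?_⟩
  · intro k hk z x
    have hmem := (euler_grid_mem (j := 0) hδ hNδ (by omega : k + (0 + 1) ≤ N)).1
    have hc := hφG (k + 1) hk
    -- Mollification and the step map commute up to `δ * L * ε`: shifting before or after the step
    -- changes its increment only through the Lipschitz field `w`. The remaining difference between
    -- a step and its linearization is Taylor's remainder `t2`.
    have t1 : |ψ k (z, x) - ψ (k + 1) (z, x + δ • w z x (k * δ))| ≤ G' * (δ * (L * ε)) := by
      refine hη.abs_mollify_sub_mollify_le (hφG k hk.le z).continuous (hc z).continuous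
        fun y hy => ?_
      simp only
      rw [hφstep k hk]
      have := (hc z).dist_le_mul (x - y + δ • w z (x - y) (k * δ)) (x + δ • w z x (k * δ) - y)
      rw [Real.dist_eq] at this
      refine this.trans (mul_le_mul_of_nonneg_left ?_ G'.2)
      rw [dist_eq_norm, show x - y + δ • w z (x - y) (k * δ) - (x + δ • w z x (k * δ) - y)
        = δ • (w z (x - y) (k * δ) - w z x (k * δ)) by rw [smul_sub]; abel, norm_smul,
        Real.norm_of_nonneg hδ]
      refine mul_le_mul_of_nonneg_left ?_ hδ
      rw [← dist_eq_norm]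
      refine ((hL z _ hmem).dist_le_mul _ _).trans (mul_le_mul_of_nonneg_left ?_ L.2)
      simpa using hy
    have t2 := abs_sub_sub_le_of_lipschitz_deriv (hψd (k + 1) hk z) (hDK (k + 1) hk z) x
      (δ • w z x (k * δ))
    rw [map_smul, smul_eq_mul] at t2
    have t3 : K * ‖δ • w z x (k * δ)‖ ^ 2 ≤ K * (δ * V) ^ 2 := by
      rw [norm_smul, Real.norm_of_nonneg hδ]
      have := hV z x (k * δ)
      gcongr
    calc _ = |(ψ k (z, x) - ψ (k + 1) (z, x + δ • w z x (k * δ)))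
          + (ψ (k + 1) (z, x + δ • w z x (k * δ)) - ψ (k + 1) (z, x)
            - δ * D (k + 1) (z, x) (w z x (k * δ)))| := by congr 1; ring
      _ ≤ G' * (δ * (L * ε)) + K * (δ * V) ^ 2 :=
          (abs_add_le _ _).trans (add_le_add t1 (t2.trans t3))
      _ = _ := by ring
  · intro k hk q
    refine hη.abs_mollify_sub_const_le (hφG k hk q.1).continuous fun y hy => ?_
    have := (hφG k hk q.1).dist_le_mul (q.2 - y) q.2
    rw [Real.dist_eq] at this
    exact this.trans (mul_le_mul_of_nonneg_left (by simpa using hy) G'.2)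

/-- Telescoping. The errors proportional to the expected path length add up over adjacent intervals,
so their total does not grow with the number of steps. -/
lemma IsMeanFlow.sum_steps_le (h : IsMeanFlow P T ξ Y C v) {N : ℕ} {δ : ℝ} (hδ : 0 ≤ δ)
    (hNδ : N * δ = T) {e : ℕ → ℝ} {a b : ℝ} (hstep : ∀ k < N, |e (k + 1) - e k| ≤
      a * (∫ q in Ioc (k * δ) ((k + 1 : ℕ) * δ), ∫ ω, ‖C q ω‖ ∂P) + b) :
    ∀ k ≤ N, |e k - e 0| ≤ a * (∫ q in Ioc 0 (k * δ), ∫ ω, ‖C q ω‖ ∂P) + k * b := by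
  intro k
  induction k with
  | zero => simp
  | succ k ih =>
    intro hk
    have hmem := euler_grid_mem (j := 0) hδ hNδ (by omega : k + (0 + 1) ≤ N)
    have hle : (k : ℝ) * δ ≤ (k + 1 : ℕ) * δ := by push_cast; nlinarith
    have hint := (h.integrable_Ioc le_rfl hmem.2.2).norm.integral_prod_left
    have hun : ∫ q in Ioc 0 (((k + 1 : ℕ) : ℝ) * δ), ∫ ω, ‖C q ω‖ ∂P
        = (∫ q in Ioc 0 ((k : ℝ) * δ), ∫ ω, ‖C q ω‖ ∂P)
          + ∫ q in Ioc ((k : ℝ) * δ) ((k + 1 : ℕ) * δ), ∫ ω, ‖C q ω‖ ∂P := by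
      rw [← Ioc_union_Ioc_eq_Ioc hmem.1.1 hle]
      exact setIntegral_union (Ioc_disjoint_Ioc_of_le le_rfl) measurableSet_Ioc
        (IntegrableOn.mono_set hint (Ioc_subset_Ioc_right hle))
        (IntegrableOn.mono_set hint (Ioc_subset_Ioc_left hmem.1.1))
    rw [hun]
    calc |e (k + 1) - e 0| = |(e (k + 1) - e k) + (e k - e 0)| := by congr 1; ring
      _ ≤ _ := (abs_add_le _ _).trans (add_le_add (hstep k hk) (ih (by omega)))
      _ = _ := by push_cast; ring

lemma IsMeanFlow.abs_cutoff_sub_le (h : IsMeanFlow P T ξ Y C v) {S : Set Z}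
    (hS : MeasurableSet S) {χ : E → ℝ} (hχ : Continuous χ) (hχ0 : ∀ u, 0 ≤ χ u)
    (hχ1 : ∀ u, χ u ≤ 1) {φ ψ : Z × E → ℝ} (hφ : Measurable φ) (hψ : Measurable ψ) {M κ : ℝ}
    (hφM : ∀ q, |φ q| ≤ M) (hψM : ∀ q, |ψ q| ≤ M) (hκ : ∀ q, |ψ q - φ q| ≤ κ) (r : ℝ) :
    |∫ ω, S.indicator 1 (ξ ω) * χ (Y r ω) * φ (ξ ω, Y r ω) ∂P
      - ∫ ω, S.indicator 1 (ξ ω) * χ (Y r ω) * ψ (ξ ω, Y r ω) ∂P| ≤ κ := by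
  have hY := h.measurable_pos_at r
  have hm : Measurable (S.indicator (1 : Z → ℝ)) := measurable_one.indicator hS
  have b1 : ∀ z, ‖S.indicator (1 : Z → ℝ) z‖ ≤ 1 := fun z => by
    by_cases hz : z ∈ S <;> simp [hz]
  have b2 : ∀ u, ‖χ u‖ ≤ 1 := fun u => by
    rw [Real.norm_of_nonneg (hχ0 _)]; exact hχ1 _
  have hi : ∀ f : Z × E → ℝ, Measurable f → (∀ q, |f q| ≤ M) →
      Integrable (fun ω => S.indicator 1 (ξ ω) * χ (Y r ω) * f (ξ ω, Y r ω)) P := by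
    intro f hf hfM
    refine .of_bound (((hm.comp h.measurable_param).mul (hχ.measurable.comp hY)).mul
        (hf.comp (h.measurable_param.prodMk hY))).aestronglyMeasurable (1 * 1 * M)
        (.of_forall fun ω => ?_)
    rw [norm_mul, norm_mul]
    exact mul_le_mul (mul_le_mul (b1 _) (b2 _) (norm_nonneg _) zero_le_one) (hfM _)
      (norm_nonneg _) (by norm_num)
  rw [← integral_sub (hi _ hφ hφM) (hi _ hψ hψM)]
  have := norm_integral_le_of_norm_le_const (μ := P)
    (f := fun ω => S.indicator 1 (ξ ω) * χ (Y r ω) * φ (ξ ω, Y r ω)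
      - S.indicator 1 (ξ ω) * χ (Y r ω) * ψ (ξ ω, Y r ω)) (C := κ)
    (.of_forall fun ω => by
      rw [← mul_sub, norm_mul, norm_mul]
      have b : ‖φ (ξ ω, Y r ω) - ψ (ξ ω, Y r ω)‖ ≤ κ := by
        rw [norm_sub_rev]; exact hκ _
      calc _ ≤ 1 * 1 * κ := mul_le_mul (mul_le_mul (b1 _) (b2 _) (norm_nonneg _) zero_le_one) b
            (norm_nonneg _) (by norm_num)
        _ = _ := by ring)
  simpa using this

/-- The mean flow of `v` is computed by the Euler scheme of a field that agrees with `v` where the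
cutoff `χ` does not vanish. -/
lemma IsMeanFlow.eventually_abs_le (h : IsMeanFlow P T ξ Y C v) (hT : 0 < T) {S : Set Z}
    (hS : MeasurableSet S) {χ : E → ℝ} {c : ℝ≥0}
    (hχ : ContDiff ℝ 1 χ) (hχ0 : ∀ u, 0 ≤ χ u) (hχ1 : ∀ u, χ u ≤ 1) (hχc : LipschitzWith c χ)
    {w : Z → E → ℝ → E} {L V : ℝ≥0} (hw : ∀ r, Measurable fun q : Z × E => w q.1 q.2 r)
    (hwv : ∀ z ∈ S, ∀ u, χ u ≠ 0 → ∀ r ∈ Icc 0 T, w z u r = v z u r)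
    (hL : ∀ z, ∀ r ∈ Icc 0 T, LipschitzWith L fun u => w z u r) (hV : ∀ z u r, ‖w z u r‖ ≤ V)
    (hu : ∀ ρ > 0, ∃ δ > 0, ∀ z u, ∀ r ∈ Icc 0 T, ∀ s ∈ Icc 0 T, |r - s| ≤ δ →
      ‖w z u r - w z u s‖ ≤ ρ) (M G : ℝ≥0) {ε : ℝ} (hε : 0 < ε) :
    ∀ᶠ N : ℕ in Filter.atTop, ∀ Φ : Z × E → ℝ, Measurable Φ → (∀ q, |Φ q| ≤ M) →
      (∀ z, LipschitzWith G fun u => Φ (z, u)) →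
      |∫ ω, S.indicator 1 (ξ ω) * χ (Y T ω) * Φ (ξ ω, Y T ω) ∂P
        - ∫ ω, S.indicator 1 (ξ ω) * χ (Y 0 ω) *
          Φ (ξ ω, euler w (T / N) 0 N (ξ ω) (Y 0 ω)) ∂P|
      ≤ M * c * (∫ q in Ioc 0 T, ∫ ω, ‖C q ω‖ ∂P) + ε := by
  set A := ∫ q in Ioc 0 T, ∫ ω, ‖C q ω‖ ∂P with hA
  obtain ⟨G', hG'⟩ : ∃ G' : ℝ≥0, (G' : ℝ) = G * Real.exp (T * L) :=
    ⟨⟨G * Real.exp (T * L), by positivity⟩, rfl⟩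
  -- Total coefficient of the mollification radius `ε1`: `2 * G'` for unmollifying at the two ends
  -- and `T * (G' * L)` for the commutators of all steps. The `+ 1` keeps the divisor positive.
  let a1 : ℝ := 2 * G' + T * (G' * L) + 1
  have ha1 : 0 < a1 := by positivity
  let ε1 : ℝ := ε / (3 * a1)
  have hε1 : 0 < ε1 := by positivity
  have hε1' : a1 * ε1 = ε / 3 := by simp only [ε1]; field_simp
  let ρ : ℝ := ε / (3 * (T * G' + 1))
  have hρ : 0 < ρ := by positivity
  have hρ' : (T * G' + 1) * ρ = ε / 3 := by simp only [ρ]; field_simp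
  -- The order of choices matters: `K` depends on `η`, hence on `ε1`, and may be huge, so the radius
  -- is fixed before the number of steps. All of these choices precede `Φ`, which makes the estimate
  -- uniform in the test function.
  obtain ⟨η, hη⟩ := exists_isMollifier (E := E) hε1
  obtain ⟨K, hK⟩ := hη.exists_lipschitzWith_mollifyDeriv M
  obtain ⟨δ0, hδ0, hmod⟩ := hu ρ hρ
  let K2 : ℝ := c * G' * V + K * V + G' * L
  have hlim : Filter.Tendsto (fun N : ℕ => T / N) Filter.atTop (nhds 0) :=
    tendsto_const_div_atTop_nhds_zero_nat T
  -- Every term containing `K` carries a factor `δ = T / N`.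
  have hlim2 : Filter.Tendsto (fun N : ℕ => T / N * (K2 * A + T * K * V ^ 2)) Filter.atTop
      (nhds 0) := by simpa using hlim.mul_const (K2 * A + T * K * V ^ 2)
  filter_upwards [hlim.eventually (gt_mem_nhds hδ0), hlim2.eventually (gt_mem_nhds (by
    positivity : 0 < ε / 3)), Filter.eventually_gt_atTop 0] with N hN1 hN2 hN0 Φ hΦ hΦM hΦG
  set δ := T / N with hδdef
  have hNr : (0 : ℝ) < N := by exact_mod_cast hN0
  have hδ : 0 ≤ δ := by positivity
  have hNδ : N * δ = T := by rw [hδdef]; field_simp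
  obtain ⟨ψ, D, hψm, hDm, hψM, hψd, hDG, hDK, hκ, hend⟩ :=
    exists_smooth_euler_family hη hK hδ hNδ hw hL hV hG' hΦ hΦM hΦG
  let κ : ℝ := G' * L * ε1 + K * δ * V ^ 2
  let e : ℕ → ℝ := fun k => ∫ ω, S.indicator 1 (ξ ω) * χ (Y (k * δ) ω) * ψ k (ξ ω, Y (k * δ) ω) ∂P
  have hstep : ∀ k < N, |e (k + 1) - e k| ≤
      (M * c + δ * K2) * (∫ q in Ioc (k * δ) ((k + 1 : ℕ) * δ), ∫ ω, ‖C q ω‖ ∂P)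
        + δ * (κ + G' * ρ) := by
    intro k hk
    have hmem := euler_grid_mem (j := 0) hδ hNδ (by omega : k + (0 + 1) ≤ N)
    have hs : ((k + 1 : ℕ) : ℝ) * δ = k * δ + δ := by push_cast; ring
    simp only [e]
    rw [hs]
    refine h.abs_step_le hmem.1.1 hδ (hs ▸ hmem.2.2) hS hχ hχ0 hχ1 hχc hw hwv hL hV ?_
      (hψm k) (hψm (k + 1)) (hDm (k + 1)) (hψd (k + 1) hk) (hψM k hk.le) (hψM (k + 1) hk)
      (hDG (k + 1) hk) (hDK (k + 1) hk) (hκ k hk)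
    intro z u r hr
    refine hmod z u r ⟨hmem.1.1.trans hr.1, (hr.2.trans (hs ▸ hmem.2.2))⟩ _ hmem.1 ?_
    rw [abs_of_nonneg (by linarith [hr.1])]
    linarith [hr.2]
  have hN := h.sum_steps_le hδ hNδ hstep N le_rfl
  rw [hNδ] at hN
  have hem : ∀ k, Measurable fun q : Z × E => Φ (q.1, euler w δ k (N - k) q.1 q.2) := fun k =>
    hΦ.comp (measurable_fst.prodMk (measurable_euler hw k (N - k)))
  have h0 := h.abs_cutoff_sub_le hS hχ.continuous hχ0 hχ1 (hem 0) (hψm 0) (fun q => hΦM _)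
    (hψM 0 (by omega)) (hend 0 (by omega)) ((0 : ℕ) * δ)
  have hNe := h.abs_cutoff_sub_le hS hχ.continuous hχ0 hχ1 (hem N) (hψm N) (fun q => hΦM _)
    (hψM N le_rfl) (hend N le_rfl) ((N : ℕ) * δ)
  change |_ - e 0| ≤ _ at h0
  change |_ - e N| ≤ _ at hNe
  simp only [hNδ, Nat.sub_self, euler, Nat.cast_zero, zero_mul, Nat.sub_zero] at h0 hNe
  have hA0 : 0 ≤ A := integral_nonneg fun _ => integral_nonneg fun _ => norm_nonneg _
  have hfin : (M * c + δ * K2) * A + N * (δ * (κ + G' * ρ)) + 2 * (G' * ε1) ≤ M * c * A + ε := by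
    have : (M * c + δ * K2) * A + N * (δ * (κ + G' * ρ)) + 2 * (G' * ε1)
        = M * c * A + δ * (K2 * A + T * K * V ^ 2) + (a1 * ε1 - ε1) + ((T * G' + 1) * ρ - ρ) := by
      rw [show N * (δ * (κ + G' * ρ)) = T * (κ + G' * ρ) by rw [← hNδ]; ring]
      simp only [a1, κ]; ring
    rw [this, hε1', hρ']
    linarith
  refine le_trans ?_ hfin
  set I1 := ∫ ω, S.indicator 1 (ξ ω) * χ (Y T ω) * Φ (ξ ω, Y T ω) ∂P
  set I0 := ∫ ω, S.indicator 1 (ξ ω) * χ (Y 0 ω) * Φ (ξ ω, euler w δ 0 N (ξ ω) (Y 0 ω)) ∂P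
  calc |I1 - I0| = |(I1 - e N) + (e N - e 0) - (I0 - e 0)| := by congr 1; ring
    _ ≤ G' * ε1 + ((M * c + δ * K2) * A + N * (δ * (κ + G' * ρ))) + G' * ε1 :=
        (abs_sub _ _).trans (add_le_add ((abs_add_le _ _).trans (add_le_add hNe hN)) h0)
    _ = _ := by ring

end Duality

/-! ### Truncated fields, convergence of Euler schemes, removal of the cutoff -/

section Truncation

open Filter Topology

variable {E : Type*} [NormedAddCommGroup E] [NormedSpace ℝ E]

/-- Radial retraction onto the closed ball of radius `R`. -/
def retr (R : ℝ) (u : E) : E := (R / max R ‖u‖) • u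

lemma retr_eq_self {R : ℝ} (hR : 0 < R) {u : E} (hu : ‖u‖ ≤ R) : retr R u = u := by
  rw [retr, max_eq_left hu, div_self hR.ne', one_smul]

lemma norm_retr_le {R : ℝ} (hR : 0 < R) (u : E) : ‖retr R u‖ ≤ R := by
  have hm : 0 < max R ‖u‖ := lt_max_of_lt_left hR
  rw [retr, norm_smul, Real.norm_of_nonneg (by positivity), div_mul_eq_mul_div, div_le_iff₀ hm]
  exact mul_le_mul_of_nonneg_left (le_max_right _ _) hR.le

/-- The difference splits into a change of vector and a change of scaling factor, each at most `‖u -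
v‖`. The norm is arbitrary, so the constant is `2` and not the Euclidean `1`. -/
lemma lipschitzWith_retr {R : ℝ} (hR : 0 < R) : LipschitzWith 2 (retr R : E → E) := by
  refine LipschitzWith.of_dist_le_mul fun u v => ?_
  rw [dist_eq_norm, dist_eq_norm]
  set m := max R ‖u‖
  set n := max R ‖v‖
  have hm : 0 < m := lt_max_of_lt_left hR
  have hn : 0 < n := lt_max_of_lt_left hR
  have e : retr R u - retr R v = (R / m) • (u - v) + (R / m - R / n) • v := by
    simp only [retr, m, n, smul_sub, sub_smul]; abel
  have h1 : ‖(R / m) • (u - v)‖ ≤ ‖u - v‖ := by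
    rw [norm_smul, Real.norm_of_nonneg (by positivity)]
    exact mul_le_of_le_one_left (norm_nonneg _) ((div_le_one hm).2 (le_max_left _ _))
  have h2 : ‖(R / m - R / n) • v‖ ≤ ‖u - v‖ := by
    rw [norm_smul, Real.norm_eq_abs, show R / m - R / n = (R / m) * ((n - m) / n) by field_simp,
      abs_mul, abs_of_pos (by positivity : 0 < R / m), abs_div, abs_of_pos hn]
    have h3 : |n - m| ≤ ‖u - v‖ := by
      rw [norm_sub_rev]
      refine (abs_max_sub_max_le_max R ‖v‖ R ‖u‖).trans (max_le (by simp) ?_)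
      exact abs_norm_sub_norm_le v u
    have h4 : R / m ≤ 1 := (div_le_one hm).2 (le_max_left _ _)
    have h5 : ‖v‖ ≤ n := le_max_right _ _
    calc R / m * (|n - m| / n) * ‖v‖ = (R / m) * |n - m| * (‖v‖ / n) := by ring
      _ ≤ 1 * ‖u - v‖ * 1 := by
          gcongr
          exact (div_le_one hn).2 h5
      _ = _ := by ring
  rw [e]
  refine (norm_add_le _ _).trans ((add_le_add h1 h2).trans (le_of_eq ?_))
  push_cast; ring

variable {Z : Type*} [NormedAddCommGroup Z] [NormedSpace ℝ Z]

/-- `v` is continuous on the time interval `[0, T]`, and Lipschitz in `u` on compact sets. -/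
structure IsRegularField (T : ℝ) (v : Z → E → ℝ → E) : Prop where
  continuousOn : ContinuousOn (fun q : Z × E × ℝ => v q.1 q.2.1 q.2.2) (univ ×ˢ univ ×ˢ Icc 0 T)
  lipschitz : ∀ R : ℝ, ∃ L : ℝ≥0, ∀ z ∈ Metric.closedBall (0 : Z) R, ∀ r ∈ Icc 0 T,
    LipschitzOnWith L (fun u => v z u r) (Metric.closedBall 0 R)

/-- The field `v` with its arguments retracted to the balls of radius `R` and to `[0, T]`. -/
def trunc (T R : ℝ) (v : Z → E → ℝ → E) (z : Z) (u : E) (r : ℝ) : E :=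
  v (retr R z) (retr R u) (max 0 (min r T))

variable {T R : ℝ} {v : Z → E → ℝ → E}

lemma clamp_mem (hT : 0 ≤ T) (r : ℝ) : max 0 (min r T) ∈ Icc 0 T :=
  ⟨le_max_left _ _, max_le hT (min_le_right _ _)⟩

lemma clamp_eq {r : ℝ} (hr : r ∈ Icc 0 T) : max 0 (min r T) = r := by
  rw [min_eq_left hr.2, max_eq_right hr.1]

lemma trunc_eq (hR : 0 < R) {z : Z} (hz : ‖z‖ ≤ R) {u : E} (hu : ‖u‖ ≤ R) {r : ℝ}
    (hr : r ∈ Icc 0 T) : trunc T R v z u r = v z u r := by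
  rw [trunc, retr_eq_self hR hz, retr_eq_self hR hu, clamp_eq hr]

lemma IsRegularField.continuous_trunc (hv : IsRegularField T v) (hT : 0 ≤ T) (hR : 0 < R) :
    Continuous fun q : Z × E × ℝ => trunc T R v q.1 q.2.1 q.2.2 := by
  refine hv.continuousOn.comp_continuous
    (f := fun q : Z × E × ℝ => (retr R q.1, retr R q.2.1, max 0 (min q.2.2 T))) ?_ fun q => ?_
  · have h1 := (lipschitzWith_retr hR (E := Z)).continuous
    have h2 := (lipschitzWith_retr hR (E := E)).continuous
    fun_prop
  · exact ⟨mem_univ _, mem_univ _, clamp_mem hT _⟩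

lemma IsRegularField.exists_lipschitz_trunc (hv : IsRegularField T v) (hT : 0 ≤ T) (hR : 0 < R) :
    ∃ L : ℝ≥0, ∀ z r, LipschitzWith L fun u => trunc T R v z u r := by
  obtain ⟨L, hL⟩ := hv.lipschitz R
  refine ⟨L * 2, fun z r => ?_⟩
  have h1 := hL (retr R z) (by simpa using norm_retr_le hR z) _ (clamp_mem hT r)
  have h2 := (lipschitzWith_retr hR (E := E)).lipschitzOnWith (s := univ)
  rw [← lipschitzOnWith_univ]
  exact h1.comp h2 (fun u _ => by simpa using norm_retr_le hR u)

variable [FiniteDimensional ℝ E] [FiniteDimensional ℝ Z]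

lemma isCompact_box : IsCompact
    (Metric.closedBall (0 : Z) R ×ˢ Metric.closedBall (0 : E) R ×ˢ Icc 0 T) := by
  have := FiniteDimensional.proper_real E
  have := FiniteDimensional.proper_real Z
  exact (isCompact_closedBall _ _).prod ((isCompact_closedBall _ _).prod isCompact_Icc)

lemma IsRegularField.exists_norm_trunc_le (hv : IsRegularField T v) (hT : 0 ≤ T) (hR : 0 < R) :
    ∃ V : ℝ≥0, ∀ z u r, ‖trunc T R v z u r‖ ≤ V := by
  obtain ⟨V, hV⟩ := (isCompact_box (E := E) (Z := Z) (R := R) (T := T)).exists_bound_of_continuousOn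
    (hv.continuousOn.mono fun q hq => ⟨mem_univ _, mem_univ _, hq.2.2⟩)
  refine ⟨V.toNNReal, fun z u r => ?_⟩
  exact (hV (retr R z, retr R u, max 0 (min r T)) ⟨by simpa using norm_retr_le hR z,
    by simpa using norm_retr_le hR u, clamp_mem hT r⟩).trans (Real.le_coe_toNNReal V)

lemma IsRegularField.exists_modulus (hv : IsRegularField T v) (hR : 0 < R) :
    ∀ ρ > 0, ∃ δ > 0, ∀ z u, ∀ r ∈ Icc 0 T, ∀ s ∈ Icc 0 T, |r - s| ≤ δ →
      ‖trunc T R v z u r - trunc T R v z u s‖ ≤ ρ := by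
  intro ρ hρ
  have hu := (isCompact_box (E := E) (Z := Z) (R := R) (T := T)).uniformContinuousOn_of_continuous
    (hv.continuousOn.mono fun q hq => ⟨mem_univ _, mem_univ _, hq.2.2⟩)
  obtain ⟨δ, hδ, h⟩ := Metric.uniformContinuousOn_iff_le.1 hu ρ hρ
  refine ⟨δ, hδ, fun z u r hr s hs hrs => ?_⟩
  have hz : retr R z ∈ Metric.closedBall (0 : Z) R := by simpa using norm_retr_le hR z
  have hu : retr R u ∈ Metric.closedBall (0 : E) R := by simpa using norm_retr_le hR u
  have := h (retr R z, retr R u, r) ⟨hz, hu, hr⟩ (retr R z, retr R u, s) ⟨hz, hu, hs⟩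
    (by simp [Prod.dist_eq, Real.dist_eq, hrs])
  rw [trunc, trunc, clamp_eq hr, clamp_eq hs, ← dist_eq_norm]
  exact this

/-- The Euler scheme converges uniformly to solutions of the ODE that stay in a ball. -/
lemma IsRegularField.eventually_euler_near (hv : IsRegularField T v) (hT : 0 < T) (hR : 0 < R)
    {ε : ℝ} (hε : 0 < ε) : ∀ᶠ N : ℕ in atTop, ∀ z : Z, ‖z‖ ≤ R → ∀ u : ℝ → E,
      ContinuousOn u (Icc 0 T) → (∀ r ∈ Icc 0 T, ‖u r‖ ≤ R) →
      (∀ r ∈ Ico 0 T, HasDerivWithinAt u (v z (u r) r) (Ici r) r) →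
      ‖euler (trunc T R v) (T / N) 0 N z (u 0) - u T‖ ≤ ε := by
  obtain ⟨L, hL⟩ := hv.exists_lipschitz_trunc hT.le hR
  obtain ⟨V, hV⟩ := hv.exists_norm_trunc_le hT.le hR
  -- The `N` local errors `δ * (2 * ρ)`, magnified by at most `exp (T * L)`, add up to `2 * exp (T *
  -- L) * T * ρ = ε`.
  let ρ : ℝ := ε / (2 * (Real.exp (T * L) * T))
  have hρ : 0 < ρ := by positivity
  have hρε : Real.exp (T * L) * T * ρ = ε / 2 := by simp only [ρ]; field_simp
  obtain ⟨δ0, hδ0, hmod⟩ := hv.exists_modulus hR ρ hρ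
  have hlim : Tendsto (fun N : ℕ => T / N) atTop (𝓝 0) := tendsto_const_div_atTop_nhds_zero_nat T
  have hlim2 : Tendsto (fun N : ℕ => T / N * (L * V)) atTop (𝓝 0) := by
    simpa using hlim.mul_const (L * V : ℝ)
  filter_upwards [hlim.eventually (gt_mem_nhds hδ0), hlim2.eventually (gt_mem_nhds hρ),
    eventually_gt_atTop 0] with N hN1 hN2 hN0 z hz u hu huR hd
  set w := trunc T R v with hw
  set δ := T / N with hδdef
  have hNr : (0 : ℝ) < N := by exact_mod_cast hN0
  have hδ : 0 ≤ δ := by positivity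
  have hNδ : N * δ = T := by rw [hδdef]; field_simp
  have hstep : ∀ k < N, ‖u ((k + 1 : ℕ) * δ) - u (k * δ) - δ • w z (u (k * δ)) (k * δ)‖
      ≤ δ * (2 * ρ) := by
    intro k hk
    have hmem := euler_grid_mem (j := 0) hδ hNδ (by omega : k + (0 + 1) ≤ N)
    set a : ℝ := k * δ with ha
    have hb : ((k + 1 : ℕ) : ℝ) * δ = a + δ := by push_cast; ring
    rw [hb] at hmem ⊢
    have hsub : Icc a (a + δ) ⊆ Icc 0 T := Icc_subset_Icc hmem.1.1 hmem.2.2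
    have hsub' : Ico a (a + δ) ⊆ Ico 0 T := Ico_subset_Ico hmem.1.1 hmem.2.2
    have hwu : ∀ r ∈ Icc 0 T, v z (u r) r = w z (u r) r := fun r hr =>
      (trunc_eq hR hz (huR r hr) hr).symm
    have hd' : ∀ r ∈ Ico a (a + δ), HasDerivWithinAt u (w z (u r) r) (Ici r) r := fun r hr => by
      rw [← hwu r (hsub (Ico_subset_Icc_self hr))]
      exact hd r (hsub' hr)
    have h1 := norm_image_sub_le_of_norm_deriv_right_le_segment (hu.mono hsub) hd'
      (fun r _ => hV z (u r) r)
    -- Subtracting the frozen linear motion turns the local error into an increment, whose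
    -- derivative is small: the path moves at most `V * δ` within a step by `h1`, and `w` has the
    -- time modulus `ρ`.
    have h2 := norm_image_sub_le_of_norm_deriv_right_le_segment
      (f := fun r => u r - r • w z (u a) a) (f' := fun r => w z (u r) r - (1 : ℝ) • w z (u a) a)
      (C := 2 * ρ) ((hu.mono hsub).sub (by fun_prop))
      (fun r hr => (hd' r hr).sub ((hasDerivWithinAt_id r _).smul_const _)) (fun r hr => by
        have hr' := Ico_subset_Icc_self hr
        rw [one_smul]
        calc ‖w z (u r) r - w z (u a) a‖
            = ‖(w z (u r) r - w z (u a) r) + (w z (u a) r - w z (u a) a)‖ := by congr 1; abel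
          _ ≤ δ * (L * V) + ρ := by
              refine (norm_add_le _ _).trans (add_le_add ?_ ?_)
              · have h3 := (hL z r).dist_le_mul (u r) (u a)
                rw [dist_eq_norm, dist_eq_norm] at h3
                refine h3.trans ?_
                calc (L : ℝ) * ‖u r - u a‖ ≤ L * (V * δ) := by
                      gcongr
                      exact (h1 r hr').trans (mul_le_mul_of_nonneg_left (by linarith [hr'.2]) V.2)
                  _ = _ := by ring
              · refine hmod z (u a) r (hsub hr') a hmem.1 ?_
                rw [abs_of_nonneg (by linarith [hr'.1])]
                linarith [hr'.2]
          _ ≤ 2 * ρ := by linarith)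
      (a + δ) (right_mem_Icc.2 (by linarith))
    have e : u (a + δ) - u a - δ • w z (u a) a
        = u (a + δ) - (a + δ) • w z (u a) a - (u a - a • w z (u a) a) := by
      rw [add_smul]; abel
    rw [e]
    exact h2.trans (le_of_eq (by ring))
  have h := norm_euler_sub_le hδ hNδ (fun r _ => hL z r) (by positivity) hstep N 0 (by omega) (u 0)
  simp only [Nat.cast_zero, zero_mul, sub_self, norm_zero, zero_add] at h
  rw [hNδ] at h
  refine h.trans ?_
  calc _ ≤ Real.exp (T * L) * (N * (δ * (2 * ρ))) := by
        refine mul_le_mul_of_nonneg_right (pow_le_exp_of_mul_eq hδ hNδ le_rfl) (by positivity)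
    _ = 2 * (Real.exp (T * L) * T * ρ) := by rw [← hNδ]; ring
    _ = ε := by rw [hρε]; ring

/-- Dilating one bump by `R` divides its Lipschitz constant by `R`. The resulting cutoff error
vanishes as `R` grows, with no moment assumption on the positions. -/
lemma exists_cutoff : ∃ c : ℝ≥0, ∀ R > 0, ∃ χ : E → ℝ, ContDiff ℝ 1 χ ∧ (∀ u, 0 ≤ χ u) ∧
    (∀ u, χ u ≤ 1) ∧ LipschitzWith (c / R.toNNReal) χ ∧ (∀ u, ‖u‖ ≤ R / 2 → χ u = 1) ∧
    ∀ u, χ u ≠ 0 → ‖u‖ ≤ R := by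
  let f : ContDiffBump (0 : E) := ⟨1 / 2, 1, by norm_num, by norm_num⟩
  obtain ⟨c, hc⟩ := (f.contDiff (n := 1)).lipschitzWith_of_hasCompactSupport f.hasCompactSupport
    (by norm_num)
  refine ⟨c, fun R hR => ⟨fun u => f (R⁻¹ • u), f.contDiff.comp (contDiff_const_smul _),
    fun u => f.nonneg, fun u => f.le_one, ?_, fun u hu => ?_, fun u hu => ?_⟩⟩
  · refine LipschitzWith.of_dist_le_mul fun u v => (hc.dist_le_mul _ _).trans (le_of_eq ?_)
    rw [dist_smul₀, Real.norm_of_nonneg (by positivity)]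
    push_cast
    rw [Real.coe_toNNReal _ hR.le]
    ring
  · refine f.one_of_mem_closedBall ?_
    simp only [mem_closedBall_zero_iff, norm_smul, norm_inv, Real.norm_of_nonneg hR.le, f]
    rw [inv_mul_le_iff₀ hR]; linarith
  · have : R⁻¹ • u ∈ Function.support f := hu
    rw [f.support_eq] at this
    simp only [mem_ball_zero_iff, norm_smul, norm_inv, Real.norm_of_nonneg hR.le, f] at this
    rw [inv_mul_lt_iff₀ hR] at this
    linarith

variable [MeasurableSpace E] [BorelSpace E] [MeasurableSpace Z] [BorelSpace Z]
  {Ω : Type*} [MeasurableSpace Ω] {P : Measure Ω} [IsProbabilityMeasure P] {ξ : Ω → Z}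
  {Y C : ℝ → Ω → E}

lemma tendsto_measureReal_norm_gt {F : Type*} [NormedAddCommGroup F] [MeasurableSpace F]
    [BorelSpace F] {X : Ω → F} (hX : Measurable X) :
    Tendsto (fun R : ℝ => P.real {ω | R < ‖X ω‖}) atTop (𝓝 0) := by
  have h : ∀ R : ℝ, P.real {ω | R < ‖X ω‖} = ∫ ω, {ω | R < ‖X ω‖}.indicator 1 ω ∂P := fun R => by
    rw [integral_indicator_one (measurableSet_lt measurable_const hX.norm)]
  simp_rw [h]
  have := tendsto_integral_filter_of_dominated_convergence (μ := P) (l := atTop)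
    (F := fun (R : ℝ) ω => {ω | R < ‖X ω‖}.indicator (1 : Ω → ℝ) ω) (f := fun _ => 0) (fun _ => 1)
    (.of_forall fun R => (measurable_one.indicator
      (measurableSet_lt measurable_const hX.norm)).aestronglyMeasurable)
    (.of_forall fun R => .of_forall fun ω => by
      by_cases h : ω ∈ {ω | R < ‖X ω‖}
      · rw [indicator_of_mem h]; simp
      · rw [indicator_of_notMem h]; simp) (integrable_const _)
    (.of_forall fun ω => by
      refine tendsto_const_nhds.congr' ?_
      filter_upwards [eventually_ge_atTop ‖X ω‖] with R hR
      rw [indicator_of_notMem]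
      simpa using hR)
  simpa using this

/-- Test functions of a mean flow are computed by the Euler scheme of the truncated field. -/
theorem IsMeanFlow.eventually_euler_near (h : IsMeanFlow P T ξ Y C v) (hv : IsRegularField T v)
    (hT : 0 < T) (M G : ℝ≥0) {ε : ℝ} (hε : 0 < ε) :
    ∀ᶠ R : ℝ in atTop, ∀ᶠ N : ℕ in atTop, ∀ Φ : Z × E → ℝ, Measurable Φ → (∀ q, |Φ q| ≤ M) →
      (∀ z, LipschitzWith G fun u => Φ (z, u)) →
      |∫ ω, Φ (ξ ω, Y T ω) ∂P
        - ∫ ω, Φ (ξ ω, euler (trunc T R v) (T / N) 0 N (ξ ω) (Y 0 ω)) ∂P| ≤ ε := by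
  obtain ⟨c, hc⟩ := exists_cutoff (E := E)
  set A := ∫ q in Ioc 0 T, ∫ ω, ‖C q ω‖ ∂P with hA
  have hξ := h.measurable_param
  have hY := h.measurable_pos_at
  -- Three errors must be small in `R`: the gradient of the cutoff (`t1`), and the mass lost by the
  -- cutoff at the two end times (`t3`), which vanishes by tightness of the single laws. Only then
  -- is `N` chosen.
  have t1 : Tendsto (fun R : ℝ => M * (c / R) * A) atTop (𝓝 0) := by
    have : Tendsto (fun R : ℝ => (c : ℝ) / R) atTop (𝓝 0) := tendsto_id.const_div_atTop _
    simpa using (this.const_mul (M : ℝ)).mul_const A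
  have t2 := tendsto_measureReal_norm_gt (P := P) hξ
  have hhalf : Tendsto (fun R : ℝ => R / 2) atTop atTop := tendsto_id.atTop_div_const (by norm_num)
  have t3 : ∀ r, Tendsto (fun R : ℝ => M * (P.real {ω | R < ‖ξ ω‖} + P.real {ω | R / 2 < ‖Y r ω‖}))
      atTop (𝓝 0) := fun r => by
    simpa using (t2.add ((tendsto_measureReal_norm_gt (P := P) (hY r)).comp hhalf)).const_mul
      (M : ℝ)
  filter_upwards [t1.eventually (gt_mem_nhds (by positivity : 0 < ε / 4)),
    (t3 T).eventually (gt_mem_nhds (by positivity : 0 < ε / 4)),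
    (t3 0).eventually (gt_mem_nhds (by positivity : 0 < ε / 4)), eventually_gt_atTop 0]
    with R h1 h2 h3 hR
  obtain ⟨χ, hχ, hχ0, hχ1, hχc, hχe, hχs⟩ := hc R hR
  obtain ⟨L, hL⟩ := hv.exists_lipschitz_trunc hT.le hR
  obtain ⟨V, hV⟩ := hv.exists_norm_trunc_le hT.le hR
  have hcont := hv.continuous_trunc hT.le hR
  have hw : ∀ r, Measurable fun q : Z × E => trunc T R v q.1 q.2 r := fun r =>
    (hcont.comp (by fun_prop : Continuous fun q : Z × E => (q.1, q.2, r))).measurable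
  set S := Metric.closedBall (0 : Z) R
  have hS : MeasurableSet S := Metric.isClosed_closedBall.measurableSet
  have hev := h.eventually_abs_le hT hS hχ hχ0 hχ1 hχc hw
    (fun z hz u hu r hr => trunc_eq hR (by simpa [S] using hz) (hχs u hu) hr)
    (fun z r _ => hL z r) hV (hv.exists_modulus hR) M G (by positivity : 0 < ε / 4)
  filter_upwards [hev] with N hN Φ hΦ hΦM hΦG
  have hmain := hN Φ hΦ hΦM hΦG
  have hm : Measurable (S.indicator (1 : Z → ℝ)) := measurable_one.indicator hS
  -- Cost of inserting the cutoff: the weight differs from `1` only where `‖ξ‖ > R` or `‖Y r‖ > R /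
  -- 2`.
  have hcut : ∀ (r : ℝ) (f : Ω → ℝ), Measurable f → (∀ ω, |f ω| ≤ M) →
      |∫ ω, f ω ∂P - ∫ ω, S.indicator 1 (ξ ω) * χ (Y r ω) * f ω ∂P|
        ≤ M * (P.real {ω | R < ‖ξ ω‖} + P.real {ω | R / 2 < ‖Y r ω‖}) := by
    intro r f hf hfM
    have b1 : ∀ z, |S.indicator (1 : Z → ℝ) z| ≤ 1 := fun z => by
      by_cases hz : z ∈ S <;> simp [hz]
    have b2 : ∀ u, |χ u| ≤ 1 := fun u => by rw [abs_of_nonneg (hχ0 u)]; exact hχ1 u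
    have b3 : ∀ z u, |S.indicator (1 : Z → ℝ) z * χ u| ≤ 1 := fun z u => by
      rw [abs_mul]; exact mul_le_one₀ (b1 z) (abs_nonneg _) (b2 u)
    have i1 : Integrable f P := .of_bound hf.aestronglyMeasurable M (.of_forall hfM)
    have i2 : Integrable (fun ω => S.indicator 1 (ξ ω) * χ (Y r ω) * f ω) P := by
      refine .of_bound (((hm.comp hξ).mul (hχ.continuous.measurable.comp (hY r))).mul
        hf).aestronglyMeasurable M (.of_forall fun ω => ?_)
      rw [norm_mul]
      simpa using mul_le_mul (b3 (ξ ω) (Y r ω)) (hfM ω) (abs_nonneg _) zero_le_one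
    have m1 : MeasurableSet {ω | R < ‖ξ ω‖} := measurableSet_lt measurable_const hξ.norm
    have m2 : MeasurableSet {ω | R / 2 < ‖Y r ω‖} := measurableSet_lt measurable_const (hY r).norm
    have i3 : Integrable (fun ω => {ω | R < ‖ξ ω‖}.indicator (1 : Ω → ℝ) ω) P :=
      (integrable_const 1).indicator m1
    have i4 : Integrable (fun ω => {ω | R / 2 < ‖Y r ω‖}.indicator (1 : Ω → ℝ) ω) P :=
      (integrable_const 1).indicator m2
    rw [← integral_sub i1 i2, ← integral_indicator_one m1, ← integral_indicator_one m2,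
      ← integral_add i3 i4, ← integral_const_mul, ← Real.norm_eq_abs]
    refine norm_integral_le_of_norm_le ((i3.add i4).const_mul _) (.of_forall fun ω => ?_)
    have e : f ω - S.indicator 1 (ξ ω) * χ (Y r ω) * f ω
        = (1 - S.indicator 1 (ξ ω) * χ (Y r ω)) * f ω := by ring
    rw [e, norm_mul, mul_comm]
    refine mul_le_mul (hfM ω) ?_ (norm_nonneg _) M.2
    have n1 : (0 : ℝ) ≤ {ω | R < ‖ξ ω‖}.indicator 1 ω := indicator_nonneg (by simp) _
    have n2 : (0 : ℝ) ≤ {ω | R / 2 < ‖Y r ω‖}.indicator 1 ω := indicator_nonneg (by simp) _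
    have n3 : 0 ≤ S.indicator (1 : Z → ℝ) (ξ ω) * χ (Y r ω) :=
      mul_nonneg (indicator_nonneg (by simp) _) (hχ0 _)
    have n4 : ‖1 - S.indicator (1 : Z → ℝ) (ξ ω) * χ (Y r ω)‖ ≤ 1 := by
      rw [Real.norm_eq_abs, abs_le]
      have := (abs_le.1 (b3 (ξ ω) (Y r ω))).2
      constructor <;> linarith
    by_cases k1 : R < ‖ξ ω‖
    · have : {ω | R < ‖ξ ω‖}.indicator (1 : Ω → ℝ) ω = 1 := indicator_of_mem (by exact k1) _
      rw [this]; linarith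
    by_cases k2 : R / 2 < ‖Y r ω‖
    · have : {ω | R / 2 < ‖Y r ω‖}.indicator (1 : Ω → ℝ) ω = 1 := indicator_of_mem (by exact k2) _
      rw [this]; linarith
    · have hz : ξ ω ∈ S := by simpa [S] using not_lt.1 k1
      rw [indicator_of_mem hz, hχe _ (not_lt.1 k2)]
      simp only [Pi.one_apply, mul_one, sub_self, norm_zero]
      linarith
  have hT1 := hcut T (fun ω => Φ (ξ ω, Y T ω)) (hΦ.comp (hξ.prodMk (hY T))) (fun ω => hΦM _)
  have h01 := hcut 0 (fun ω => Φ (ξ ω, euler (trunc T R v) (T / N) 0 N (ξ ω) (Y 0 ω)))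
    (hΦ.comp (hξ.prodMk ((measurable_euler (δ := T / N) hw 0 N).comp (hξ.prodMk (hY 0)))))
    (fun ω => hΦM _)
  have hcR : ((c / R.toNNReal : ℝ≥0) : ℝ) = c / R := by
    rw [NNReal.coe_div, Real.coe_toNNReal _ hR.le]
  rw [hcR] at hmain
  set I1 := ∫ ω, Φ (ξ ω, Y T ω) ∂P
  set I0 := ∫ ω, Φ (ξ ω, euler (trunc T R v) (T / N) 0 N (ξ ω) (Y 0 ω)) ∂P
  set J1 := ∫ ω, S.indicator 1 (ξ ω) * χ (Y T ω) * Φ (ξ ω, Y T ω) ∂P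
  set J0 := ∫ ω, S.indicator 1 (ξ ω) * χ (Y 0 ω) *
          Φ (ξ ω, euler (trunc T R v) (T / N) 0 N (ξ ω) (Y 0 ω)) ∂P
  calc |I1 - I0| = |(I1 - J1) + (J1 - J0) - (I0 - J0)| := by congr 1; ring
    _ ≤ |I1 - J1| + |J1 - J0| + |I0 - J0| :=
        (abs_sub _ _).trans (add_le_add (abs_add_le _ _) le_rfl)
    _ ≤ ε := by linarith

end Truncation

/-! ### Least squares and conditional means -/

section CondMean

open scoped RealInnerProductSpace

/-- First-order condition for a least-squares minimizer. -/
lemma integral_inner_eq_zero_of_minimal {α F : Type*} [MeasurableSpace α] {μ : Measure α}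
    [NormedAddCommGroup F] [InnerProductSpace ℝ F] {f g : α → F} (hf : MemLp f 2 μ)
    (hg : MemLp g 2 μ) (h : ∀ s : ℝ, ∫ x, ‖f x‖ ^ 2 ∂μ ≤ ∫ x, ‖f x - s • g x‖ ^ 2 ∂μ) :
    ∫ x, ⟪f x, g x⟫ ∂μ = 0 := by
  have h1 : Integrable (fun x => ‖f x‖ ^ 2) μ := (memLp_two_iff_integrable_sq_norm hf.1).1 hf
  have h2 : Integrable (fun x => ‖g x‖ ^ 2) μ := (memLp_two_iff_integrable_sq_norm hg.1).1 hg
  have h3 : Integrable (fun x => ⟪f x, g x⟫) μ := by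
    refine (h1.add h2).mono' (hf.1.inner hg.1) (.of_forall fun x => ?_)
    refine (norm_inner_le_norm _ _).trans ?_
    simp only [Pi.add_apply]
    nlinarith [sq_nonneg (‖f x‖ - ‖g x‖), norm_nonneg (f x), norm_nonneg (g x)]
  set I := ∫ x, ⟪f x, g x⟫ ∂μ
  set J := ∫ x, ‖g x‖ ^ 2 ∂μ
  have hJ : 0 ≤ J := integral_nonneg fun _ => by positivity
  have key : ∀ s : ℝ, 0 ≤ -(2 * s * I) + s ^ 2 * J := by
    intro s
    have e : ∫ x, ‖f x - s • g x‖ ^ 2 ∂μ = ∫ x, ‖f x‖ ^ 2 ∂μ - 2 * s * I + s ^ 2 * J := by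
      have : ∀ x, ‖f x - s • g x‖ ^ 2 = ‖f x‖ ^ 2 - (2 * s) * ⟪f x, g x⟫ + s ^ 2 * ‖g x‖ ^ 2 := by
        intro x
        rw [norm_sub_sq_real, inner_smul_right, norm_smul, mul_pow, Real.norm_eq_abs, sq_abs]
        ring
      have h4 : Integrable (fun x => ‖f x‖ ^ 2 - (2 * s) * ⟪f x, g x⟫) μ := h1.sub (h3.const_mul _)
      simp_rw [this]
      rw [integral_add h4 (h2.const_mul _),
        integral_sub h1 (h3.const_mul _), integral_const_mul, integral_const_mul]
    have := h s
    rw [e] at this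
    linarith
  -- The optimal step is `I / J`; the denominator `J + 1` also covers `J = 0` and still makes the
  -- quadratic negative unless `I = 0`.
  have := key (I / (J + 1))
  have e : -(2 * (I / (J + 1)) * I) + (I / (J + 1)) ^ 2 * J
      = -(I ^ 2 * (J + 2) / (J + 1) ^ 2) := by field_simp; ring
  rw [e] at this
  have h4 : I ^ 2 * (J + 2) / (J + 1) ^ 2 ≤ 0 := by linarith
  have h5 : 0 ≤ I ^ 2 * (J + 2) / (J + 1) ^ 2 := by positivity
  have h6 : I ^ 2 * (J + 2) / (J + 1) ^ 2 = 0 := le_antisymm h4 h5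
  rw [div_eq_zero_iff] at h6
  rcases h6 with h6 | h6
  · rcases mul_eq_zero.1 h6 with h7 | h7
    · exact pow_eq_zero_iff (two_ne_zero) |>.1 h7
    · linarith
  · have : (0 : ℝ) < (J + 1) ^ 2 := by positivity
    linarith

variable {E : Type*} [NormedAddCommGroup E] [NormedSpace ℝ E] [FiniteDimensional ℝ E]
  [MeasurableSpace E] [BorelSpace E] {Ω : Type*} [MeasurableSpace Ω] {P : Measure Ω}
  [IsProbabilityMeasure P]

/-- Existence of the conditional mean `β` of `D` given `W`, as a function on the range of `W`. -/
lemma exists_condMean {A : Type*} [MeasurableSpace A] {W : Ω → A} {D : Ω → E} (hW : Measurable W)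
    (hD : Measurable D) (hDi : Integrable D P) : ∃ β : A → E, Measurable β ∧
      Integrable β (P.map W) ∧ ∀ l : A → E →L[ℝ] ℝ, Measurable l → (∃ K, ∀ q, ‖l q‖ ≤ K) →
        ∫ ω, l (W ω) (D ω) ∂P = ∫ w, l w (β w) ∂(P.map W) := by
  have := Measure.isProbabilityMeasure_map (μ := P) hW.aemeasurable
  have : CompleteSpace E := FiniteDimensional.complete ℝ E
  have hcomp : (P.map W) ⊗ₘ condDistrib D W P = P.map fun ω => (W ω, D ω) :=
    compProd_map_condDistrib hD.aemeasurable
  have hi2 : Integrable (fun q : A × E => q.2) ((P.map W) ⊗ₘ condDistrib D W P) := by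
    rw [hcomp, integrable_map_measure (by fun_prop) (by fun_prop)]
    exact hDi
  have hsm : StronglyMeasurable fun w => ∫ y, y ∂condDistrib D W P w :=
    StronglyMeasurable.integral_condDistrib (f := fun q : A × E => q.2)
      measurable_snd.stronglyMeasurable
  have hae := ((Measure.integrable_compProd_iff hi2.1).1 hi2).1
  refine ⟨fun w => ∫ y, y ∂condDistrib D W P w, hsm.measurable, ?_, fun l hl ⟨K, hK⟩ => ?_⟩
  · refine ((Measure.integrable_compProd_iff hi2.1).1 hi2).2.mono' hsm.aestronglyMeasurable
      (.of_forall fun w => norm_integral_le_integral_norm _)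
  · have hm : Measurable fun q : A × E => l q.1 q.2 :=
      (hl.comp measurable_fst).clm_apply_vec measurable_snd
    have hli : Integrable (fun q : A × E => l q.1 q.2) ((P.map W) ⊗ₘ condDistrib D W P) :=
      (hi2.norm.const_mul K).mono' hm.aestronglyMeasurable (.of_forall fun q =>
        ((l _).le_opNorm _).trans (mul_le_mul_of_nonneg_right (hK _) (norm_nonneg _)))
    calc ∫ ω, l (W ω) (D ω) ∂P
        = ∫ q : A × E, l q.1 q.2 ∂(P.map fun ω => (W ω, D ω)) := by
          rw [integral_map (hW.prodMk hD).aemeasurable hm.aestronglyMeasurable]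
      _ = ∫ w, ∫ y, l w y ∂condDistrib D W P w ∂(P.map W) := by
          rw [← hcomp, Measure.integral_compProd hli]
      _ = _ := by
          refine integral_congr_ae (hae.mono fun w hw => ?_)
          exact (l w).integral_comp_comm hw

/-- A continuous field that has the same smooth moments as `D` is the conditional mean of `D`. -/
lemma integral_eq_of_contDiff_test {A : Type*} [NormedAddCommGroup A] [NormedSpace ℝ A]
    [FiniteDimensional ℝ A] [MeasurableSpace A] [BorelSpace A] {W : Ω → A} {D : Ω → E}
    (hW : Measurable W) (hD : Measurable D) (hDi : Integrable D P) {α : A → E} (hα : Continuous α)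
    (h : ∀ k : A → ℝ, ContDiff ℝ ((⊤ : ℕ∞) : WithTop ℕ∞) k → HasCompactSupport k →
      ∫ ω, k (W ω) • D ω ∂P = ∫ ω, k (W ω) • α (W ω) ∂P)
    (l : A → E →L[ℝ] ℝ) (hl : Measurable l) (hb : ∃ K, ∀ q, ‖l q‖ ≤ K) :
    ∫ ω, l (W ω) (D ω) ∂P = ∫ ω, l (W ω) (α (W ω)) ∂P := by
  have := Measure.isProbabilityMeasure_map (μ := P) hW.aemeasurable
  have : CompleteSpace E := FiniteDimensional.complete ℝ E
  obtain ⟨β, hβ, hβi, hβl⟩ := exists_condMean (P := P) hW hD hDi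
  -- Smooth compactly supported tests determine a locally integrable function almost everywhere. For
  -- `α` continuity is enough at this point; its integrability is not known beforehand and follows
  -- from the identification with `β`.
  have hae : ∀ᵐ w ∂(P.map W), β w = α w := by
    refine ae_eq_of_integral_contDiff_smul_eq hβi.locallyIntegrable hα.locallyIntegrable
      fun k hk hks => ?_
    obtain ⟨K, hK⟩ := hk.continuous.bounded_above_of_compact_support hks
    have hkm : Measurable k := hk.continuous.measurable
    have i1 : Integrable (fun w => k w • β w) (P.map W) :=
      hβi.bdd_smul K hkm.aestronglyMeasurable (.of_forall hK)
    have i2 : Integrable (fun ω => k (W ω) • D ω) P :=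
      hDi.bdd_smul K (hkm.comp hW).aestronglyMeasurable (.of_forall fun ω => hK _)
    have e2 : ∫ w, k w • α w ∂(P.map W) = ∫ ω, k (W ω) • D ω ∂P := by
      rw [h k hk hks, integral_map hW.aemeasurable]
      exact (hkm.smul hα.measurable).aestronglyMeasurable
    rw [e2]
    refine (SeparatingDual.eq_iff_forall_dual_eq (R := ℝ)).2 fun φ => ?_
    rw [← φ.integral_comp_comm i1, ← φ.integral_comp_comm i2]
    have := hβl (fun w => k w • φ) (by fun_prop) ⟨K * ‖φ‖, fun q => by
      rw [norm_smul]; exact mul_le_mul_of_nonneg_right (hK q) (norm_nonneg _)⟩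
    simpa using this.symm
  rw [hβl l hl hb, ← integral_map (f := fun w => l w (α w)) hW.aemeasurable
    (hl.clm_apply_vec hα.measurable).aestronglyMeasurable]
  exact integral_congr_ae (hae.mono fun w hw => by simp only [hw])

end CondMean

/-! ### The trained field as a conditional mean, at every time -/

section Training

open scoped RealInnerProductSpace

variable {d : ℕ}

instance : IsProbabilityMeasure unif := ⟨by simp [unif]⟩

/-- Position `x_t` of a training sample `((x₀, x₁), v₀)`. -/
def posn (t : ℝ) (q : (Pt d × Pt d) × Pt d) : Pt d := lerp t q.1.1 q.1.2

/-- Velocity `v_τ` of a training sample `((x₀, x₁), v₀)`. -/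
def veln (τ : ℝ) (q : (Pt d × Pt d) × Pt d) : Pt d := lerp τ q.2 (q.1.2 - q.1.1)

/-- Acceleration of a training sample `((x₀, x₁), v₀)`. -/
def accel (q : (Pt d × Pt d) × Pt d) : Pt d := q.1.2 - q.1.1 - q.2

lemma continuous_accel : Continuous (accel : (Pt d × Pt d) × Pt d → Pt d) := by
  unfold accel; fun_prop

lemma measurable_posn (t : ℝ) : Measurable (posn t : (Pt d × Pt d) × Pt d → Pt d) := by
  unfold posn lerp; fun_prop

lemma measurable_veln (τ : ℝ) : Measurable (veln τ : (Pt d × Pt d) × Pt d → Pt d) := by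
  unfold veln lerp; fun_prop

/-- The argument of the acceleration field at a sample and at the times `(τ, t)`. -/
def samplePoint (r : ((Pt d × Pt d) × Pt d) × ℝ × ℝ) : Pt d × ℝ × Pt d × ℝ :=
  (posn r.2.2 r.1, r.2.2, veln r.2.1 r.1, r.2.1)

lemma continuous_samplePoint :
    Continuous (samplePoint : ((Pt d × Pt d) × Pt d) × ℝ × ℝ → Pt d × ℝ × Pt d × ℝ) := by
  unfold samplePoint posn veln lerp; fun_prop

lemma measurePreserving_rearrange {α β : Type*} [MeasurableSpace α] [MeasurableSpace β]
    (μ : Measure α) (ν : Measure β) (κ : Measure ℝ) [SFinite μ] [SFinite ν] [SFinite κ] :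
    MeasurePreserving (fun r : (α × β) × ℝ × ℝ => (r.1.1, r.2.2, r.1.2, r.2.1))
      ((μ.prod ν).prod (κ.prod κ)) (μ.prod (κ.prod (ν.prod κ))) := by
  have h1 := measurePreserving_prodAssoc μ ν (κ.prod κ)
  have h2 := (measurePreserving_prodAssoc ν κ κ).symm
  have h3 : MeasurePreserving Prod.swap ((ν.prod κ).prod κ) (κ.prod (ν.prod κ)) :=
    Measure.measurePreserving_swap
  exact ((MeasurePreserving.id μ).prod (h3.comp h2)).comp h1

variable {γ : Measure (Pt d × Pt d)} {π₀ : Measure (Pt d)} [IsProbabilityMeasure γ]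
  [IsProbabilityMeasure π₀] {a : AccField d}

lemma trainingLoss_eq (ha : Measurable a.flat) : trainingLoss γ π₀ a =
    ∫⁻ r, ‖accel r.1 - a.flat (samplePoint r)‖ₑ ^ 2 ∂((γ.prod π₀).prod (unif.prod unif)) := by
  rw [trainingLoss, ← (measurePreserving_rearrange γ π₀ unif).lintegral_comp]
  · rfl
  · have h1 : Measurable fun q : (Pt d × Pt d) × ℝ × Pt d × ℝ =>
        a.flat (lerp q.2.1 q.1.1 q.1.2, q.2.1, lerp q.2.2.2 q.2.2.1 (q.1.2 - q.1.1), q.2.2.2) :=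
      ha.comp (by unfold lerp; fun_prop)
    have h2 : Measurable fun q : (Pt d × Pt d) × ℝ × Pt d × ℝ => q.1.2 - q.1.1 - q.2.2.1 := by
      fun_prop
    exact (h2.sub h1).enorm.pow_const 2

lemma memLp_accel (hγ : Integrable (fun p : Pt d × Pt d => ‖p.2 - p.1‖ ^ 2) γ)
    (hπ : Integrable (fun v : Pt d => ‖v‖ ^ 2) π₀) : MemLp accel 2 (γ.prod π₀) := by
  have h1 : MemLp (fun p : Pt d × Pt d => p.2 - p.1) 2 γ :=
    (memLp_two_iff_integrable_sq_norm (by fun_prop)).2 hγ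
  have h2 : MemLp (fun v : Pt d => v) 2 π₀ := (memLp_two_iff_integrable_sq_norm (by fun_prop)).2 hπ
  exact (h1.comp_measurePreserving measurePreserving_fst).sub
    (h2.comp_measurePreserving measurePreserving_snd)

lemma integral_norm_sq_eq_toReal {α : Type*} [MeasurableSpace α] {μ : Measure α} {f : α → Pt d}
    (hf : AEStronglyMeasurable f μ) :
    ∫ x, ‖f x‖ ^ 2 ∂μ = (∫⁻ x, ‖f x‖ₑ ^ 2 ∂μ).toReal := by
  have := integral_norm_eq_lintegral_enorm (f := fun x => ‖f x‖ ^ 2) (hf.norm.pow 2)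
  simpa [enorm_pow] using this

lemma memLp_two_of_lintegral_lt_top {α : Type*} [MeasurableSpace α] {μ : Measure α} {f : α → Pt d}
    (hf : AEStronglyMeasurable f μ) (h : ∫⁻ x, ‖f x‖ₑ ^ 2 ∂μ < ∞) : MemLp f 2 μ := by
  rw [memLp_two_iff_integrable_sq_norm hf]
  refine ⟨hf.norm.pow 2, ?_⟩
  rw [hasFiniteIntegral_iff_enorm]
  simpa [enorm_pow] using h

lemma lintegral_lt_top_of_memLp_two {α : Type*} [MeasurableSpace α] {μ : Measure α} {f : α → Pt d}
    (h : MemLp f 2 μ) : ∫⁻ x, ‖f x‖ₑ ^ 2 ∂μ < ∞ := by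
  have := ((memLp_two_iff_integrable_sq_norm h.1).1 h).2
  rw [hasFiniteIntegral_iff_enorm] at this
  simpa [enorm_pow] using this

/-- The zero field has finite loss, because the acceleration is square integrable; hence the minimal
loss is finite too. -/
lemma IsTrained.memLp_residual (ha : IsTrained γ π₀ a) (hacc : MemLp accel 2 (γ.prod π₀)) :
    MemLp (fun r => accel r.1 - a.flat (samplePoint r)) 2
      ((γ.prod π₀).prod (unif.prod unif)) := by
  have hA : MemLp (fun r : ((Pt d × Pt d) × Pt d) × ℝ × ℝ => accel r.1) 2
      ((γ.prod π₀).prod (unif.prod unif)) := hacc.comp_measurePreserving measurePreserving_fst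
  refine memLp_two_of_lintegral_lt_top ?_ ?_
  · exact ((continuous_accel.measurable.comp measurable_fst).sub
      (ha.measurable.comp continuous_samplePoint.measurable)).aestronglyMeasurable
  · rw [← trainingLoss_eq ha.measurable]
    have h0 : Measurable (AccField.flat (fun _ _ _ _ => (0 : Pt d))) := measurable_const
    refine (ha.minimal _ h0).trans_lt ?_
    rw [trainingLoss_eq h0]
    simpa [AccField.flat] using lintegral_lt_top_of_memLp_two hA

/-- Euler–Lagrange equation: the fields `a + s • g` are all admissible competitors, so the residual
is orthogonal to `g`. -/
lemma IsTrained.integral_inner_eq_zero (ha : IsTrained γ π₀ a)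
    (hacc : MemLp accel 2 (γ.prod π₀)) {g : Pt d × ℝ × Pt d × ℝ → Pt d} (hg : Measurable g)
    {K : ℝ} (hK : ∀ x, ‖g x‖ ≤ K) :
    ∫ r, ⟪accel r.1 - a.flat (samplePoint r), g (samplePoint r)⟫
      ∂((γ.prod π₀).prod (unif.prod unif)) = 0 := by
  have hs := continuous_samplePoint (d := d) |>.measurable
  have hf := ha.memLp_residual hacc
  have hgm : MemLp (fun r : ((Pt d × Pt d) × Pt d) × ℝ × ℝ => g (samplePoint r)) 2
      ((γ.prod π₀).prod (unif.prod unif)) :=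
    .of_bound (hg.comp hs).aestronglyMeasurable K (.of_forall fun r => hK _)
  refine integral_inner_eq_zero_of_minimal hf hgm fun s => ?_
  let a' : AccField d := fun x t u τ => a x t u τ + s • g (x, t, u, τ)
  have ha' : a'.flat = fun q => a.flat q + s • g q := rfl
  have ham : Measurable a'.flat := by
    rw [ha']; exact ha.measurable.add (hg.const_smul s)
  have hm := ha.minimal a' ham
  rw [trainingLoss_eq ha.measurable, trainingLoss_eq ham, ha'] at hm
  simp only [← sub_sub] at hm
  have hf2 : MemLp (fun r => accel r.1 - a.flat (samplePoint r) - s • g (samplePoint r)) 2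
      ((γ.prod π₀).prod (unif.prod unif)) := hf.sub (hgm.const_smul s)
  rw [integral_norm_sq_eq_toReal hf.1, integral_norm_sq_eq_toReal hf2.1]
  exact ENNReal.toReal_mono (lintegral_lt_top_of_memLp_two hf2).ne hm

lemma IsRegularAcc.exists_bound (hr : IsRegularAcc a) (R : ℝ) {s : ℝ} (hs : s < 1) :
    ∃ A : ℝ, 0 ≤ A ∧ ∀ x u, ‖x‖ ≤ R → ‖u‖ ≤ R → ∀ t ∈ Icc 0 s, ∀ τ ∈ Icc 0 s,
      ‖a x t u τ‖ ≤ A := by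
  have hc : IsCompact (Metric.closedBall (0 : Pt d) R ×ˢ Icc 0 s ×ˢ
      Metric.closedBall (0 : Pt d) R ×ˢ Icc 0 s) :=
    (isCompact_closedBall _ _).prod (isCompact_Icc.prod
      ((isCompact_closedBall _ _).prod isCompact_Icc))
  obtain ⟨A, hA⟩ := hc.exists_bound_of_continuousOn (hr.continuousOn.mono fun q hq =>
    ⟨mem_univ _, ⟨hq.2.1.1, hq.2.1.2.trans_lt hs⟩, mem_univ _,
      ⟨hq.2.2.2.1, hq.2.2.2.2.trans_lt hs⟩⟩)
  refine ⟨max A 0, le_max_right _ _, fun x u hx hu t ht τ hτ => le_trans ?_ (le_max_left _ _)⟩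
  exact hA (x, t, u, τ) ⟨by simpa using hx, ht, by simpa using hu, hτ⟩

/-- The moment of the training residual at the fixed times `s = (τ, t)`. -/
def residualMoment (γ : Measure (Pt d × Pt d)) (π₀ : Measure (Pt d)) (a : AccField d)
    (k : Pt d × Pt d → ℝ) (e : Pt d) (s : ℝ × ℝ) : ℝ :=
  ∫ q, k (posn s.2 q, veln s.1 q) * ⟪accel q - a.flat (samplePoint (q, s)), e⟫ ∂(γ.prod π₀)

/-- Localization in time: test fields carrying the indicator of an arbitrary set `B` of time pairs
show that the integral of the moment over `B` vanishes. -/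
lemma IsTrained.ae_residualMoment_eq_zero (ha : IsTrained γ π₀ a)
    (hacc : MemLp accel 2 (γ.prod π₀)) {k : Pt d × Pt d → ℝ} (hk : Continuous k)
    (hks : HasCompactSupport k) (e : Pt d) :
    ∀ᵐ s ∂(unif.prod unif), residualMoment γ π₀ a k e s = 0 := by
  obtain ⟨K, hK⟩ := hk.bounded_above_of_compact_support hks
  have hf1 : Integrable (fun r => accel r.1 - a.flat (samplePoint r))
      ((γ.prod π₀).prod (unif.prod unif)) := (ha.memLp_residual hacc).integrable (by norm_num)
  have hkm : Measurable fun r : ((Pt d × Pt d) × Pt d) × ℝ × ℝ =>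
      k (posn r.2.2 r.1, veln r.2.1 r.1) := by
    refine hk.measurable.comp ?_
    unfold posn veln lerp; fun_prop
  have hF : Integrable (fun r : ((Pt d × Pt d) × Pt d) × ℝ × ℝ =>
      k (posn r.2.2 r.1, veln r.2.1 r.1) * ⟪accel r.1 - a.flat (samplePoint r), e⟫)
      ((γ.prod π₀).prod (unif.prod unif)) :=
    (hf1.inner_const e).bdd_mul hkm.aestronglyMeasurable (.of_forall fun r => hK _)
  refine Integrable.ae_eq_zero_of_forall_setIntegral_eq_zero hF.integral_prod_right
    fun B hB _ => ?_
  have hg : Measurable fun x : Pt d × ℝ × Pt d × ℝ =>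
      (B.indicator 1 (x.2.2.2, x.2.1) * k (x.1, x.2.2.1)) • e := by
    refine Measurable.smul_const (Measurable.mul ?_ ?_) e
    · exact (measurable_one.indicator hB).comp (by fun_prop)
    · exact hk.measurable.comp (by fun_prop)
  have h0 := ha.integral_inner_eq_zero hacc hg (K := K * ‖e‖) (fun x => by
    rw [norm_smul, norm_mul]
    refine mul_le_mul_of_nonneg_right ?_ (norm_nonneg _)
    by_cases hx : (x.2.2.2, x.2.1) ∈ B
    · rw [indicator_of_mem hx]; simpa using hK _
    · rw [indicator_of_notMem hx]; simpa using (norm_nonneg _).trans (hK 0))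
  have h1 : ∀ r : ((Pt d × Pt d) × Pt d) × ℝ × ℝ,
      ⟪accel r.1 - a.flat (samplePoint r),
        (B.indicator (1 : ℝ × ℝ → ℝ) ((samplePoint r).2.2.2, (samplePoint r).2.1) *
          k ((samplePoint r).1, (samplePoint r).2.2.1)) • e⟫
      = (univ ×ˢ B).indicator (fun r => k (posn r.2.2 r.1, veln r.2.1 r.1) *
          ⟪accel r.1 - a.flat (samplePoint r), e⟫) r := by
    intro r
    rw [inner_smul_right]
    rw [show ((samplePoint r).2.2.2, (samplePoint r).2.1) = r.2 from rfl]
    by_cases hx : r.2 ∈ B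
    · have hx' : r ∈ (univ : Set ((Pt d × Pt d) × Pt d)) ×ˢ B := ⟨mem_univ _, hx⟩
      rw [indicator_of_mem hx', indicator_of_mem hx]
      simp [samplePoint]
    · have hx' : r ∉ (univ : Set ((Pt d × Pt d) × Pt d)) ×ˢ B := fun h => hx h.2
      rw [indicator_of_notMem hx', indicator_of_notMem hx]
      simp
  simp_rw [h1] at h0
  rw [integral_indicator (MeasurableSet.univ.prod hB), ← Measure.prod_restrict,
    Measure.restrict_univ] at h0
  rw [integral_prod_symm] at h0
  · exact h0
  · rw [← Measure.restrict_univ (μ := γ.prod π₀), Measure.prod_restrict]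
    exact hF.integrableOn

/-- Dominated convergence. Where `k` does not vanish, the arguments of `a` stay in a compact set, on
which `a` is bounded; elsewhere the integrand is zero. -/
lemma continuousOn_residualMoment (hr : IsRegularAcc a) (ham : Measurable a.flat)
    (hacc : Integrable accel (γ.prod π₀)) {k : Pt d × Pt d → ℝ} (hk : Continuous k)
    (hks : HasCompactSupport k) (e : Pt d) {s : ℝ} (hs : s < 1) :
    ContinuousOn (residualMoment γ π₀ a k e) (Icc 0 s ×ˢ Icc 0 s) := by
  obtain ⟨K, hK⟩ := hk.bounded_above_of_compact_support hks
  have hK0 : 0 ≤ K := (norm_nonneg _).trans (hK 0)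
  obtain ⟨R, hR⟩ := hks.isCompact.isBounded.exists_norm_le
  obtain ⟨A, hA0, hA⟩ := hr.exists_bound R hs
  have hmk : ∀ x : ℝ × ℝ, Measurable fun q : (Pt d × Pt d) × Pt d =>
      k (posn x.2 q, veln x.1 q) := fun x =>
    hk.measurable.comp ((measurable_posn _).prodMk (measurable_veln _))
  have hms : ∀ x : ℝ × ℝ, Measurable fun q : (Pt d × Pt d) × Pt d => a.flat (samplePoint (q, x)) :=
    fun x => ham.comp (continuous_samplePoint.measurable.comp (by fun_prop))
  refine continuousOn_of_dominated (bound := fun q => K * (‖accel q‖ + A) * ‖e‖) ?_ ?_ ?_ ?_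
  · intro x _
    exact ((hmk x).mul ((continuous_accel.measurable.sub (hms x)).inner
      measurable_const)).aestronglyMeasurable
  · refine fun x hx => .of_forall fun q => ?_
    rw [norm_mul, mul_assoc]
    by_cases h0 : k (posn x.2 q, veln x.1 q) = 0
    · rw [h0, norm_zero, zero_mul]; positivity
    · refine mul_le_mul (hK _) ((norm_inner_le_norm _ _).trans ?_) (norm_nonneg _) hK0
      refine mul_le_mul_of_nonneg_right ((norm_sub_le _ _).trans ?_) (norm_nonneg _)
      have hm := hR _ (subset_tsupport _ h0)
      rw [Prod.norm_def, max_le_iff] at hm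
      have := hA (posn x.2 q) (veln x.1 q) hm.1 hm.2 x.2 hx.2 x.1 hx.1
      simpa [samplePoint, AccField.flat] using this
  · exact ((hacc.norm.add (integrable_const A)).const_mul K).mul_const _
  · refine .of_forall fun q => ?_
    have h1 : Continuous fun x : ℝ × ℝ => k (posn x.2 q, veln x.1 q) := by
      refine hk.comp ?_
      unfold posn veln lerp; fun_prop
    have h2 : ContinuousOn (fun x : ℝ × ℝ => a.flat (samplePoint (q, x))) (Icc 0 s ×ˢ Icc 0 s) :=
      hr.continuousOn.comp (continuous_samplePoint.comp (by fun_prop)).continuousOn fun x hx =>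
        ⟨mem_univ _, ⟨hx.2.1, hx.2.2.trans_lt hs⟩, mem_univ _, ⟨hx.1.1, hx.1.2.trans_lt hs⟩⟩
    exact h1.continuousOn.mul ((continuousOn_const.sub h2).inner continuousOn_const)

/-- Training controls `a` only for almost every pair of times, while the velocity ODE is solved at
one fixed `t`, a null set. Continuity in time bridges the gap. -/
lemma IsTrained.residualMoment_eq_zero (ha : IsTrained γ π₀ a) (hr : IsRegularAcc a)
    (hacc : MemLp accel 2 (γ.prod π₀)) {k : Pt d × Pt d → ℝ} (hk : Continuous k)
    (hks : HasCompactSupport k) (e : Pt d) {t τ : ℝ} (ht : t ∈ Ico (0 : ℝ) 1)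
    (hτ : τ ∈ Ico (0 : ℝ) 1) : residualMoment γ π₀ a k e (τ, t) = 0 := by
  -- The square `[0, s]²` contains `(τ, t)`, stays away from the singular time `1`, and has `s > 0`,
  -- so that it is the closure of its interior, where null sets cannot hide a value.
  obtain ⟨s, hs1, hs2⟩ := exists_between (max_lt (max_lt ht.2 hτ.2) zero_lt_one)
  have hs0 : 0 < s := (le_max_right _ _).trans_lt hs1
  have hts : t ≤ s := ((le_max_left t τ).trans (le_max_left _ _)).trans hs1.le
  have hτs : τ ≤ s := ((le_max_right t τ).trans (le_max_left _ _)).trans hs1.le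
  have hae : residualMoment γ π₀ a k e
      =ᵐ[volume.restrict (Icc (0 : ℝ) s ×ˢ Icc (0 : ℝ) s)] fun _ => (0 : ℝ) := by
    have h := ha.ae_residualMoment_eq_zero hacc hk hks e
    rw [unif, Measure.prod_restrict] at h
    exact ae_restrict_of_ae_restrict_of_subset
      (prod_mono (Icc_subset_Icc_right hs2.le) (Icc_subset_Icc_right hs2.le)) h
  refine Measure.eqOn_of_ae_eq hae (continuousOn_residualMoment hr ha.measurable
    (hacc.integrable (by norm_num)) hk hks e hs2) continuousOn_const ?_
    (⟨⟨hτ.1, hτs⟩, ⟨ht.1, hts⟩⟩ : ((τ, t) : ℝ × ℝ) ∈ Icc (0 : ℝ) s ×ˢ Icc (0 : ℝ) s)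
  rw [interior_prod_eq, closure_prod_eq, closure_interior_Icc hs0.ne]

/-- At all times in `[0, 1)` the trained field is the conditional mean of the acceleration. -/
theorem IsTrained.integral_eq (ha : IsTrained γ π₀ a) (hr : IsRegularAcc a)
    (hacc : MemLp accel 2 (γ.prod π₀)) {t τ : ℝ} (ht : t ∈ Ico (0 : ℝ) 1)
    (hτ : τ ∈ Ico (0 : ℝ) 1) (l : Pt d × Pt d → Pt d →L[ℝ] ℝ) (hl : Measurable l)
    (hb : ∃ K, ∀ q, ‖l q‖ ≤ K) :
    ∫ q, l (posn t q, veln τ q) (accel q) ∂(γ.prod π₀)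
      = ∫ q, l (posn t q, veln τ q) (a (posn t q) t (veln τ q) τ) ∂(γ.prod π₀) := by
  have hacc1 : Integrable accel (γ.prod π₀) := hacc.integrable (by norm_num)
  have hW : Measurable fun q : (Pt d × Pt d) × Pt d => (posn t q, veln τ q) :=
    (measurable_posn t).prodMk (measurable_veln τ)
  have hα : Continuous fun w : Pt d × Pt d => a w.1 t w.2 τ :=
    hr.continuousOn.comp_continuous (f := fun w : Pt d × Pt d => (w.1, t, w.2, τ)) (by fun_prop)
      fun w => ⟨mem_univ _, ht, mem_univ _, hτ⟩
  refine integral_eq_of_contDiff_test hW continuous_accel.measurable hacc1 hα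
    (fun k hk hks => ?_) l hl hb
  obtain ⟨K, hK⟩ := hk.continuous.bounded_above_of_compact_support hks
  have hkm : Measurable k := hk.continuous.measurable
  have i1 : Integrable (fun q => k (posn t q, veln τ q) • accel q) (γ.prod π₀) :=
    hacc1.bdd_smul K (hkm.comp hW).aestronglyMeasurable (.of_forall fun q => hK _)
  -- At fixed times `a` is not yet known to be integrable along the samples; its product with `k` is
  -- continuous with compact support, hence bounded.
  have i2 : Integrable (fun q => k (posn t q, veln τ q) • a (posn t q) t (veln τ q) τ)
      (γ.prod π₀) := by
    obtain ⟨B, hB⟩ := (hk.continuous.smul hα).bounded_above_of_compact_support hks.smul_right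
    exact .of_bound (((hkm.smul hα.measurable).comp hW).aestronglyMeasurable) B
      (.of_forall fun q => hB _)
  have i3 : Integrable (fun q => k (posn t q, veln τ q) • accel q
      - k (posn t q, veln τ q) • a (posn t q) t (veln τ q) τ) (γ.prod π₀) := i1.sub i2
  rw [← sub_eq_zero, ← integral_sub i1 i2]
  refine ext_inner_right ℝ fun e => ?_
  rw [inner_zero_left, ← ha.residualMoment_eq_zero hr hacc hk.continuous hks e ht hτ,
    real_inner_comm, ← integral_inner i3, residualMoment]
  refine integral_congr_ae (.of_forall fun q => ?_)
  dsimp only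
  rw [← smul_sub, inner_smul_right, real_inner_comm]
  rfl

end Training

/-! ### Equality of laws through Lipschitz test functions -/

section Laws

open Filter Topology

/-- Bounded Lipschitz functions characterize weak convergence, so the constant sequence `μ`
converges to `ν`; weak limits are unique. -/
lemma measure_eq_of_forall_lipschitz {A : Type*} [MeasurableSpace A] [PseudoMetricSpace A]
    [BorelSpace A] {μ ν : Measure A} [IsProbabilityMeasure μ] [IsProbabilityMeasure ν]
    (h : ∀ Φ : A → ℝ, (∃ K : ℝ≥0, ∀ x, |Φ x| ≤ K) → (∃ L, LipschitzWith L Φ) →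
      ∫ x, Φ x ∂μ = ∫ x, Φ x ∂ν) : μ = ν := by
  let μ' : ProbabilityMeasure A := ⟨μ, inferInstance⟩
  let ν' : ProbabilityMeasure A := ⟨ν, inferInstance⟩
  have ht : Tendsto (fun _ : ℕ => μ') atTop (𝓝 ν') := by
    rw [tendsto_iff_forall_lipschitz_integral_tendsto]
    rintro f ⟨C, hC⟩ hL
    have hb : ∃ K : ℝ≥0, ∀ x, |f x| ≤ K := by
      rcases isEmpty_or_nonempty A with hA | ⟨⟨x0⟩⟩
      · exact ⟨0, fun x => isEmptyElim x⟩
      · refine ⟨(C + |f x0|).toNNReal, fun x => le_trans ?_ (Real.le_coe_toNNReal _)⟩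
        have := hC x x0
        rw [Real.dist_eq] at this
        calc |f x| = |(f x - f x0) + f x0| := by congr 1; ring
          _ ≤ _ := (abs_add_le _ _).trans (add_le_add this le_rfl)
    change Tendsto (fun _ : ℕ => ∫ x, f x ∂μ) atTop (𝓝 (∫ x, f x ∂ν))
    rw [h f hb hL]
    exact tendsto_const_nhds
  exact congrArg (fun m : ProbabilityMeasure A => (m : Measure A))
    (tendsto_nhds_unique tendsto_const_nhds ht)

lemma tendsto_integral_of_ae_tendsto {A Ω : Type*} [MeasurableSpace A] [PseudoMetricSpace A]
    [BorelSpace A] [MeasurableSpace Ω] {P : Measure Ω} [IsFiniteMeasure P] {X : ℕ → Ω → A}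
    {X' : Ω → A} (hX : ∀ n, Measurable (X n))
    (h : ∀ᵐ ω ∂P, Tendsto (fun n => X n ω) atTop (𝓝 (X' ω))) {Φ : A → ℝ} (hΦ : Continuous Φ)
    {K : ℝ≥0} (hK : ∀ x, |Φ x| ≤ K) :
    Tendsto (fun n => ∫ ω, Φ (X n ω) ∂P) atTop (𝓝 (∫ ω, Φ (X' ω) ∂P)) :=
  tendsto_integral_of_dominated_convergence (fun _ => (K : ℝ))
    (fun n => (hΦ.measurable.comp (hX n)).aestronglyMeasurable) (integrable_const _)
    (fun _ => .of_forall fun _ => hK _) (h.mono fun _ hω => (hΦ.tendsto _).comp hω)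

end Laws

/-! ### The velocity ODE reproduces the law of the displacement -/

section VelocityFlow

open Filter Topology

variable {d : ℕ} {γ : Measure (Pt d × Pt d)} {π₀ : Measure (Pt d)} [IsProbabilityMeasure γ]
  [IsProbabilityMeasure π₀] {a : AccField d} {t : ℝ}

lemma IsRegularAcc.isRegularField (hr : IsRegularAcc a) (ht : t ∈ Ico (0 : ℝ) 1) {T : ℝ}
    (hT : T < 1) : IsRegularField T (fun z u τ => a z t u τ) := by
  constructor
  · exact hr.continuousOn.comp (f := fun q : Pt d × Pt d × ℝ => (q.1, t, q.2.1, q.2.2))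
      (by fun_prop) fun q hq => ⟨mem_univ _, ht, mem_univ _, ⟨hq.2.2.1, hq.2.2.2.trans_lt hT⟩⟩
  · intro R
    obtain ⟨L, hL⟩ := hr.lipschitz R (max t T) ⟨ht.1.trans (le_max_left _ _), max_lt ht.2 hT⟩
    exact ⟨L, fun z hz r hr => hL z hz t ⟨ht.1, le_max_left _ _⟩ r
      ⟨hr.1, hr.2.trans (le_max_right _ _)⟩⟩

lemma hasDerivAt_lerp (p q : Pt d) (s : ℝ) : HasDerivAt (fun s => lerp s p q) (q - p) s := by
  have h : HasDerivAt (fun s : ℝ => (1 - s) • p + s • q) ((-1 : ℝ) • p + (1 : ℝ) • q) s :=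
    ((hasDerivAt_id s).const_sub 1).smul_const p |>.add ((hasDerivAt_id s).smul_const q)
  exact h.congr_deriv (by module)

lemma continuous_lerp (p q : Pt d) : Continuous fun s => lerp s p q :=
  continuous_iff_continuousAt.2 fun s => (hasDerivAt_lerp p q s).continuousAt

/-- The conditional training velocities form a mean flow of the acceleration field. -/
lemma IsTrained.isMeanFlow (ha : IsTrained γ π₀ a) (hr : IsRegularAcc a)
    (hacc : MemLp accel 2 (γ.prod π₀)) (ht : t ∈ Ico (0 : ℝ) 1) {T : ℝ} (hT : T < 1) :
    IsMeanFlow (γ.prod π₀) T (posn t) veln (fun _ => accel) (fun z u τ => a z t u τ) where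
  measurable_param := measurable_posn t
  measurable_pos := by unfold veln lerp Function.uncurry; fun_prop
  measurable_vel := continuous_accel.measurable.comp measurable_snd
  continuousOn := .of_forall fun q => (continuous_lerp _ _).continuousOn
  hasDerivAt := .of_forall fun q r _ => hasDerivAt_lerp _ _ _
  integrable := (hacc.integrable (by norm_num)).comp_snd (volume.restrict (Ioc 0 T))
  mean := by
    filter_upwards [ae_restrict_mem measurableSet_Ioc] with r hr' l hl hb
    exact ha.integral_eq hr hacc ht ⟨hr'.1.le, hr'.2.trans_lt hT⟩ l hl hb

lemma IsVelocityPath.hasDerivWithinAt_Ici {z : Pt d} {u : ℝ → Pt d} (h : IsVelocityPath a z t u)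
    {τ : ℝ} (hτ : τ ∈ Ico (0 : ℝ) 1) : HasDerivWithinAt u (a z t (u τ) τ) (Ici τ) τ :=
  (h.ode τ hτ).mono_of_mem_nhdsWithin (Icc_mem_nhdsGE_of_mem hτ)

/-- Euler approximations of the velocity flow at time `t`: they converge along every solution of
the velocity ODE, and their law converges to the conditional law of the training velocity. -/
lemma IsTrained.exists_euler_seq (ha : IsTrained γ π₀ a) (hr : IsRegularAcc a)
    (hacc : MemLp accel 2 (γ.prod π₀)) (ht : t ∈ Ico (0 : ℝ) 1) :
    ∃ e : ℕ → Pt d × Pt d → Pt d, (∀ n, Measurable (e n)) ∧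
      (∀ z u, IsVelocityPath a z t u → Tendsto (fun n => e n (z, u 0)) atTop (𝓝 (u 1))) ∧
      ∀ Φ : Pt d × Pt d → ℝ, (∃ K : ℝ≥0, ∀ x, |Φ x| ≤ K) → (∃ L, LipschitzWith L Φ) →
        Tendsto (fun n => ∫ q, Φ (posn t q, e n (posn t q, q.2)) ∂(γ.prod π₀)) atTop
          (𝓝 (∫ q, Φ (posn t q, q.1.2 - q.1.1) ∂(γ.prod π₀))) := by
  -- Final times increasing to `1`, all in `(0, 1)`: the field is regular only before `1`.
  let T : ℕ → ℝ := fun n => 1 - 1 / ((n : ℝ) + 2)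
  have hT0 : ∀ n, 0 < T n := fun n => by
    have : 1 / ((n : ℝ) + 2) < 1 := by
      rw [div_lt_one (by positivity)]
      linarith [n.cast_nonneg (α := ℝ)]
    simp only [T]; linarith
  have hT1 : ∀ n, T n < 1 := fun n => by
    have : 0 < 1 / ((n : ℝ) + 2) := by positivity
    simp only [T]; linarith
  have hTlim : Tendsto T atTop (𝓝 1) := by
    have h1 : Tendsto (fun n : ℕ => (n : ℝ) + 2) atTop atTop :=
      tendsto_atTop_add_const_right _ _ tendsto_natCast_atTop_atTop
    simpa [T] using (tendsto_const_nhds (x := (1 : ℝ))).sub (h1.const_div_atTop 1)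
  have hlim0 : Tendsto (fun n : ℕ => 1 / ((n : ℝ) + 1)) atTop (𝓝 0) :=
    tendsto_one_div_add_atTop_nhds_zero_nat
  have hreg := fun n => hr.isRegularField ht (hT1 n)
  -- A single scheme must serve both purposes, the duality estimate and the approximation of paths.
  -- The bounds on `Φ` and the radius grow with `n`, so any fixed test function, location and path
  -- is eventually covered.
  have hex : ∀ n : ℕ, ∃ R : ℝ, ∃ N : ℕ, (n : ℝ) + 1 ≤ R ∧
      (∀ Φ : Pt d × Pt d → ℝ, Measurable Φ → (∀ q, |Φ q| ≤ (n : ℝ≥0)) →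
        (∀ z, LipschitzWith n fun u => Φ (z, u)) →
        |∫ q, Φ (posn t q, veln (T n) q) ∂(γ.prod π₀)
          - ∫ q, Φ (posn t q, euler (trunc (T n) R fun z u τ => a z t u τ) (T n / N) 0 N (posn t q)
            (veln 0 q)) ∂(γ.prod π₀)| ≤ 1 / ((n : ℝ) + 1)) ∧
      ∀ z : Pt d, ‖z‖ ≤ R → ∀ u : ℝ → Pt d, ContinuousOn u (Icc 0 (T n)) →
        (∀ r ∈ Icc 0 (T n), ‖u r‖ ≤ R) →
        (∀ r ∈ Ico 0 (T n), HasDerivWithinAt u (a z t (u r) r) (Ici r) r) →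
        ‖euler (trunc (T n) R fun z u τ => a z t u τ) (T n / N) 0 N z (u 0) - u (T n)‖
          ≤ 1 / ((n : ℝ) + 1) := by
    intro n
    have hn : (0 : ℝ) < 1 / ((n : ℝ) + 1) := by positivity
    obtain ⟨R, hR1, hR2⟩ := (((ha.isMeanFlow hr hacc ht (hT1 n)).eventually_euler_near (hreg n)
      (hT0 n) n n hn).and (eventually_ge_atTop ((n : ℝ) + 1))).exists
    have hR0 : 0 < R := lt_of_lt_of_le (by positivity) hR2
    obtain ⟨N, hN1, hN2⟩ := (hR1.and ((hreg n).eventually_euler_near (hT0 n) hR0 hn)).exists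
    exact ⟨R, N, hR2, hN1, hN2⟩
  choose R N hRn hdual hpath using hex
  have hR0 : ∀ n, 0 < R n := fun n => lt_of_lt_of_le (by positivity) (hRn n)
  let e : ℕ → Pt d × Pt d → Pt d := fun n q =>
    euler (trunc (T n) (R n) fun z u τ => a z t u τ) (T n / N n) 0 (N n) q.1 q.2
  refine ⟨e, fun n => ?_, fun z u hu => ?_, fun Φ ⟨K, hK⟩ ⟨L, hL⟩ => ?_⟩
  · have hcont := (hreg n).continuous_trunc (hT0 n).le (hR0 n)
    exact measurable_euler (fun r => (hcont.comp
      (by fun_prop : Continuous fun q : Pt d × Pt d => (q.1, q.2, r))).measurable) 0 (N n)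
  · obtain ⟨B, hB⟩ := isCompact_Icc.exists_bound_of_continuousOn hu.continuousOn
    have h1 : Tendsto (fun n => u (T n)) atTop (𝓝 (u 1)) := by
      have hw : Tendsto T atTop (𝓝[Icc 0 1] 1) :=
        tendsto_nhdsWithin_iff.2 ⟨hTlim, .of_forall fun n => ⟨(hT0 n).le, (hT1 n).le⟩⟩
      exact (hu.continuousOn 1 (right_mem_Icc.2 zero_le_one)).tendsto.comp hw
    have h2 : Tendsto (fun n => e n (z, u 0) - u (T n)) atTop (𝓝 0) := by
      refine squeeze_zero_norm' ?_ hlim0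
      filter_upwards [eventually_ge_atTop ⌈B⌉₊, eventually_ge_atTop ⌈‖z‖⌉₊] with n hn1 hn2
      have hB' : B ≤ R n := (Nat.ceil_le.1 hn1).trans (by linarith [hRn n])
      have hz' : ‖z‖ ≤ R n := (Nat.ceil_le.1 hn2).trans (by linarith [hRn n])
      have hsub : Icc 0 (T n) ⊆ Icc 0 1 := Icc_subset_Icc_right (hT1 n).le
      exact hpath n z hz' u (hu.continuousOn.mono hsub) (fun r hr => (hB r (hsub hr)).trans hB')
        (fun r hr => hu.hasDerivWithinAt_Ici ⟨hr.1, hr.2.trans (hT1 n)⟩)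
    simpa using h2.add h1
  · have h1 : Tendsto (fun n => ∫ q, Φ (posn t q, veln (T n) q) ∂(γ.prod π₀)) atTop
        (𝓝 (∫ q, Φ (posn t q, q.1.2 - q.1.1) ∂(γ.prod π₀))) := by
      refine tendsto_integral_of_ae_tendsto
        (fun n => (measurable_posn t).prodMk (measurable_veln (T n)))
        (.of_forall fun q => ?_) hL.continuous hK
      have h2 : Tendsto (fun n => veln (T n) q) atTop (𝓝 (veln 1 q)) :=
        ((continuous_lerp q.2 (q.1.2 - q.1.1)).tendsto 1).comp hTlim
      have h3 : veln 1 q = q.1.2 - q.1.1 := by simp [veln, lerp]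
      rw [h3] at h2
      exact tendsto_const_nhds.prodMk_nhds h2
    have h2 : Tendsto (fun n => ∫ q, Φ (posn t q, e n (posn t q, q.2)) ∂(γ.prod π₀)
        - ∫ q, Φ (posn t q, veln (T n) q) ∂(γ.prod π₀)) atTop (𝓝 0) := by
      refine squeeze_zero_norm' ?_ hlim0
      filter_upwards [eventually_ge_atTop ⌈K⌉₊, eventually_ge_atTop ⌈L⌉₊] with n hn1 hn2
      have hKn : K ≤ n := Nat.ceil_le.1 hn1
      have hLn : L ≤ n := Nat.ceil_le.1 hn2
      have h3 := hdual n Φ hL.continuous.measurable (fun q => (hK q).trans (by exact_mod_cast hKn))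
        (fun z => by
          have : LipschitzWith 1 fun u : Pt d => (z, u) := LipschitzWith.prodMk_left z
          have h5 := (hL.weaken hLn).comp this
          rw [mul_one] at h5
          exact h5)
      have h4 : ∀ q : (Pt d × Pt d) × Pt d, veln 0 q = q.2 := fun q => by simp [veln, lerp]
      simp only [h4] at h3
      rw [norm_sub_rev]
      exact h3
    simpa using h2.add h1

/-- The flow of the velocity ODE at time `t`, up to the final time. -/
structure IsVelocityFlow (γ : Measure (Pt d × Pt d)) (π₀ : Measure (Pt d)) (a : AccField d)
    (t : ℝ) (F : Pt d × Pt d → Pt d) : Prop where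
  measurable : Measurable F
  eq : ∀ z u, IsVelocityPath a z t u → F (z, u 0) = u 1
  law : (∀ z, ∀ᵐ w ∂π₀, ∃ u, u 0 = w ∧ IsVelocityPath a z t u) →
    (γ.prod π₀).map (fun q => (posn t q, F (posn t q, q.2)))
      = (γ.prod π₀).map (fun q => (posn t q, q.1.2 - q.1.1))

lemma map_posn_prod : (γ.prod π₀).map (fun q => (posn t q, q.2)) = (interpLaw γ t).prod π₀ := by
  have h : Measurable fun p : Pt d × Pt d => lerp t p.1 p.2 := by unfold lerp; fun_prop
  conv_rhs => rw [interpLaw, ← Measure.map_id (μ := π₀), Measure.map_prod_map _ _ h measurable_id]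
  rfl

lemma map_posn_diff : (γ.prod π₀).map (fun q => (posn t q, q.1.2 - q.1.1))
    = γ.map fun p => (lerp t p.1 p.2, p.2 - p.1) := by
  have h : Measurable fun p : Pt d × Pt d => (lerp t p.1 p.2, p.2 - p.1) := by
    unfold lerp; fun_prop
  have h1 : (γ.prod π₀).map Prod.fst = γ := by simp
  conv_rhs => rw [← h1, Measure.map_map h measurable_fst]
  rfl

lemma measurable_posn_diff :
    Measurable fun q : (Pt d × Pt d) × Pt d => (posn t q, q.1.2 - q.1.1) :=
  (measurable_posn t).prodMk (by fun_prop)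

/-- The pointwise limit of the Euler maps is measurable and returns the endpoint of every solution,
although the solutions themselves come with no measurable dependence on `(z, w)`. Where the limit
fails to exist its default value is harmless. -/
lemma IsTrained.exists_velocityFlow (ha : IsTrained γ π₀ a) (hr : IsRegularAcc a)
    (hacc : MemLp accel 2 (γ.prod π₀)) (ht : t ∈ Ico (0 : ℝ) 1) :
    ∃ F, IsVelocityFlow γ π₀ a t F := by
  obtain ⟨e, hem, hep, hel⟩ := ha.exists_euler_seq hr hacc ht
  have hFm : Measurable fun q => limUnder atTop (fun n => e n q) :=
    (StronglyMeasurable.limUnder fun n => (hem n).stronglyMeasurable).measurable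
  refine ⟨fun q => limUnder atTop (fun n => e n q), hFm, fun z u hu => (hep z u hu).limUnder_eq,
    fun hex => ?_⟩
  have hpos2 : Measurable fun q : (Pt d × Pt d) × Pt d => (posn t q, q.2) :=
    (measurable_posn t).prodMk measurable_snd
  have hconv : ∀ᵐ q ∂(γ.prod π₀), Tendsto (fun n => e n (posn t q, q.2)) atTop
      (𝓝 (limUnder atTop fun n => e n (posn t q, q.2))) := by
    have hms : MeasurableSet {x | ∃ c, Tendsto (fun n => e n x) atTop (𝓝 c)} :=
      measurableSet_exists_tendsto hem
    -- Existence of paths is known for each `z` and almost every `w`. Fubini needs a measurable set,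
    -- so it is applied to the set where the Euler maps converge, not to the set where a path
    -- exists.
    have h1 : ∀ᵐ x ∂((interpLaw γ t).prod π₀), ∃ c, Tendsto (fun n => e n x) atTop (𝓝 c) := by
      rw [Measure.ae_prod_iff_ae_ae hms]
      refine .of_forall fun z => (hex z).mono ?_
      rintro w ⟨u, rfl, hu⟩
      exact ⟨u 1, hep z u hu⟩
    rw [← map_posn_prod] at h1
    exact (ae_of_ae_map hpos2.aemeasurable h1).mono fun q hq => tendsto_nhds_limUnder hq
  have hmF : Measurable fun q : (Pt d × Pt d) × Pt d =>
      (posn t q, limUnder atTop fun n => e n (posn t q, q.2)) :=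
    (measurable_posn t).prodMk (hFm.comp hpos2)
  have i1 := Measure.isProbabilityMeasure_map (μ := γ.prod π₀) hmF.aemeasurable
  have i2 := Measure.isProbabilityMeasure_map (μ := γ.prod π₀)
    (measurable_posn_diff (t := t) (d := d)).aemeasurable
  refine measure_eq_of_forall_lipschitz fun Φ ⟨K, hK⟩ ⟨L, hL⟩ => ?_
  rw [integral_map hmF.aemeasurable hL.continuous.aestronglyMeasurable,
    integral_map measurable_posn_diff.aemeasurable hL.continuous.aestronglyMeasurable]
  refine tendsto_nhds_unique ?_ (hel Φ ⟨K, hK⟩ ⟨L, hL⟩)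
  exact tendsto_integral_of_ae_tendsto
    (fun n => (measurable_posn t).prodMk ((hem n).comp hpos2))
    (hconv.mono fun q hq => tendsto_const_nhds.prodMk_nhds hq) hL.continuous hK

variable {Ω : Type*} [MeasurableSpace Ω] {P : Measure Ω} [IsProbabilityMeasure P] {Y : Ω → Pt d}
  {V : ℝ → Ω → Pt d}

lemma IsVelocitySample.measurable_zero (hV : IsVelocitySample P π₀ a Y t V) : Measurable (V 0) :=
  hV.measurable 0 (left_mem_Icc.2 zero_le_one)

lemma IsVelocitySample.map_prod (hV : IsVelocitySample P π₀ a Y t V) (hY : Measurable Y) :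
    P.map (fun ω => (Y ω, V 0 ω)) = (P.map Y).prod π₀ := by
  have := (indepFun_iff_map_prod_eq_prod_map_map hY.aemeasurable
    hV.measurable_zero.aemeasurable).1 hV.indep
  rw [this, hV.law_zero]

/-- A velocity generated at a location with the law of `X_t` has, jointly with the location, the
law of the training velocity. -/
theorem IsTrained.map_velocitySample (ha : IsTrained γ π₀ a) (hr : IsRegularAcc a)
    (hacc : MemLp accel 2 (γ.prod π₀)) (ht : t ∈ Ico (0 : ℝ) 1) (hY : Measurable Y)
    (hlaw : P.map Y = interpLaw γ t) (hV : IsVelocitySample P π₀ a Y t V) :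
    P.map (fun ω => (Y ω, V 1 ω)) = γ.map fun p => (lerp t p.1 p.2, p.2 - p.1) := by
  obtain ⟨e, hem, hep, hel⟩ := ha.exists_euler_seq hr hacc ht
  have hV1 : Measurable (V 1) := hV.measurable 1 (right_mem_Icc.2 zero_le_one)
  have hYV0 : Measurable fun ω => (Y ω, V 0 ω) := hY.prodMk hV.measurable_zero
  have hYV1 : Measurable fun ω => (Y ω, V 1 ω) := hY.prodMk hV1
  have hpos2 : Measurable fun q : (Pt d × Pt d) × Pt d => (posn t q, q.2) :=
    (measurable_posn t).prodMk measurable_snd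
  rw [← map_posn_diff (π₀ := π₀)]
  have i1 := Measure.isProbabilityMeasure_map (μ := P) hYV1.aemeasurable
  have i2 := Measure.isProbabilityMeasure_map (μ := γ.prod π₀)
    (measurable_posn_diff (t := t) (d := d)).aemeasurable
  refine measure_eq_of_forall_lipschitz fun Φ ⟨K, hK⟩ ⟨L, hL⟩ => ?_
  rw [integral_map hYV1.aemeasurable hL.continuous.aestronglyMeasurable,
    integral_map measurable_posn_diff.aemeasurable hL.continuous.aestronglyMeasurable]
  refine tendsto_nhds_unique ?_ (hel Φ ⟨K, hK⟩ ⟨L, hL⟩)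
  have h1 : Tendsto (fun n => ∫ ω, Φ (Y ω, e n (Y ω, V 0 ω)) ∂P) atTop
      (𝓝 (∫ ω, Φ (Y ω, V 1 ω) ∂P)) :=
    tendsto_integral_of_ae_tendsto (fun n => hY.prodMk ((hem n).comp hYV0))
      (hV.path.mono fun ω hω => tendsto_const_nhds.prodMk_nhds (hep _ _ hω)) hL.continuous hK
  -- For each `n` the two integrals agree: `(Y, V 0)` and `(X_t, v₀)` both have the product law of
  -- `interpLaw γ t` and `π₀`. This is where independence of the source velocity enters.
  refine h1.congr fun n => ?_
  have hm : Measurable fun x : Pt d × Pt d => Φ (x.1, e n x) :=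
    hL.continuous.measurable.comp (measurable_fst.prodMk (hem n))
  rw [← integral_map (f := fun x : Pt d × Pt d => Φ (x.1, e n x)) hYV0.aemeasurable
    hm.aestronglyMeasurable, ← integral_map (f := fun x : Pt d × Pt d => Φ (x.1, e n x))
    hpos2.aemeasurable hm.aestronglyMeasurable, hV.map_prod hY, map_posn_prod, hlaw]

/-- The mean velocity is the conditional mean of the velocity flow. -/
lemma IsVelocityFlow.integral_eq {F : Pt d × Pt d → Pt d} (hF : IsVelocityFlow γ π₀ a t F)
    {b : Pt d → ℝ → Pt d} (hb : IsMeanVelocity π₀ a b) (ht : t ∈ Ico (0 : ℝ) 1)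
    (hY : Measurable Y) {V₀ : Ω → Pt d} (hV₀ : Measurable V₀)
    (hlaw : P.map (fun ω => (Y ω, V₀ ω)) = (P.map Y).prod π₀)
    (hint : Integrable (fun ω => F (Y ω, V₀ ω)) P) (l : Pt d → Pt d →L[ℝ] ℝ) (hl : Measurable l)
    (hlb : ∃ K, ∀ z, ‖l z‖ ≤ K) :
    ∫ ω, l (Y ω) (F (Y ω, V₀ ω)) ∂P = ∫ ω, l (Y ω) (b (Y ω) t) ∂P := by
  obtain ⟨K, hK⟩ := hlb
  have hP := Measure.isProbabilityMeasure_map (μ := P) hY.aemeasurable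
  have hbF : ∀ z, Integrable (fun w => F (z, w)) π₀ ∧ ∫ w, F (z, w) ∂π₀ = b z t := by
    intro z
    obtain ⟨u, hu1, hu2, hu3⟩ := hb z t ht
    -- `F` gives the endpoint of whichever solution is chosen, so the selection `u` in the
    -- hypothesis does not matter, and `b` becomes a measurable integral of `F`.
    have hae : (fun w => u w 1) =ᵐ[π₀] fun w => F (z, w) := by
      filter_upwards [hu1] with w hw
      have := hF.eq z (u w) hw.2
      rw [hw.1] at this
      exact this.symm
    exact ⟨hu2.congr hae, (integral_congr_ae hae).symm.trans hu3⟩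
  have hbm : Measurable fun z => b z t := by
    simp only [← fun z => (hbF z).2]
    exact (hF.measurable.stronglyMeasurable.integral_prod_right' (ν := π₀)).measurable
  have hm : Measurable fun x : Pt d × Pt d => l x.1 (F x) :=
    (hl.comp measurable_fst).clm_apply_vec hF.measurable
  have hFi : Integrable F ((P.map Y).prod π₀) := by
    rw [← hlaw, integrable_map_measure hF.measurable.aestronglyMeasurable
      (hY.prodMk hV₀).aemeasurable]
    exact hint
  have hi : Integrable (fun x : Pt d × Pt d => l x.1 (F x)) ((P.map Y).prod π₀) :=
    (hFi.norm.const_mul K).mono' hm.aestronglyMeasurable (.of_forall fun q =>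
      ((l _).le_opNorm _).trans (mul_le_mul_of_nonneg_right (hK _) (norm_nonneg _)))
  calc ∫ ω, l (Y ω) (F (Y ω, V₀ ω)) ∂P
      = ∫ x, l x.1 (F x) ∂((P.map Y).prod π₀) := by
        rw [← hlaw, integral_map (hY.prodMk hV₀).aemeasurable hm.aestronglyMeasurable]
    _ = ∫ z, ∫ w, l z (F (z, w)) ∂π₀ ∂(P.map Y) := integral_prod _ hi
    _ = ∫ z, l z (b z t) ∂(P.map Y) := by
        congr 1; ext z
        rw [(l z).integral_comp_comm (hbF z).1, (hbF z).2]
    _ = _ := by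
        rw [integral_map hY.aemeasurable (hl.clm_apply_vec hbm).aestronglyMeasurable]

end VelocityFlow

/-! ### The coupled ODEs: two mean flows of the mean velocity -/

section Coupled

open Filter Topology

variable {d : ℕ} {γ : Measure (Pt d × Pt d)} {π₀ : Measure (Pt d)} [IsProbabilityMeasure γ]
  [IsProbabilityMeasure π₀] {a : AccField d} {b : Pt d → ℝ → Pt d} {t T : ℝ}

lemma IsRegularVel.isRegularField (hb : IsRegularVel b) (hT : T < 1) :
    IsRegularField T (fun (_ : Pt d) u r => b u r) := by
  constructor
  · exact hb.continuousOn.comp (f := fun q : Pt d × Pt d × ℝ => (q.2.1, q.2.2))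
      (by fun_prop) fun q hq => ⟨mem_univ _, ⟨hq.2.2.1, hq.2.2.2.trans_lt hT⟩⟩
  · intro R
    obtain ⟨L, hL⟩ := hb.lipschitz R (max 0 T) ⟨le_max_left _ _, max_lt one_pos hT⟩
    exact ⟨L, fun z hz r hr => hL r ⟨hr.1, hr.2.trans (le_max_right _ _)⟩⟩

lemma IsMeanVelocity.exists_path (hb : IsMeanVelocity π₀ a b) (ht : t ∈ Ico (0 : ℝ) 1) (z : Pt d) :
    ∀ᵐ w ∂π₀, ∃ u, u 0 = w ∧ IsVelocityPath a z t u := by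
  obtain ⟨u, hu, -⟩ := hb z t ht
  exact hu.mono fun w hw => ⟨u w, hw⟩

lemma map_posn : (γ.prod π₀).map (posn t) = interpLaw γ t := by
  have h := congrArg (Measure.map Prod.fst) (map_posn_prod (γ := γ) (π₀ := π₀) (t := t))
  rw [Measure.map_map measurable_fst ((measurable_posn t).prodMk measurable_snd)] at h
  simpa [Function.comp_def] using h

lemma integrable_displacement (hacc : MemLp accel 2 (γ.prod π₀))
    (hπ : Integrable (fun v : Pt d => ‖v‖ ^ 2) π₀) :
    Integrable (fun q : (Pt d × Pt d) × Pt d => q.1.2 - q.1.1) (γ.prod π₀) := by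
  have h1 : MemLp (fun v : Pt d => v) 2 π₀ :=
    (memLp_two_iff_integrable_sq_norm aestronglyMeasurable_id).2 hπ
  have h2 := (h1.integrable (by norm_num)).comp_snd γ
  refine ((hacc.integrable (by norm_num)).add h2).congr (.of_forall fun q => ?_)
  simp [accel]

/-- The mean velocity is the conditional mean of the displacement given the position. -/
lemma IsTrained.isMeanFlow_posn (ha : IsTrained γ π₀ a) (hr : IsRegularAcc a)
    (hacc : MemLp accel 2 (γ.prod π₀)) (hπ : Integrable (fun v : Pt d => ‖v‖ ^ 2) π₀)
    (hb : IsMeanVelocity π₀ a b) (hT : T < 1) :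
    IsMeanFlow (γ.prod π₀) T (fun _ => (0 : Pt d)) posn (fun _ q => q.1.2 - q.1.1)
      (fun _ u r => b u r) where
  measurable_param := measurable_const
  measurable_pos := by unfold posn lerp Function.uncurry; fun_prop
  measurable_vel := by unfold Function.uncurry; fun_prop
  continuousOn := .of_forall fun q => (continuous_lerp _ _).continuousOn
  hasDerivAt := .of_forall fun q r _ => hasDerivAt_lerp _ _ _
  integrable := (integrable_displacement hacc hπ).comp_snd (volume.restrict (Ioc 0 T))
  mean := by
    filter_upwards [ae_restrict_mem measurableSet_Ioc] with r hr' l hl ⟨K, hK⟩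
    have ht : r ∈ Ico (0 : ℝ) 1 := ⟨hr'.1.le, hr'.2.trans_lt hT⟩
    obtain ⟨F, hF⟩ := ha.exists_velocityFlow hr hacc ht
    have hlaw := hF.law (hb.exists_path ht)
    have hpos2 : Measurable fun q : (Pt d × Pt d) × Pt d => (posn r q, q.2) :=
      (measurable_posn r).prodMk measurable_snd
    have hposF : Measurable fun q : (Pt d × Pt d) × Pt d => (posn r q, F (posn r q, q.2)) :=
      (measurable_posn r).prodMk (hF.measurable.comp hpos2)
    have hl' : Measurable fun z => l (0, z) := hl.comp (measurable_const.prodMk measurable_id)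
    have hm : Measurable fun x : Pt d × Pt d => l (0, x.1) x.2 :=
      (hl'.comp measurable_fst).clm_apply_vec measurable_snd
    have hint : Integrable (fun q => F (posn r q, q.2)) (γ.prod π₀) := by
      have h1 : Integrable (fun x : Pt d × Pt d => x.2)
          ((γ.prod π₀).map fun q => (posn r q, q.1.2 - q.1.1)) :=
        (integrable_map_measure measurable_snd.aestronglyMeasurable
          measurable_posn_diff.aemeasurable).2 (integrable_displacement hacc hπ)
      rw [← hlaw] at h1
      exact (integrable_map_measure measurable_snd.aestronglyMeasurable hposF.aemeasurable).1 h1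
    -- The displacement may be replaced by `F (X_r, v₀)`, which has the same joint law with `X_r`.
    -- As `v₀` is independent of `X_r`, integrating it out yields `b`.
    have h2 := hF.integral_eq hb ht (measurable_posn r) measurable_snd
      (by rw [map_posn_prod, map_posn]) hint (fun z => l (0, z)) hl' ⟨K, fun z => hK _⟩
    rw [← h2]
    have h3 := integral_map (μ := γ.prod π₀) hposF.aemeasurable hm.aestronglyMeasurable
    rw [hlaw, integral_map measurable_posn_diff.aemeasurable hm.aestronglyMeasurable] at h3
    exact h3

variable {Ω : Type*} [MeasurableSpace Ω] {P : Measure Ω} [IsProbabilityMeasure P]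
  {ρ₀ : Measure (Pt d)} {Z : ℝ → Ω → Pt d} {U : ℝ → ℝ → Ω → Pt d}

/-- A generated process has a modification that is jointly measurable, as is its velocity. -/
lemma IsGenerated.exists_modification (h : IsGenerated P ρ₀ π₀ a Z U) :
    ∃ Z' C : ℝ → Ω → Pt d, Measurable (Function.uncurry Z') ∧ Measurable (Function.uncurry C) ∧
      (∀ ω, Continuous fun t => Z' t ω) ∧ ∀ᵐ ω ∂P, (∀ t ∈ Icc (0 : ℝ) 1, Z' t ω = Z t ω) ∧
        ∀ t ∈ Ico (0 : ℝ) 1, C t ω = U t 1 ω ∧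
          (0 < t → HasDerivAt (fun t => Z' t ω) (C t ω) t) := by
  classical
  -- The good paths contain a measurable set of full measure; setting the process to zero off `G`
  -- and clamping time makes all paths continuous, hence the process jointly measurable.
  obtain ⟨G, hGm, hG, hGae⟩ : ∃ G : Set Ω, MeasurableSet G ∧
      (∀ ω ∈ G, ContinuousOn (fun t => Z t ω) (Icc 0 1) ∧ ∀ t ∈ Ico (0 : ℝ) 1,
        HasDerivWithinAt (fun t => Z t ω) (U t 1 ω) (Icc 0 1) t) ∧ ∀ᵐ ω ∂P, ω ∈ G := by
    obtain ⟨G, hG, hGm, hGp⟩ := (h.continuousOn.and h.position).exists_measurable_mem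
    exact ⟨G, hGm, hGp, hG⟩
  let Z' : ℝ → Ω → Pt d := fun t => G.indicator (Z (max 0 (min t 1)))
  have hclamp : ∀ t : ℝ, max 0 (min t 1) ∈ Icc (0 : ℝ) 1 := fun t =>
    ⟨le_max_left _ _, max_le zero_le_one (min_le_right _ _)⟩
  have hclampeq : ∀ t ∈ Icc (0 : ℝ) 1, max 0 (min t 1) = t := fun t ht => by
    rw [min_eq_left ht.2, max_eq_right ht.1]
  have hZ'c : ∀ ω, Continuous fun t => Z' t ω := by
    intro ω
    by_cases hω : ω ∈ G
    · simp only [Z', indicator_of_mem hω]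
      exact (hG ω hω).1.comp_continuous (by fun_prop) hclamp
    · simp only [Z', indicator_of_notMem hω]
      exact continuous_const
  have hZ'm : Measurable (Function.uncurry Z') :=
    measurable_uncurry_of_continuous_of_measurable hZ'c fun t => (h.measurable _ (hclamp t)).indicator hGm
  have hZ'eq : ∀ ω ∈ G, ∀ t ∈ Icc (0 : ℝ) 1, Z' t ω = Z t ω := fun ω hω t ht => by
    simp only [Z', indicator_of_mem hω, hclampeq t ht]
  have hder : ∀ ω ∈ G, ∀ t ∈ Ico (0 : ℝ) 1,
      HasDerivWithinAt (fun t => Z' t ω) (U t 1 ω) (Icc 0 1) t := fun ω hω t ht =>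
    ((hG ω hω).2 t ht).congr (hZ'eq ω hω) (hZ'eq ω hω t ⟨ht.1, ht.2.le⟩)
  -- The velocities `U t 1` are not assumed jointly measurable in `(t, ω)`. They are recovered as
  -- limits of forward difference quotients, which also exist at `t = 0`.
  let δ : ℕ → ℝ := fun n => 1 / ((n : ℝ) + 1)
  have hδ0 : ∀ n, 0 < δ n := fun n => by positivity
  let g : ℕ → ℝ × Ω → Pt d := fun n q => (δ n)⁻¹ • (Z' (q.1 + δ n) q.2 - Z' q.1 q.2)
  have hgm : ∀ n, Measurable (g n) := fun n =>
    Measurable.const_smul (g := fun q : ℝ × Ω => Z' (q.1 + δ n) q.2 - Z' q.1 q.2)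
      ((hZ'm.comp ((measurable_fst.add_const (δ n)).prodMk measurable_snd)).sub hZ'm) (δ n)⁻¹
  have hlim : ∀ ω ∈ G, ∀ t ∈ Ico (0 : ℝ) 1,
      limUnder atTop (fun n => g n (t, ω)) = U t 1 ω := by
    intro ω hω t ht
    have h1 := ((hder ω hω t ht).mono_of_mem_nhdsWithin (Icc_mem_nhdsGE_of_mem ht)).Ioi_of_Ici
    rw [hasDerivWithinAt_iff_tendsto_slope' self_notMem_Ioi] at h1
    have h2 : Tendsto (fun n => t + δ n) atTop (𝓝[>] t) := by
      refine tendsto_nhdsWithin_iff.2 ⟨?_, .of_forall fun n => by simpa using hδ0 n⟩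
      simpa [δ] using tendsto_one_div_add_atTop_nhds_zero_nat.const_add t
    refine ((h1.comp h2).congr fun n => ?_).limUnder_eq
    simp [slope, g]
  have hCm : Measurable fun q => limUnder atTop fun n => g n q :=
    (StronglyMeasurable.limUnder fun n => (hgm n).stronglyMeasurable).measurable
  refine ⟨Z', fun t ω => limUnder atTop fun n => g n (t, ω), hZ'm, hCm, hZ'c, ?_⟩
  filter_upwards [hGae] with ω hω
  refine ⟨hZ'eq ω hω, fun t ht => ⟨hlim ω hω t ht, fun ht0 => ?_⟩⟩
  rw [hlim ω hω t ht]
  exact (hder ω hω t ht).hasDerivAt (Icc_mem_nhds ht0 ht.2)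

/-- At each time the generated velocity is `F` of the location and an independent source velocity,
so its conditional mean is `b`. Only one time is involved, so the joint law of the sources at
different times plays no role. -/
lemma IsTrained.isMeanFlow_generated (ha : IsTrained γ π₀ a) (hr : IsRegularAcc a)
    (hacc : MemLp accel 2 (γ.prod π₀)) (hb : IsMeanVelocity π₀ a b)
    (h : IsGenerated P ρ₀ π₀ a Z U) :
    ∃ Z' C : ℝ → Ω → Pt d, (∀ ω, Continuous fun t => Z' t ω) ∧
      (∀ t ∈ Icc (0 : ℝ) 1, Z' t =ᵐ[P] Z t) ∧
      ∀ T < 1, IsMeanFlow P T (fun _ => (0 : Pt d)) Z' C (fun _ u r => b u r) := by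
  obtain ⟨Z', C, hZm, hCm, hZc, hae⟩ := h.exists_modification
  have hZ'ae : ∀ t ∈ Icc (0 : ℝ) 1, Z' t =ᵐ[P] Z t := fun t ht => hae.mono fun ω hω => hω.1 t ht
  refine ⟨Z', C, hZc, hZ'ae, fun T hT => ?_⟩
  have hIoc : ∀ r ∈ Ioc 0 T, r ∈ Ico (0 : ℝ) 1 := fun r hr => ⟨hr.1.le, hr.2.trans_lt hT⟩
  have hint : Integrable (Function.uncurry C) ((volume.restrict (Ioc 0 T)).prod P) := by
    refine ⟨hCm.aestronglyMeasurable, ?_⟩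
    rw [HasFiniteIntegral, lintegral_prod _ hCm.enorm.aemeasurable]
    have h1 : ∀ r ∈ Ioc 0 T,
        ∫⁻ ω, ‖Function.uncurry C (r, ω)‖ₑ ∂P = ∫⁻ ω, ‖U r 1 ω‖ₑ ∂P := fun r hr =>
      lintegral_congr_ae (hae.mono fun ω hω => by
        simp only [Function.uncurry_apply_pair, (hω.2 r (hIoc r hr)).1])
    rw [setLIntegral_congr_fun measurableSet_Ioc h1]
    have h2 : Ioc 0 T ⊆ Icc (0 : ℝ) 1 := fun r hr => ⟨hr.1.le, (hIoc r hr).2.le⟩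
    exact (lintegral_mono_set h2).trans_lt h.integrable
  refine ⟨measurable_const, hZm, hCm, .of_forall fun ω => (hZc ω).continuousOn,
    hae.mono fun ω hω r hr => (hω.2 r ⟨hr.1.le, hr.2.trans hT⟩).2 hr.1, hint, ?_⟩
  filter_upwards [ae_restrict_mem measurableSet_Ioc, hint.prod_right_ae] with r hrT hri l hl ⟨K, hK⟩
  have ht := hIoc r hrT
  have htI : r ∈ Icc (0 : ℝ) 1 := ⟨ht.1, ht.2.le⟩
  obtain ⟨F, hF⟩ := ha.exists_velocityFlow hr hacc ht
  have hV := h.velocity r ht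
  have hFC : ∀ᵐ ω ∂P, F (Z r ω, U r 0 ω) = C r ω := by
    filter_upwards [hae, hV.path] with ω h1 h2
    rw [(h1.2 r ht).1]
    exact hF.eq _ _ h2
  have hl' : Measurable fun z => l (0, z) := hl.comp (measurable_const.prodMk measurable_id)
  have h2 := hF.integral_eq hb ht (h.measurable r htI) hV.measurable_zero
    (hV.map_prod (h.measurable r htI))
    (hri.congr (hFC.mono fun ω hω => hω.symm)) (fun z => l (0, z)) hl' ⟨K, fun z => hK _⟩
  calc ∫ ω, l (0, Z' r ω) (C r ω) ∂P = ∫ ω, l (0, Z r ω) (F (Z r ω, U r 0 ω)) ∂P := by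
        refine integral_congr_ae ?_
        filter_upwards [hFC, hZ'ae r htI] with ω h3 h4
        rw [h3, h4]
    _ = _ := h2
    _ = _ := by
        refine integral_congr_ae ?_
        filter_upwards [hZ'ae r htI] with ω h4
        rw [h4]

/-- Two mean flows of a regular field with the same initial law have the same laws. -/
lemma IsMeanFlow.map_eq {Ω₁ Ω₂ : Type*} [MeasurableSpace Ω₁] [MeasurableSpace Ω₂]
    {P₁ : Measure Ω₁} {P₂ : Measure Ω₂} [IsProbabilityMeasure P₁] [IsProbabilityMeasure P₂]
    {Y₁ C₁ : ℝ → Ω₁ → Pt d} {Y₂ C₂ : ℝ → Ω₂ → Pt d} {v : Pt d → Pt d → ℝ → Pt d}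
    (h₁ : IsMeanFlow P₁ T (fun _ => (0 : Pt d)) Y₁ C₁ v)
    (h₂ : IsMeanFlow P₂ T (fun _ => (0 : Pt d)) Y₂ C₂ v) (hv : IsRegularField T v) (hT : 0 < T)
    (h0 : P₁.map (Y₁ 0) = P₂.map (Y₂ 0)) : P₁.map (Y₁ T) = P₂.map (Y₂ T) := by
  have hm₁ : ∀ r, Measurable (Y₁ r) := fun r => h₁.measurable_pos.comp measurable_prodMk_left
  have hm₂ : ∀ r, Measurable (Y₂ r) := fun r => h₂.measurable_pos.comp measurable_prodMk_left
  have i1 := Measure.isProbabilityMeasure_map (μ := P₁) (hm₁ T).aemeasurable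
  have i2 := Measure.isProbabilityMeasure_map (μ := P₂) (hm₂ T).aemeasurable
  refine measure_eq_of_forall_lipschitz fun Φ ⟨K, hK⟩ ⟨L, hL⟩ => ?_
  rw [integral_map (hm₁ T).aemeasurable hL.continuous.aestronglyMeasurable,
    integral_map (hm₂ T).aemeasurable hL.continuous.aestronglyMeasurable]
  refine eq_of_forall_dist_le fun ε hε => ?_
  -- The same `R` and `N` are taken for both processes: each final expectation is then close to the
  -- expectation of one and the same function of the initial position.
  obtain ⟨R, ⟨hR1, hR2⟩, hR0⟩ := (((h₁.eventually_euler_near hv hT K L (half_pos hε)).and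
    (h₂.eventually_euler_near hv hT K L (half_pos hε))).and (eventually_gt_atTop (0 : ℝ))).exists
  obtain ⟨N, hN1, hN2⟩ := (hR1.and hR2).exists
  have hΦm : Measurable fun q : Pt d × Pt d => Φ q.2 := hL.continuous.measurable.comp measurable_snd
  have e1 := hN1 (fun q => Φ q.2) hΦm (fun q => hK _) (fun _ => hL)
  have e2 := hN2 (fun q => Φ q.2) hΦm (fun q => hK _) (fun _ => hL)
  have hcont := hv.continuous_trunc hT.le hR0
  have hem : Measurable fun u : Pt d => Φ (euler (trunc T R v) (T / N) 0 N (0 : Pt d) u) :=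
    hL.continuous.measurable.comp ((measurable_euler (fun r => (hcont.comp
      (by fun_prop : Continuous fun q : Pt d × Pt d => (q.1, q.2, r))).measurable) 0 N).comp
      (measurable_const.prodMk measurable_id))
  have e3 : ∫ ω, Φ (euler (trunc T R v) (T / N) 0 N (0 : Pt d) (Y₁ 0 ω)) ∂P₁
      = ∫ ω, Φ (euler (trunc T R v) (T / N) 0 N (0 : Pt d) (Y₂ 0 ω)) ∂P₂ := by
    rw [← integral_map (hm₁ 0).aemeasurable hem.aestronglyMeasurable, h0,
      integral_map (hm₂ 0).aemeasurable hem.aestronglyMeasurable]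
  simp only at e1 e2
  rw [e3] at e1
  rw [Real.dist_eq]
  have e4 := abs_sub_comm (∫ ω, Φ (Y₂ T ω) ∂P₂)
    (∫ ω, Φ (euler (trunc T R v) (T / N) 0 N (0 : Pt d) (Y₂ 0 ω)) ∂P₂)
  have e5 := abs_sub_le (∫ ω, Φ (Y₁ T ω) ∂P₁)
    (∫ ω, Φ (euler (trunc T R v) (T / N) 0 N (0 : Pt d) (Y₂ 0 ω)) ∂P₂) (∫ ω, Φ (Y₂ T ω) ∂P₂)
  linarith

lemma interpLaw_zero {ρ₁ : Measure (Pt d)} (hc : IsCoupling ρ₀ ρ₁ γ) : interpLaw γ 0 = ρ₀ := by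
  simpa [interpLaw, lerp] using hc.fst_eq

lemma map_eq_of_tendsto {Ω₁ Ω₂ : Type*} [MeasurableSpace Ω₁] [MeasurableSpace Ω₂]
    {P₁ : Measure Ω₁} {P₂ : Measure Ω₂} [IsProbabilityMeasure P₁] [IsProbabilityMeasure P₂]
    {X : ℕ → Ω₁ → Pt d} {Y : ℕ → Ω₂ → Pt d} {X' : Ω₁ → Pt d} {Y' : Ω₂ → Pt d}
    (hX : ∀ n, Measurable (X n)) (hY : ∀ n, Measurable (Y n)) (hX' : Measurable X')
    (hY' : Measurable Y') (h : ∀ n, P₁.map (X n) = P₂.map (Y n))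
    (h₁ : ∀ᵐ ω ∂P₁, Tendsto (fun n => X n ω) atTop (𝓝 (X' ω)))
    (h₂ : ∀ᵐ ω ∂P₂, Tendsto (fun n => Y n ω) atTop (𝓝 (Y' ω))) : P₁.map X' = P₂.map Y' := by
  have i1 := Measure.isProbabilityMeasure_map (μ := P₁) hX'.aemeasurable
  have i2 := Measure.isProbabilityMeasure_map (μ := P₂) hY'.aemeasurable
  refine measure_eq_of_forall_lipschitz fun Φ ⟨K, hK⟩ ⟨L, hL⟩ => ?_
  have hs := hL.continuous.measurable.stronglyMeasurable
  rw [integral_map hX'.aemeasurable hs.aestronglyMeasurable,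
    integral_map hY'.aemeasurable hs.aestronglyMeasurable]
  refine tendsto_nhds_unique (tendsto_integral_of_ae_tendsto hX h₁ hL.continuous hK) ?_
  refine (tendsto_integral_of_ae_tendsto hY h₂ hL.continuous hK).congr fun n => ?_
  rw [← integral_map (hX n).aemeasurable hs.aestronglyMeasurable, h n,
    integral_map (hY n).aemeasurable hs.aestronglyMeasurable]

/-- The coupled ODEs preserve the marginals. -/
theorem IsGenerated.map_eq {ρ₁ : Measure (Pt d)} (h : IsGenerated P ρ₀ π₀ a Z U)
    (hc : IsCoupling ρ₀ ρ₁ γ) (ha : IsTrained γ π₀ a) (hr : IsRegularAcc a)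
    (hacc : MemLp accel 2 (γ.prod π₀)) (hπ : Integrable (fun v : Pt d => ‖v‖ ^ 2) π₀)
    (hb : IsMeanVelocity π₀ a b) (hbr : IsRegularVel b) (ht : t ∈ Icc (0 : ℝ) 1) :
    P.map (Z t) = interpLaw γ t := by
  have h0 : P.map (Z 0) = interpLaw γ 0 := by rw [h.law_zero, interpLaw_zero hc]
  obtain ⟨Z', C, hZc, hZae, hZf⟩ := ha.isMeanFlow_generated hr hacc hb h
  have hlt : ∀ T ∈ Ioo (0 : ℝ) 1, P.map (Z T) = (γ.prod π₀).map (posn T) := fun T hT => by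
    rw [← Measure.map_congr (hZae T ⟨hT.1.le, hT.2.le⟩)]
    refine (hZf T hT.2).map_eq (ha.isMeanFlow_posn hr hacc hπ hb hT.2)
      (hbr.isRegularField hT.2) hT.1 ?_
    rw [Measure.map_congr (hZae 0 (left_mem_Icc.2 zero_le_one)), map_posn, h0]
  rcases ht.1.eq_or_lt with rfl | ht0
  · exact h0
  rcases ht.2.eq_or_lt with rfl | ht1
  -- The fields are controlled only before time `1`; the laws at `1` are limits of those at `T n`,
  -- by continuity of both paths.
  · rw [← map_posn (π₀ := π₀)]
    let T : ℕ → ℝ := fun n => 1 - 1 / ((n : ℝ) + 2)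
    have hT : ∀ n, T n ∈ Ioo (0 : ℝ) 1 := fun n => by
      have h1 : 0 < 1 / ((n : ℝ) + 2) := by positivity
      have h2 : 1 / ((n : ℝ) + 2) < 1 := by
        rw [div_lt_one (by positivity)]
        linarith [n.cast_nonneg (α := ℝ)]
      exact ⟨by simp only [T]; linarith, by simp only [T]; linarith⟩
    have hTlim : Tendsto T atTop (𝓝 1) := by
      have h1 : Tendsto (fun n : ℕ => (n : ℝ) + 2) atTop atTop :=
        tendsto_atTop_add_const_right _ _ tendsto_natCast_atTop_atTop
      simpa [T] using (tendsto_const_nhds (x := (1 : ℝ))).sub (h1.const_div_atTop 1)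
    have hw : Tendsto T atTop (𝓝[Icc 0 1] 1) :=
      tendsto_nhdsWithin_iff.2 ⟨hTlim, .of_forall fun n => ⟨(hT n).1.le, (hT n).2.le⟩⟩
    exact map_eq_of_tendsto (X := fun n => Z (T n)) (Y := fun n => posn (T n))
      (fun n => h.measurable _ ⟨(hT n).1.le, (hT n).2.le⟩) (fun n => measurable_posn _)
      (h.measurable 1 ht) (measurable_posn 1) (fun n => hlt _ (hT n))
      (h.continuousOn.mono fun ω hω => (hω 1 ht).tendsto.comp hw)
      (.of_forall fun q => ((continuous_lerp q.1.1 q.1.2).tendsto 1).comp hTlim)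
  · rw [hlt t ⟨ht0, ht1⟩, map_posn]

end Coupled

/-! ### Euler sampling is exact in law -/

section EulerSampling

variable {d : ℕ} {γ : Measure (Pt d × Pt d)} {π₀ ρ₀ ρ₁ : Measure (Pt d)} [IsProbabilityMeasure γ]
  [IsProbabilityMeasure π₀] {a : AccField d} {Ω : Type*} [MeasurableSpace Ω] {P : Measure Ω}
  [IsProbabilityMeasure P] {N : ℕ} {s : ℕ → ℝ} {Z : ℝ → Ω → Pt d} {U : ℕ → ℝ → Ω → Pt d}

lemma IsEulerGenerated.grid_mono (h : IsEulerGenerated P ρ₀ π₀ a N s Z U) {k m : ℕ} (hkm : k ≤ m)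
    (hm : m ≤ N) : s k ≤ s m := by
  induction m, hkm using Nat.le_induction with
  | base => exact le_rfl
  | succ m _ ih => exact (ih (by omega)).trans (h.grid_lt m (by omega)).le

lemma IsEulerGenerated.grid_mem (h : IsEulerGenerated P ρ₀ π₀ a N s Z U) {k : ℕ} (hk : k < N) :
    s k ∈ Ico (0 : ℝ) 1 := by
  refine ⟨h.grid_zero ▸ h.grid_mono k.zero_le hk.le, ?_⟩
  have := h.grid_mono (Nat.succ_le_of_lt hk) le_rfl
  rw [h.grid_last] at this
  exact (h.grid_lt k hk).trans_le this

/-- The joint law of location and generated velocity is that of `(X_s, X_1 - X_0)`, and moving `X_s`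
along the straight line with velocity `X_1 - X_0` for a time `t - s` gives `X_t` exactly. The
marginal law of the velocity alone would not suffice. -/
lemma IsEulerGenerated.map_step (h : IsEulerGenerated P ρ₀ π₀ a N s Z U) (ha : IsTrained γ π₀ a)
    (hr : IsRegularAcc a) (hacc : MemLp accel 2 (γ.prod π₀)) {k : ℕ} (hk : k < N)
    (hlaw : P.map (Z (s k)) = interpLaw γ (s k)) {t : ℝ} (ht : t ∈ Icc (s k) (s (k + 1))) :
    P.map (Z t) = interpLaw γ t := by
  have hs := h.grid_mem hk
  have hZ := h.measurable _ ⟨hs.1, hs.2.le⟩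
  have hU : Measurable (U k 1) := (h.velocity k hk).measurable 1 (right_mem_Icc.2 zero_le_one)
  have hstep : Measurable fun x : Pt d × Pt d => x.1 + (t - s k) • x.2 := by fun_prop
  have hpair : Measurable fun p : Pt d × Pt d => (lerp (s k) p.1 p.2, p.2 - p.1) := by
    unfold lerp; fun_prop
  have h1 := congrArg (Measure.map fun x : Pt d × Pt d => x.1 + (t - s k) • x.2)
    (ha.map_velocitySample hr hacc hs hZ hlaw (h.velocity k hk))
  rw [Measure.map_map hstep (hZ.prodMk hU), Measure.map_map hstep hpair] at h1
  rw [Measure.map_congr (h.position k hk t ht)]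
  refine h1.trans ?_
  rw [interpLaw]
  congr 1
  ext1 p
  simp only [Function.comp_apply, lerp]
  module

/-- The Euler scheme for the position ODE preserves the marginals. -/
theorem IsEulerGenerated.map_eq (h : IsEulerGenerated P ρ₀ π₀ a N s Z U)
    (hc : IsCoupling ρ₀ ρ₁ γ) (ha : IsTrained γ π₀ a) (hr : IsRegularAcc a)
    (hacc : MemLp accel 2 (γ.prod π₀)) {t : ℝ} (ht : t ∈ Icc (0 : ℝ) 1) :
    P.map (Z t) = interpLaw γ t := by
  have hgrid : ∀ k ≤ N, P.map (Z (s k)) = interpLaw γ (s k) := by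
    intro k hk
    induction k with
    | zero => rw [h.grid_zero, h.law_zero, interpLaw_zero hc]
    | succ k ih =>
      exact h.map_step ha hr hacc hk (ih (by omega)) (right_mem_Icc.2 (h.grid_lt k hk).le)
  have hex : ∀ k ≤ N, t ≤ s k → ∃ m ≤ N, t = s m ∨ (m < N ∧ t ∈ Icc (s m) (s (m + 1))) := by
    intro k hk htk
    induction k with
    | zero => exact ⟨0, hk, .inl (le_antisymm htk (h.grid_zero ▸ ht.1))⟩
    | succ k ih =>
      rcases le_total t (s k) with h1 | h1
      · exact ih (by omega) h1
      · exact ⟨k, by omega, .inr ⟨hk, h1, htk⟩⟩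
  obtain ⟨m, hm, rfl | ⟨hmN, hmt⟩⟩ := hex N le_rfl (h.grid_last ▸ ht.2)
  · exact hgrid m hm
  · exact h.map_step ha hr hacc hmN (hgrid m hm) hmt

end EulerSampling

end HRF

end

theorem theorem2 {d : ℕ} (ρ₀ ρ₁ π₀ : Measure (HRF.Pt d)) [IsProbabilityMeasure ρ₀]
    [IsProbabilityMeasure ρ₁] [IsProbabilityMeasure π₀]
    {Ω : Type*} [MeasurableSpace Ω] (P : Measure Ω) [IsProbabilityMeasure P] :
    -- mini-batch optimal transport induces a joint distribution with the right marginals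
    (∀ (B : ℕ) (c : HRF.Pt d → HRF.Pt d → ℝ)
      (σ : (Fin B → HRF.Pt d) → (Fin B → HRF.Pt d) → Equiv.Perm (Fin B)),
      0 < B → HRF.IsBatchOT B c σ →
        HRF.IsCoupling ρ₀ ρ₁ (HRF.miniBatchCoupling ρ₀ ρ₁ B σ)) ∧
    -- generation with a field trained with any such joint distribution has the marginals of
    -- the linear interpolation
    (∀ (γ : Measure (HRF.Pt d × HRF.Pt d)) (a : HRF.AccField d),
      HRF.IsCoupling ρ₀ ρ₁ γ →
      Integrable (fun p : HRF.Pt d × HRF.Pt d => ‖p.2 - p.1‖ ^ 2) γ →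
      Integrable (fun v : HRF.Pt d => ‖v‖ ^ 2) π₀ →
      HRF.IsTrained γ π₀ a →
      HRF.IsRegularAcc a →
        (∀ (b : HRF.Pt d → ℝ → HRF.Pt d) (Z : ℝ → Ω → HRF.Pt d)
          (U : ℝ → ℝ → Ω → HRF.Pt d),
          HRF.IsMeanVelocity π₀ a b → HRF.IsRegularVel b →
          HRF.IsGenerated P ρ₀ π₀ a Z U →
            ∀ t ∈ Icc (0 : ℝ) 1, P.map (Z t) = HRF.interpLaw γ t) ∧
        (∀ (N : ℕ) (s : ℕ → ℝ) (Z : ℝ → Ω → HRF.Pt d) (U : ℕ → ℝ → Ω → HRF.Pt d),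
          HRF.IsEulerGenerated P ρ₀ π₀ a N s Z U →
            ∀ t ∈ Icc (0 : ℝ) 1, P.map (Z t) = HRF.interpLaw γ t)) := by
  refine ⟨fun B c σ hB h => h.isCoupling_miniBatchCoupling hB, fun γ a hc hγ hπ ha hr => ?_⟩
  -- The total mass of `γ` is that of its first marginal.
  have hγP : IsProbabilityMeasure γ := ⟨by
    have h : γ.map Prod.fst univ = 1 := by rw [hc.fst_eq, measure_univ]
    rwa [Measure.map_apply measurable_fst MeasurableSet.univ, preimage_univ] at h⟩
  have hacc := HRF.memLp_accel hγ hπ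
  exact ⟨fun b Z U hb hbr h t ht => h.map_eq hc ha hr hacc hπ hb hbr ht,
    fun N s Z U h t ht => h.map_eq hc ha hr hacc ht⟩
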